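/- Let $d\in\{2,3\}$ and $\mathbb T^d=\mathbb R^d/\mathbb Z^d$. Let $\eta\in C^\infty(\mathbb R)$ satisfy $0<\lambda\le\eta\le\Lambda<\infty$, let $C\in\mathbb R$, let $f_0(r)=(r^2-1)^2$, and for a function $c$ on $\mathbb T^d$ put $\mu(c)=f_0'(c)-C\,\Delta c$. For $\sigma\ge 0$ let $\|u\|_{H^\sigma}^2=\sum_{k\in\mathbb Z^d}(1+|k|^2)^\sigma|\hat u(k)|^2$. Let $s\ge 0$. There is an increasing function $\mathcal F:[0,\infty)\to[0,\infty)$, depending only on $d$, $s$, $\eta$ and $C$, such that for every real-valued $c\in H^{s+2}(\mathbb T^d)$ and every real-valued $p\in C^\infty(\mathbb T^d)$ satisfying $$\operatorname{div}\Big(\frac1{\eta(c)}\nabla p\Big)=\operatorname{div}\Big(\frac1{\eta(c)}\,\mu(c)\nabla c\Big)$$ on $\mathbb T^d$ in the sense of distributions, one has $$\|\nabla p\|_{H^s}\le \mathcal F(\|c\|_{L^\infty})\,\big(1+\|\nabla c\|_{L^\infty}\big)\,\big(1+\|c\|_{H^2}\big)^{[2s]+1}\,\|c\|_{H^{s+2}},$$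 where $[2s]$ is the integer part of $2s$ (the right-hand side is $+\infty$ if $\nabla c\notin L^\infty$). -/

import Mathlib

open MeasureTheory
open scoped ENNReal NNReal ContDiff ComplexConjugate

noncomputable section

namespace HeleShaw

/-- The `d`-dimensional flat torus `ℝ^d / ℤ^d`. -/
abbrev Torus (d : ℕ) : Type := UnitAddTorus (Fin d)

/-- Lebesgue measure on the torus, of total mass one: the product of the Haar probability
measures of the factors `ℝ / ℤ`. -/
abbrev torusMeasure (d : ℕ) : Measure (Torus d) :=
  Measure.pi (fun _ : Fin d => (AddCircle.haarAddCircle : Measure UnitAddCircle))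

variable {d : ℕ} {E : Type*} [NormedAddCommGroup E] [NormedSpace ℝ E]

/-- `C^∞` functions on the torus: the `ℤ^d`-periodic lift to `ℝ^d` is `C^∞`. -/
def IsSmooth (f : Torus d → E) : Prop :=
  ContDiff ℝ ∞ (fun y : Fin d → ℝ => f (fun i => (y i : UnitAddCircle)))

/-- The classical partial derivative `∂ᵢ f` of a function on the torus. -/
def partialDeriv (i : Fin d) (f : Torus d → E) (x : Torus d) : E :=
  deriv (fun t : ℝ => f (x + Pi.single i (t : UnitAddCircle))) 0

/-- The classical gradient of a real function on the torus. -/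
def grad (f : Torus d → ℝ) (x : Torus d) : EuclideanSpace ℝ (Fin d) :=
  WithLp.toLp 2 (fun i => partialDeriv i f x)

/-- `g ∈ L²` is the weak (distributional) partial derivative `∂ᵢ f`. -/
def HasWeakPartial (i : Fin d) (f g : Torus d → ℝ) : Prop :=
  MemLp g 2 (torusMeasure d) ∧
    ∀ φ : Torus d → ℝ, IsSmooth φ →
      ∫ x, f x * partialDeriv i φ x ∂(torusMeasure d) = - ∫ x, g x * φ x ∂(torusMeasure d)

open Classical in
/-- The weak partial derivative `∂ᵢ f` (unique up to null sets), and zero if `f` has none in `L²`.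
For `f` in `H^1` it exists, see `hasWeakPartial_weakPartial`. -/
def weakPartial (i : Fin d) (f : Torus d → ℝ) : Torus d → ℝ :=
  if h : ∃ g, HasWeakPartial i f g then h.choose else 0

/-- The weak gradient of a real function on the torus. -/
def weakGrad (f : Torus d → ℝ) (x : Torus d) : EuclideanSpace ℝ (Fin d) :=
  WithLp.toLp 2 (fun i => weakPartial i f x)

/-- The weak Laplacian `∑ᵢ ∂ᵢ ∂ᵢ f`. -/
def weakLaplacian (f : Torus d → ℝ) (x : Torus d) : ℝ :=
  ∑ i, weakPartial i (weakPartial i f) x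

/-- The `H^s` norm `(∑ₖ (1 + |k|²)^s |f̂(k)|²)^{1/2}`, where
`f̂(k) = ∫ f(x) e^{-2π i k·x} dx`, with values in `[0, ∞]`. -/
def sobolevNorm (s : ℝ) (f : Torus d → ℝ) : ℝ≥0∞ :=
  (∑' k : Fin d → ℤ, ENNReal.ofReal ((1 + ∑ i, (k i : ℝ) ^ 2) ^ s) *
    ‖UnitAddTorus.mFourierCoeff (fun x => (f x : ℂ)) k‖ₑ ^ 2) ^ (1 / 2 : ℝ)

/-- The `H^s` norm of a vector field. -/
def sobolevNormVec (s : ℝ) (V : Torus d → EuclideanSpace ℝ (Fin d)) : ℝ≥0∞ :=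
  (∑ i, sobolevNorm s (fun x => V x i) ^ 2) ^ (1 / 2 : ℝ)

/-- Membership in `H^s` (for `s ≥ 0`, so that `H^s ⊆ L²`). -/
def MemSobolev (s : ℝ) (f : Torus d → ℝ) : Prop :=
  MemLp f 2 (torusMeasure d) ∧ sobolevNorm s f < ⊤

/-- The double well potential `f₀`. -/
def doubleWell (r : ℝ) : ℝ := (r ^ 2 - 1) ^ 2

/-- The chemical potential `μ(c) = f₀'(c) - C Δc`. -/
def chemPotential (C : ℝ) (c : Torus d → ℝ) (x : Torus d) : ℝ :=
  deriv doubleWell (c x) - C * weakLaplacian c x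

/-- `p` is a smooth solution of `div (η(c)⁻¹ ∇p) = div (η(c)⁻¹ μ(c) ∇c)` on the torus, the equation
being understood in the sense of distributions (`c` need not be smooth). -/
def IsSmoothPressure (η : ℝ → ℝ) (C : ℝ) (c p : Torus d → ℝ) : Prop :=
  IsSmooth p ∧ ∀ φ : Torus d → ℝ, IsSmooth φ →
    ∫ x, (η (c x))⁻¹ * inner ℝ (grad p x) (grad φ x) ∂(torusMeasure d) =
      ∫ x, (η (c x))⁻¹ * chemPotential C c x * inner ℝ (weakGrad c x) (grad φ x)
        ∂(torusMeasure d)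

/-! Existence of the weak derivatives of Sobolev functions. -/

lemma continuous_lift : Continuous (fun (y : Fin d → ℝ) (i : Fin d) => (y i : UnitAddCircle)) :=
  continuous_pi fun i => continuous_quotient_mk'.comp (continuous_apply i)

lemma isOpenQuotientMap_lift :
    IsOpenQuotientMap (fun (y : Fin d → ℝ) (i : Fin d) => (y i : UnitAddCircle)) :=
  IsOpenQuotientMap.piMap fun _ => QuotientAddGroup.isOpenQuotientMap_mk

lemma IsSmooth.continuous {f : Torus d → E} (hf : IsSmooth f) : Continuous f :=
  isOpenQuotientMap_lift.isQuotientMap.continuous_iff.2 (ContDiff.continuous hf)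

lemma lift_add_single (y : Fin d → ℝ) (i : Fin d) (t : ℝ) :
    (fun j => (y j : UnitAddCircle)) + Pi.single i (t : UnitAddCircle)
      = fun j => ((y + t • (Pi.single i (1 : ℝ) : Fin d → ℝ)) j : UnitAddCircle) := by
  ext j
  by_cases h : j = i
  · subst h; simp
  · simp [h]

lemma IsSmooth.hasDerivAt {f : Torus d → E} (hf : IsSmooth f) (i : Fin d) (x : Torus d) (t : ℝ) :
    HasDerivAt (fun t : ℝ => f (x + Pi.single i (t : UnitAddCircle)))
      (partialDeriv i f (x + Pi.single i (t : UnitAddCircle))) t := by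
  have key : ∀ x : Torus d, DifferentiableAt ℝ
      (fun t : ℝ => f (x + Pi.single i (t : UnitAddCircle))) 0 := by
    intro x
    obtain ⟨y, rfl⟩ := (isOpenQuotientMap_lift (d := d)).surjective x
    simp_rw [lift_add_single]
    have h1 : Differentiable ℝ (fun y : Fin d → ℝ => f (fun i => (y i : UnitAddCircle))) :=
      ContDiff.differentiable hf (by simp)
    exact (h1.comp (g := fun y : Fin d → ℝ => f (fun i => (y i : UnitAddCircle)))
      (f := fun t : ℝ => y + t • (Pi.single i (1 : ℝ) : Fin d → ℝ)) (by fun_prop)) 0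
  have h2 := (key (x + Pi.single i (t : UnitAddCircle))).hasDerivAt
  have h3 : HasDerivAt (fun u : ℝ => u - t) 1 t := (hasDerivAt_id t).sub_const t
  have h4 := HasDerivAt.scomp_of_eq t h2 h3 (by simp)
  simp only [one_smul] at h4
  refine h4.congr_of_eventuallyEq (Filter.Eventually.of_forall fun u => ?_)
  simp [add_assoc, ← Pi.single_add]

lemma IsSmooth.isSmooth_partialDeriv {f : Torus d → E} (hf : IsSmooth f) (i : Fin d) :
    IsSmooth (partialDeriv i f) := by
  have h1 : Differentiable ℝ (fun y : Fin d → ℝ => f (fun i => (y i : UnitAddCircle))) :=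
    ContDiff.differentiable hf (by simp)
  have : (fun y : Fin d → ℝ => partialDeriv i f (fun j => (y j : UnitAddCircle)))
      = fun y => fderiv ℝ (fun y : Fin d → ℝ => f (fun i => (y i : UnitAddCircle))) y
          (Pi.single i 1) := by
    ext y
    have h2 : HasDerivAt (fun t : ℝ => y + t • (Pi.single i (1 : ℝ) : Fin d → ℝ))
        (Pi.single i 1) 0 := by
      simpa using ((hasDerivAt_id (0 : ℝ)).smul_const (Pi.single i (1 : ℝ) : Fin d → ℝ)).const_add y
    have h3 := (h1 y).hasFDerivAt.comp_hasDerivAt_of_eq (0 : ℝ) h2 (by simp)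
    unfold partialDeriv
    simp_rw [lift_add_single]
    exact h3.deriv
  unfold IsSmooth
  rw [this]
  exact (ContDiff.fderiv_right hf (m := ∞) (by simp)).clm_apply contDiff_const

lemma mFourier_add_single (k : Fin d → ℤ) (x : Torus d) (i : Fin d) (t : ℝ) :
    UnitAddTorus.mFourier k (x + Pi.single i (t : UnitAddCircle))
      = Complex.exp (2 * Real.pi * Complex.I * k i * t) * UnitAddTorus.mFourier k x := by
  simp only [UnitAddTorus.mFourier, ContinuousMap.coe_mk, Pi.add_apply]
  have : ∀ j, fourier (k j) (x j + (Pi.single i (t : UnitAddCircle) : Torus d) j)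
      = fourier (k j) (x j) * (if j = i then Complex.exp (2 * Real.pi * Complex.I * k i * t)
          else 1) := by
    intro j
    by_cases h : j = i
    · subst h
      have := fourier_coe_apply (T := (1 : ℝ)) (n := k j) (x := t)
      simp only [fourier_apply, zsmul_add, AddCircle.toCircle_add] at this ⊢
      simp [this]
    · simp [h]
  simp_rw [this, Finset.prod_mul_distrib]
  simp [mul_comm]

lemma isSmooth_mFourier (k : Fin d → ℤ) :
    IsSmooth (fun x : Torus d => UnitAddTorus.mFourier k x) := by
  unfold IsSmooth
  simp only [UnitAddTorus.mFourier, ContinuousMap.coe_mk, fourier_coe_apply]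
  refine contDiff_prod fun i _ => ?_
  refine ContDiff.cexp ?_
  have : ContDiff ℝ ∞ (fun y : Fin d → ℝ => ((y i : ℝ) : ℂ)) :=
    Complex.ofRealCLM.contDiff.comp (contDiff_apply ℝ ℝ i)
  exact (contDiff_const.mul this).div_const _

lemma partialDeriv_mFourier (i : Fin d) (k : Fin d → ℤ) (x : Torus d) :
    partialDeriv i (fun x : Torus d => UnitAddTorus.mFourier k x) x
      = 2 * Real.pi * Complex.I * k i * UnitAddTorus.mFourier k x := by
  unfold partialDeriv
  simp_rw [mFourier_add_single]
  have h : HasDerivAt (fun t : ℝ => Complex.exp (2 * Real.pi * Complex.I * k i * t))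
      (2 * Real.pi * Complex.I * k i) 0 := by
    have h0 : HasDerivAt (fun t : ℝ => 2 * Real.pi * Complex.I * k i * (t : ℂ))
        (2 * Real.pi * Complex.I * k i) 0 := by
      simpa using (Complex.ofRealCLM.hasDerivAt (x := (0 : ℝ))).const_mul
        (2 * Real.pi * Complex.I * k i)
    simpa using h0.cexp
  exact (h.mul_const _).deriv

lemma integrable_of_continuous {f : Torus d → ℂ} (hf : Continuous f) :
    Integrable f (torusMeasure d) :=
  hf.integrable_of_hasCompactSupport (HasCompactSupport.of_compactSpace _)

lemma integral_partialDeriv_eq_zero {f : Torus d → ℂ} (hf : IsSmooth f)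
    (i : Fin d) : ∫ x, partialDeriv i f x ∂(torusMeasure d) = 0 := by
  have hcont : Continuous (partialDeriv i f) := (hf.isSmooth_partialDeriv i).continuous
  obtain ⟨B, hB⟩ := isCompact_univ.exists_bound_of_continuousOn hcont.continuousOn
  have hc : ∀ (g : Torus d → ℂ), Continuous g → ∀ t : ℝ,
      Continuous fun x : Torus d => g (x + Pi.single i (t : UnitAddCircle)) :=
    fun g hg t => hg.comp (by fun_prop)
  let G : ℝ → Torus d → ℂ := fun t x => f (x + Pi.single i (t : UnitAddCircle))
  let G' : ℝ → Torus d → ℂ := fun t x => partialDeriv i f (x + Pi.single i (t : UnitAddCircle))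
  have hG0 : Continuous (G 0) := hc f hf.continuous 0
  have hG1 : ∀ᶠ t in nhds (0 : ℝ), AEStronglyMeasurable (G t) (torusMeasure d) :=
    Filter.Eventually.of_forall fun t => (hc f hf.continuous t).aestronglyMeasurable
  have hG2 : Integrable (G 0) (torusMeasure d) := integrable_of_continuous hG0
  have hG3 : AEStronglyMeasurable (G' 0) (torusMeasure d) := (hc _ hcont 0).aestronglyMeasurable
  have hG4 : ∀ᵐ x ∂(torusMeasure d), ∀ t ∈ Set.univ, ‖G' t x‖ ≤ B :=
    Filter.Eventually.of_forall fun x t _ => hB _ (Set.mem_univ _)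
  have hG5 : ∀ᵐ x ∂(torusMeasure d), ∀ t ∈ Set.univ, HasDerivAt (fun t => G t x) (G' t x) t :=
    Filter.Eventually.of_forall fun x t _ => hf.hasDerivAt i x t
  have h2 := (hasDerivAt_integral_of_dominated_loc_of_deriv_le (μ := torusMeasure d) (F := G)
    (F' := G') (bound := fun _ => B) Filter.univ_mem hG1 hG2 hG3 hG4 (integrable_const B) hG5).2
  have e : ∀ t : ℝ, ∫ x, G t x ∂(torusMeasure d) = ∫ x, f x ∂(torusMeasure d) :=
    fun t => integral_add_right_eq_self (μ := torusMeasure d) f (Pi.single i (t : UnitAddCircle))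
  have e' : ∫ x, G' 0 x ∂(torusMeasure d) = ∫ x, partialDeriv i f x ∂(torusMeasure d) :=
    integral_add_right_eq_self (μ := torusMeasure d) (partialDeriv i f)
      (Pi.single i ((0 : ℝ) : UnitAddCircle))
  rw [e'] at h2
  simp_rw [e] at h2
  exact h2.unique (hasDerivAt_const _ _)

lemma IsSmooth.mul {f g : Torus d → ℂ} (hf : IsSmooth f) (hg : IsSmooth g) :
    IsSmooth (fun x => f x * g x) :=
  ContDiff.mul hf hg

lemma IsSmooth.hasDerivAt_zero {f : Torus d → E} (hf : IsSmooth f) (i : Fin d) (x : Torus d) :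
    HasDerivAt (fun t : ℝ => f (x + Pi.single i (t : UnitAddCircle))) (partialDeriv i f x) 0 := by
  simpa using hf.hasDerivAt i x 0

lemma IsSmooth.clm_comp {E' : Type*} [NormedAddCommGroup E'] [NormedSpace ℝ E'] (L : E →L[ℝ] E')
    {f : Torus d → E} (hf : IsSmooth f) : IsSmooth (fun x => L (f x)) :=
  L.contDiff.comp hf

lemma partialDeriv_clm_comp {E' : Type*} [NormedAddCommGroup E'] [NormedSpace ℝ E']
    (L : E →L[ℝ] E') {f : Torus d → E} (hf : IsSmooth f) (i : Fin d) (x : Torus d) :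
    partialDeriv i (fun x => L (f x)) x = L (partialDeriv i f x) :=
  (L.hasFDerivAt.comp_hasDerivAt (0 : ℝ) (hf.hasDerivAt_zero i x)).deriv

lemma mFourierCoeff_def (f : Torus d → ℂ) (k : Fin d → ℤ) :
    UnitAddTorus.mFourierCoeff f k
      = ∫ x, UnitAddTorus.mFourier (-k) x * f x ∂(torusMeasure d) := rfl

lemma mFourierCoeff_partialDeriv {f : Torus d → ℂ} (hf : IsSmooth f) (i : Fin d)
    (k : Fin d → ℤ) :
    UnitAddTorus.mFourierCoeff (partialDeriv i f) k
      = 2 * Real.pi * Complex.I * k i * UnitAddTorus.mFourierCoeff f k := by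
  have hk := isSmooth_mFourier (d := d) (-k)
  have h0 := integral_partialDeriv_eq_zero (hk.mul hf) i
  have h1 : ∀ x, partialDeriv i (fun x => UnitAddTorus.mFourier (-k) x * f x) x
      = UnitAddTorus.mFourier (-k) x * partialDeriv i f x
        - 2 * Real.pi * Complex.I * k i * (UnitAddTorus.mFourier (-k) x * f x) := by
    intro x
    have := ((hk.hasDerivAt_zero i x).mul (hf.hasDerivAt_zero i x)).deriv
    rw [partialDeriv_mFourier] at this
    simp only [QuotientAddGroup.mk_zero, Pi.single_zero, add_zero] at this
    unfold partialDeriv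
    refine this.trans ?_
    rw [partialDeriv]
    push_cast [Pi.neg_apply]
    ring
  simp_rw [h1] at h0
  have i1 : Integrable (fun x => UnitAddTorus.mFourier (-k) x * partialDeriv i f x)
      (torusMeasure d) :=
    integrable_of_continuous (hk.continuous.mul (hf.isSmooth_partialDeriv i).continuous)
  have i2 : Integrable (fun x => UnitAddTorus.mFourier (-k) x * f x) (torusMeasure d) :=
    integrable_of_continuous (hk.continuous.mul hf.continuous)
  rw [integral_sub i1 (i2.const_mul _),
    integral_const_mul, sub_eq_zero] at h0
  rw [mFourierCoeff_def, mFourierCoeff_def, h0]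

/-- Weak differentiation is multiplication by `2π i kᵢ` on the Fourier side. -/
lemma HasWeakPartial.mFourierCoeff {f g : Torus d → ℝ} {i : Fin d} (h : HasWeakPartial i f g)
    (hf : Integrable f (torusMeasure d)) (k : Fin d → ℤ) :
    UnitAddTorus.mFourierCoeff (fun x => (g x : ℂ)) k
      = 2 * Real.pi * Complex.I * k i * UnitAddTorus.mFourierCoeff (fun x => (f x : ℂ)) k := by
  have hk := isSmooth_mFourier (d := d) (-k)
  have hg : Integrable g (torusMeasure d) := h.1.integrable (by norm_num)
  have key : ∀ u : Torus d → ℂ, IsSmooth u →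
      ∫ x, (f x : ℂ) * partialDeriv i u x ∂(torusMeasure d)
        = - ∫ x, (g x : ℂ) * u x ∂(torusMeasure d) := by
    intro u hu
    have hi : ∀ (a : Torus d → ℝ) (v : Torus d → ℂ), Integrable a (torusMeasure d) →
        Continuous v → Integrable (fun x => (a x : ℂ) * v x) (torusMeasure d) := by
      intro a v ha hv
      obtain ⟨B, hB⟩ := isCompact_univ.exists_bound_of_continuousOn hv.continuousOn
      exact ha.ofReal.mul_bdd (c := B) hv.aestronglyMeasurable
        (Filter.Eventually.of_forall fun x => hB x (Set.mem_univ x))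
    have i1 := hi f _ hf (hu.isSmooth_partialDeriv i).continuous
    have i2 := hi g _ hg hu.continuous
    have r := h.2 _ (hu.clm_comp Complex.reCLM)
    have m := h.2 _ (hu.clm_comp Complex.imCLM)
    simp_rw [partialDeriv_clm_comp _ hu] at r m
    apply Complex.ext
    · rw [Complex.neg_re]
      have a := integral_re i1
      have b := integral_re i2
      simp only [RCLike.re_eq_complex_re, Complex.re_ofReal_mul] at a b
      rw [← a, ← b]
      simpa using r
    · rw [Complex.neg_im]
      have a := integral_im i1
      have b := integral_im i2
      simp only [RCLike.im_eq_complex_im, Complex.im_ofReal_mul] at a b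
      rw [← a, ← b]
      simpa using m
  have h1 := key _ hk
  simp_rw [partialDeriv_mFourier] at h1
  rw [mFourierCoeff_def, mFourierCoeff_def, ← integral_const_mul]
  have h2 : ∫ x, UnitAddTorus.mFourier (-k) x * (g x : ℂ) ∂(torusMeasure d)
      = ∫ x, (g x : ℂ) * UnitAddTorus.mFourier (-k) x ∂(torusMeasure d) := by
    simp_rw [mul_comm]
  rw [h2, ← neg_eq_iff_eq_neg.2 h1, ← integral_neg]
  refine integral_congr_ae (Filter.Eventually.of_forall fun x => ?_)
  simp only [Pi.neg_apply]
  push_cast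
  ring

lemma sobolevNorm_lt_top_iff (s : ℝ) (f : Torus d → ℝ) :
    sobolevNorm s f < ⊤ ↔
      (∑' k : Fin d → ℤ, ENNReal.ofReal ((1 + ∑ i, (k i : ℝ) ^ 2) ^ s) *
        ‖UnitAddTorus.mFourierCoeff (fun x => (f x : ℂ)) k‖ₑ ^ 2) < ⊤ := by
  unfold sobolevNorm
  rw [ENNReal.rpow_lt_top_iff_of_pos (by norm_num)]

lemma weight_mul_le (s : ℝ) (i : Fin d) (k : Fin d → ℤ) (z : ℂ) :
    ENNReal.ofReal ((1 + ∑ i, (k i : ℝ) ^ 2) ^ s) *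
        ‖2 * Real.pi * Complex.I * k i * z‖ₑ ^ 2
      ≤ ENNReal.ofReal (4 * Real.pi ^ 2) *
        (ENNReal.ofReal ((1 + ∑ i, (k i : ℝ) ^ 2) ^ (s + 1)) * ‖z‖ₑ ^ 2) := by
  have hsum : (k i : ℝ) ^ 2 ≤ ∑ i, (k i : ℝ) ^ 2 :=
    Finset.single_le_sum (f := fun i => (k i : ℝ) ^ 2) (fun _ _ => sq_nonneg _)
      (Finset.mem_univ i)
  have hpos : 0 < 1 + ∑ i, (k i : ℝ) ^ 2 := by
    have := sq_nonneg (k i : ℝ)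
    linarith
  rw [← ofReal_norm, ← ofReal_norm, ← ENNReal.ofReal_pow (norm_nonneg _),
    ← ENNReal.ofReal_pow (norm_nonneg _), ← ENNReal.ofReal_mul (by positivity),
    ← ENNReal.ofReal_mul (by positivity), ← ENNReal.ofReal_mul (by positivity)]
  apply ENNReal.ofReal_le_ofReal
  rw [Real.rpow_add_one hpos.ne']
  have hn : ‖2 * Real.pi * Complex.I * k i * z‖ ^ 2
      = 4 * Real.pi ^ 2 * (k i : ℝ) ^ 2 * ‖z‖ ^ 2 := by
    simp only [norm_mul, Complex.norm_I, Complex.norm_real, Complex.norm_intCast,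
      Complex.norm_ofNat, Real.norm_eq_abs, mul_pow, sq_abs]
    ring
  rw [hn]
  have hw : 0 ≤ (1 + ∑ i, (k i : ℝ) ^ 2) ^ s := by positivity
  have : (k i : ℝ) ^ 2 ≤ 1 + ∑ i, (k i : ℝ) ^ 2 := by linarith
  calc (1 + ∑ i, (k i : ℝ) ^ 2) ^ s * (4 * Real.pi ^ 2 * (k i : ℝ) ^ 2 * ‖z‖ ^ 2)
      = (4 * Real.pi ^ 2) * ((1 + ∑ i, (k i : ℝ) ^ 2) ^ s * (k i : ℝ) ^ 2 * ‖z‖ ^ 2) := by ring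
    _ ≤ _ := by gcongr

/-- A function in `H^1` has weak partial derivatives. -/
lemma exists_hasWeakPartial {f : Torus d → ℝ} (hf : MemSobolev 1 f) (i : Fin d) :
    ∃ g, HasWeakPartial i f g := by
  set a : (Fin d → ℤ) → ℂ := fun k => 2 * Real.pi * Complex.I * k i *
    UnitAddTorus.mFourierCoeff (fun x => (f x : ℂ)) k with ha
  have hsum : ∑' k, ‖a k‖ₑ ^ 2 < ⊤ := by
    refine lt_of_le_of_lt (ENNReal.tsum_le_tsum fun k => ?_)
      ((ENNReal.tsum_mul_left (a := ENNReal.ofReal (4 * Real.pi ^ 2))).trans_lt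
        (ENNReal.mul_lt_top ENNReal.ofReal_lt_top ((sobolevNorm_lt_top_iff 1 f).1 hf.2)))
    simpa [ha] using weight_mul_le 0 i k (UnitAddTorus.mFourierCoeff (fun x => (f x : ℂ)) k)
  have hmem : Memℓp a 2 := by
    refine memℓp_gen ?_
    simpa using ENNReal.summable_toReal hsum.ne
  obtain ⟨G, hG⟩ := (UnitAddTorus.mFourierBasis (d := Fin d)).repr.surjective
    (⟨a, hmem⟩ : lp (fun _ : Fin d → ℤ => ℂ) 2)
  have hGc : ∀ k, UnitAddTorus.mFourierCoeff G k = a k := by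
    intro k
    rw [← UnitAddTorus.mFourierBasis_repr, hG]
  have hGm : MemLp (G : Torus d → ℂ) 2 (torusMeasure d) := Lp.memLp G
  have hfm : MemLp (fun x => (f x : ℂ)) 2 (torusMeasure d) := hf.1.ofReal
  refine ⟨fun x => (G x).re, hGm.re, fun φ hφ => ?_⟩
  have hφ' : IsSmooth (fun x => (φ x : ℂ)) := hφ.clm_comp Complex.ofRealCLM
  have hD : ∀ x, partialDeriv i (fun x => (φ x : ℂ)) x = ((partialDeriv i φ x : ℝ) : ℂ) :=
    fun x => partialDeriv_clm_comp Complex.ofRealCLM hφ i x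
  have hm : ∀ {u : Torus d → ℂ}, IsSmooth u → MemLp u 2 (torusMeasure d) := by
    intro u hu
    obtain ⟨B, hB⟩ := isCompact_univ.exists_bound_of_continuousOn hu.continuous.continuousOn
    exact MemLp.of_bound hu.continuous.aestronglyMeasurable B
      (Filter.Eventually.of_forall fun x => hB x (Set.mem_univ x))
  have pars : ∀ {u v : Torus d → ℂ}, MemLp u 2 (torusMeasure d) → MemLp v 2 (torusMeasure d) →
      HasSum (fun k => conj (UnitAddTorus.mFourierCoeff u k) * UnitAddTorus.mFourierCoeff v k)
        (∫ x, conj (u x) * v x ∂(torusMeasure d)) := by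
    intro u v hu hv
    have hc : ∀ {w : Torus d → ℂ} (hw : MemLp w 2 (torusMeasure d)) k,
        UnitAddTorus.mFourierCoeff (hw.toLp w) k = UnitAddTorus.mFourierCoeff w k := by
      intro w hw k
      rw [mFourierCoeff_def, mFourierCoeff_def]
      refine integral_congr_ae ?_
      filter_upwards [hw.coeFn_toLp] with x hx
      rw [hx]
    have := UnitAddTorus.hasSum_prod_mFourierCoeff (hu.toLp u) (hv.toLp v)
    simp_rw [hc] at this
    convert! this using 1
    refine integral_congr_ae ?_
    filter_upwards [hu.coeFn_toLp, hv.coeFn_toLp] with x hx hy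
    rw [hx, hy]
  have p1 := pars hfm (hm (hφ'.isSmooth_partialDeriv i))
  have p2 := (pars hGm (hm hφ')).neg
  have e : ∫ x, conj (f x : ℂ) * partialDeriv i (fun x => (φ x : ℂ)) x ∂(torusMeasure d)
      = - ∫ x, conj (G x) * (φ x : ℂ) ∂(torusMeasure d) := by
    refine p1.unique ?_
    convert! p2 using 2 with k
    rw [hGc, mFourierCoeff_partialDeriv hφ', ha]
    simp only [map_mul, Complex.conj_I, Complex.conj_ofReal, map_ofNat, map_intCast]
    ring
  have int2 : Integrable (fun x => conj (G x) * (φ x : ℂ)) (torusMeasure d) :=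
    hGm.star.integrable_mul (hm hφ')
  have e2 := congrArg Complex.re e
  have r2 := integral_re int2
  simp only [RCLike.re_eq_complex_re, Complex.re_mul_ofReal, Complex.conj_re] at r2
  rw [Complex.neg_re, ← r2] at e2
  rw [← e2]
  simp_rw [hD, Complex.conj_ofReal, ← Complex.ofReal_mul]
  rw [integral_complex_ofReal, Complex.ofReal_re]

/-- For `f` in `H^{s+1}`, `s ≥ 0`, the function `weakPartial i f` is the weak partial derivative
of `f`, and it belongs to `H^s`. -/
lemma hasWeakPartial_weakPartial {s : ℝ} (hs : 0 ≤ s) {f : Torus d → ℝ}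
    (hf : MemSobolev (s + 1) f) (i : Fin d) :
    HasWeakPartial i f (weakPartial i f) ∧ MemSobolev s (weakPartial i f) := by
  have hf1 : MemSobolev 1 f := by
    refine ⟨hf.1, (sobolevNorm_lt_top_iff 1 f).2 (lt_of_le_of_lt (ENNReal.tsum_le_tsum fun k => ?_)
      ((sobolevNorm_lt_top_iff (s + 1) f).1 hf.2))⟩
    have : (1 : ℝ) ≤ 1 + ∑ i, (k i : ℝ) ^ 2 :=
      le_add_of_nonneg_right (Finset.sum_nonneg fun _ _ => sq_nonneg _)
    gcongr
    linarith
  have h : HasWeakPartial i f (weakPartial i f) := by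
    have hex := exists_hasWeakPartial hf1 i
    rw [weakPartial, dif_pos hex]
    exact hex.choose_spec
  refine ⟨h, h.1, (sobolevNorm_lt_top_iff s _).2 ?_⟩
  refine lt_of_le_of_lt (ENNReal.tsum_le_tsum fun k => ?_)
      ((ENNReal.tsum_mul_left (a := ENNReal.ofReal (4 * Real.pi ^ 2))).trans_lt
        (ENNReal.mul_lt_top ENNReal.ofReal_lt_top ((sobolevNorm_lt_top_iff (s + 1) f).1 hf.2)))
  rw [h.mFourierCoeff (hf.1.integrable (by norm_num)) k]
  exact weight_mul_le s i k _

end HeleShaw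

end

open HeleShaw

/-! Write a = 1/η(c), W = μ(c)∇c and v = ∇p − W. The equation says that a v is divergence free,
while v + W = ∇p is a gradient, so the Fourier coefficients of v + W and of a v are orthogonal in
ℂ^d at every frequency. Pairing the two fields and using a ≥ 1/Λ gives ‖v‖_{L²} ≲ ‖W‖_{L²}
(`energy_inequality`).

For H^s, put J = (1 − Δ)^{s/2}. The orthogonality survives multiplication by (1 + |k|²)^s, so the
same energy argument applies to Jv and JW, with the commutator [J, a]v as error. The symbol of that
commutator satisfies |⟨k⟩^s − ⟨m⟩^s| ≲ ⟨k−m⟩^θ⟨m⟩^{s−θ} + ⟨k−m⟩^{s+ρ}⟨m⟩^{−ρ}. In the first term the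
factor depending on a is measured in ℓ¹ on the Fourier side. This is controlled by its H² norm as
soon as 2(2 − θ) > d, and for d ≤ 3 the condition θ < 1/2 suffices. Hence the choice θ = s/(n+1)
with n = [2s]. Interpolating H^{s−θ} = H^{nθ} between L² and H^s produces a small multiple of
‖v‖_{H^s}, which is absorbed, plus ‖c‖_{H²}^{n+1}‖v‖_{L²}. Choosing ρ = 2 − θ in the second term
leaves ‖1/η(c) − 1/η(0)‖_{H^{2+nθ}}‖v‖_{L²}. Absorption is legitimate because p is smooth, so that
‖v‖_{H^s} is known in advance to be finite.

Three further estimates feed this argument. Composition (`hn_two_comp_le`, `hn_comp_le`): B(c) is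
bounded in H² linearly in ‖c‖_{H²}, by Gagliardo–Nirenberg, and each gain of θ derivatives costs one
factor 1 + ‖c‖_{H²}; hence ‖B(c)‖_{H^{2+nθ}} ≲ (1 + ‖c‖_{H²})^n ‖c‖_{H^{2+nθ}}. Products
(`hn_mul_le`): H^σ ∩ L^∞ is an algebra with the tame bound, proved by de la Vallée-Poussin means in
place of a paraproduct. Force (`exists_force_le`): W is a sum of derivatives of f₀(c) and of
products ∂ᵢc ∂ⱼc, so the tame product bound yields ‖W‖_{H^s} ≲ (1 + ‖∇c‖_∞)‖c‖_{H^{s+2}}, with no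
power of ‖c‖_{H²}. Together with ‖W‖_{L²} ≲ ‖∇c‖_∞‖c‖_{H²}, counting factors gives the exponent n +
1 = [2s] + 1. -/

noncomputable section

namespace HeleShaw

/-! ### Weighted `ℓ²` norms of sequences with values in `[0, ∞]` -/

/-- The `ℓ²` norm of a family in `[0, ∞]`. -/
def l2 {ι : Type*} (a : ι → ℝ≥0∞) : ℝ≥0∞ := (∑' i, a i ^ 2) ^ (1 / 2 : ℝ)

section Sequences

variable {ι : Type*}

lemma l2_sq (a : ι → ℝ≥0∞) : l2 a ^ 2 = ∑' i, a i ^ 2 := by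
  rw [l2, ← ENNReal.rpow_natCast, ← ENNReal.rpow_mul]
  norm_num

lemma l2_le_iff {a : ι → ℝ≥0∞} {C : ℝ≥0∞} : l2 a ≤ C ↔ ∑' i, a i ^ 2 ≤ C ^ 2 := by
  rw [← l2_sq]
  exact (ENNReal.pow_le_pow_left_iff two_ne_zero).symm

lemma l2_lt_top_iff {a : ι → ℝ≥0∞} : l2 a < ⊤ ↔ ∑' i, a i ^ 2 < ⊤ := by
  rw [← l2_sq, ENNReal.pow_lt_top_iff]
  simp

lemma l2_mono {a b : ι → ℝ≥0∞} (h : ∀ i, a i ≤ b i) : l2 a ≤ l2 b := by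
  rw [l2_le_iff, l2_sq]
  exact ENNReal.tsum_le_tsum fun i => by gcongr; exact h i

lemma le_l2 (a : ι → ℝ≥0∞) (i : ι) : a i ≤ l2 a := by
  have := ENNReal.le_tsum (f := fun i => a i ^ 2) i
  rw [← l2_sq] at this
  exact (ENNReal.pow_le_pow_left_iff two_ne_zero).1 this

lemma l2_const_mul (c : ℝ≥0∞) (a : ι → ℝ≥0∞) : l2 (fun i => c * a i) = c * l2 a := by
  simp only [l2, mul_pow, ENNReal.tsum_mul_left]
  rw [ENNReal.mul_rpow_of_nonneg _ _ (by norm_num), ← ENNReal.rpow_natCast, ← ENNReal.rpow_mul]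
  norm_num

lemma l2_zero : l2 (fun _ : ι => 0) = 0 := by
  simp [l2]

lemma tsum_mul_le_l2 (a b : ι → ℝ≥0∞) : ∑' i, a i * b i ≤ l2 a * l2 b := by
  -- With the discrete σ-algebra every family is measurable, so Hölder's inequality for counting
  -- measure is Cauchy–Schwarz for sums.
  let _ : MeasurableSpace ι := ⊤
  have := ENNReal.lintegral_mul_le_Lp_mul_Lq (Measure.count : Measure ι)
    (Real.HolderConjugate.two_two) (f := a) (g := b) (measurable_from_top.aemeasurable)
    (measurable_from_top.aemeasurable)
  simp only [lintegral_count, Pi.mul_apply, ENNReal.rpow_two] at this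
  exact this

lemma l2_add_le (a b : ι → ℝ≥0∞) : l2 (fun i => a i + b i) ≤ l2 a + l2 b := by
  let _ : MeasurableSpace ι := ⊤
  have := ENNReal.lintegral_Lp_add_le (μ := (Measure.count : Measure ι)) (p := 2)
    (f := a) (g := b) (measurable_from_top.aemeasurable)
    (measurable_from_top.aemeasurable) one_le_two
  simp only [lintegral_count, Pi.add_apply, ENNReal.rpow_two] at this
  exact this

lemma l2_sum_le {κ : Type*} (s : Finset κ) (a : κ → ι → ℝ≥0∞) :
    l2 (fun i => ∑ j ∈ s, a j i) ≤ ∑ j ∈ s, l2 (a j) := by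
  classical
  induction s using Finset.induction_on with
  | empty => simp [l2]
  | insert j s hj ih =>
    simp only [Finset.sum_insert hj]
    exact (l2_add_le _ _).trans (by gcongr)

/-- Young's inequality `ℓ¹ * ℓ² ⊆ ℓ²`. -/
lemma l2_conv_le [AddCommGroup ι] (a b : ι → ℝ≥0∞) :
    l2 (fun k => ∑' m, a (k - m) * b m) ≤ (∑' m, a m) * l2 b := by
  rw [l2_le_iff, mul_pow, l2_sq]
  have h1 : ∀ k, ∑' m, a (k - m) = ∑' m, a m := fun k => (Equiv.subLeft k).tsum_eq a
  -- Cauchy–Schwarz after splitting a = a^{1/2} · a^{1/2}; one half stays with b, the other sums to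
  -- the ℓ¹ norm.
  have key : ∀ k, (∑' m, a (k - m) * b m) ^ 2
      ≤ (∑' m, a m) * ∑' m, a (k - m) * b m ^ 2 := by
    intro k
    have := tsum_mul_le_l2 (fun m => a (k - m) ^ (1 / 2 : ℝ))
      (fun m => a (k - m) ^ (1 / 2 : ℝ) * b m)
    have e : ∀ x : ℝ≥0∞, x ^ (1 / 2 : ℝ) * x ^ (1 / 2 : ℝ) = x := by
      intro x
      rw [← ENNReal.rpow_add_of_nonneg _ _ (by norm_num) (by norm_num)]
      norm_num
    simp_rw [← mul_assoc, e] at this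
    refine (pow_le_pow_left' this 2).trans_eq ?_
    rw [mul_pow, l2_sq, l2_sq]
    simp_rw [mul_pow, pow_two (_ ^ (1 / 2 : ℝ)), e, h1]
  calc _ ≤ ∑' k, (∑' m, a m) * ∑' m, a (k - m) * b m ^ 2 := ENNReal.tsum_le_tsum key
    _ = (∑' m, a m) * ∑' m, ∑' k, a (k - m) * b m ^ 2 := by
        rw [ENNReal.tsum_mul_left, ENNReal.tsum_comm]
    _ = _ := by
        have h2 : ∀ m, ∑' k, a (k - m) = ∑' m, a m := fun m => (Equiv.subRight m).tsum_eq a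
        simp_rw [ENNReal.tsum_mul_right, h2, ENNReal.tsum_mul_left]
        ring

/-- Young's inequality `ℓ² * ℓ¹ ⊆ ℓ²`. -/
lemma l2_conv_le' [AddCommGroup ι] (a b : ι → ℝ≥0∞) :
    l2 (fun k => ∑' m, a (k - m) * b m) ≤ l2 a * ∑' m, b m := by
  rw [mul_comm]
  convert! l2_conv_le b a using 3 with k
  rw [← (Equiv.subLeft k).tsum_eq]
  simp [mul_comm]

end Sequences

/-! ### The weights `(1 + |k|²)^{σ/2}` -/

variable {d : ℕ}

/-- The Japanese bracket `(1 + |k|²)^{1/2}`. -/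
def bracket (k : Fin d → ℤ) : ℝ := Real.sqrt (1 + ∑ i, (k i : ℝ) ^ 2)

/-- The weight `(1 + |k|²)^{σ/2}`. -/
def wt (σ : ℝ) (k : Fin d → ℤ) : ℝ≥0∞ := ENNReal.ofReal (bracket k ^ σ)

lemma bracket_sq (k : Fin d → ℤ) : bracket k ^ 2 = 1 + ∑ i, (k i : ℝ) ^ 2 :=
  Real.sq_sqrt (add_nonneg zero_le_one (Finset.sum_nonneg fun _ _ => sq_nonneg _))

lemma one_le_bracket (k : Fin d → ℤ) : 1 ≤ bracket k :=
  Real.one_le_sqrt.2 (le_add_of_nonneg_right (Finset.sum_nonneg fun _ _ => sq_nonneg _))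

lemma bracket_pos (k : Fin d → ℤ) : 0 < bracket k := zero_lt_one.trans_le (one_le_bracket k)

lemma abs_le_bracket (k : Fin d → ℤ) (i : Fin d) : |(k i : ℝ)| ≤ bracket k := by
  refine Real.abs_le_sqrt ?_
  have := Finset.single_le_sum (f := fun i => (k i : ℝ) ^ 2) (fun _ _ => sq_nonneg _)
    (Finset.mem_univ i)
  linarith

lemma bracket_le_one_add_sum (k : Fin d → ℤ) : bracket k ≤ 1 + ∑ i, |(k i : ℝ)| := by
  refine Real.sqrt_le_iff.2 ⟨by positivity, ?_⟩
  have h0 : 0 ≤ ∑ i, |(k i : ℝ)| := by positivity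
  have h1 : ∑ i, (k i : ℝ) ^ 2 ≤ (∑ i, |(k i : ℝ)|) ^ 2 := by
    have := Finset.sum_sq_le_sq_sum_of_nonneg (s := Finset.univ) (f := fun i => |(k i : ℝ)|)
      (fun _ _ => abs_nonneg _)
    simpa using this
  nlinarith

/-- The bracket is the Euclidean length of (1, k). This makes it Lipschitz: the first coordinates
cancel in a difference, and the reverse triangle inequality gives `abs_bracket_sub_le`. -/
lemma bracket_eq_norm (k : Fin d → ℤ) :
    bracket k = ‖WithLp.toLp 2 ((1 : ℝ), (WithLp.toLp 2 (fun i => (k i : ℝ)) :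
      EuclideanSpace ℝ (Fin d)))‖ := by
  rw [WithLp.prod_norm_eq_of_L2]
  simp [bracket, EuclideanSpace.norm_eq, Real.sq_sqrt, Finset.sum_nonneg, sq_nonneg]

lemma abs_bracket_sub_le (k m : Fin d → ℤ) : |bracket k - bracket m| ≤ bracket (k - m) := by
  rw [bracket_eq_norm k, bracket_eq_norm m]
  refine (abs_norm_sub_norm_le _ _).trans ?_
  rw [WithLp.prod_norm_eq_of_L2]
  refine Real.sqrt_le_sqrt ?_
  simp [EuclideanSpace.norm_eq, Real.sq_sqrt, Finset.sum_nonneg, sq_nonneg]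

lemma wt_zero (k : Fin d → ℤ) : wt 0 k = 1 := by simp [wt]

lemma wt_add (σ τ : ℝ) (k : Fin d → ℤ) : wt (σ + τ) k = wt σ k * wt τ k := by
  rw [wt, wt, wt, ← ENNReal.ofReal_mul (by have := bracket_pos k; positivity),
    Real.rpow_add (bracket_pos k)]

lemma wt_mono {σ τ : ℝ} (h : σ ≤ τ) (k : Fin d → ℤ) : wt σ k ≤ wt τ k :=
  ENNReal.ofReal_le_ofReal (Real.rpow_le_rpow_of_exponent_le (one_le_bracket k) h)

lemma one_le_wt {σ : ℝ} (h : 0 ≤ σ) (k : Fin d → ℤ) : 1 ≤ wt σ k :=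
  (wt_zero k).symm.trans_le (wt_mono h k)

lemma wt_ne_top (σ : ℝ) (k : Fin d → ℤ) : wt σ k ≠ ⊤ := ENNReal.ofReal_ne_top

lemma wt_pow (σ : ℝ) (n : ℕ) (k : Fin d → ℤ) : wt σ k ^ n = wt (n * σ) k := by
  rw [wt, wt, ← ENNReal.ofReal_pow (by have := bracket_pos k; positivity), mul_comm,
    Real.rpow_mul_natCast (bracket_pos k).le]

lemma wt_two (k : Fin d → ℤ) : wt 2 k = ENNReal.ofReal (1 + ∑ i, (k i : ℝ) ^ 2) := by
  rw [wt, Real.rpow_two, bracket_sq]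

lemma ofReal_abs_le_wt (k : Fin d → ℤ) (i : Fin d) : ENNReal.ofReal |(k i : ℝ)| ≤ wt 1 k := by
  rw [wt, Real.rpow_one]
  exact ENNReal.ofReal_le_ofReal (abs_le_bracket k i)

lemma prod_le_bracket_pow (k : Fin d → ℤ) :
    ∏ i, (1 + |(k i : ℝ)|) ≤ (2 * bracket k) ^ d := by
  calc ∏ i, (1 + |(k i : ℝ)|) ≤ ∏ _i : Fin d, (2 * bracket k) :=
        Finset.prod_le_prod (fun i _ => by positivity) fun i _ => by
          linarith [abs_le_bracket k i, one_le_bracket k]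
    _ = _ := by simp

lemma tsum_prod_lt_top (g : ℤ → ℝ≥0∞) (hg : ∑' n, g n < ⊤) (d : ℕ) :
    ∑' k : Fin d → ℤ, ∏ i, g (k i) < ⊤ := by
  induction d with
  | zero => simp
  | succ d ih =>
    rw [← (Fin.consEquiv (fun _ => ℤ)).tsum_eq, ENNReal.tsum_prod']
    simp only [Fin.consEquiv_apply, Fin.prod_univ_succ, Fin.cons_zero, Fin.cons_succ,
      ENNReal.tsum_mul_left, ENNReal.tsum_mul_right]
    exact ENNReal.mul_lt_top hg ih

/-- Since ∏(1 + |kᵢ|) ≤ (2⟨k⟩)^d, the lattice sum is dominated by a product of d one-dimensional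
sums with exponent q = r/d > 1. Dimension zero is separate because of the division by d. -/
lemma tsum_wt_neg_lt_top {r : ℝ} (hr : (d : ℝ) < r) : ∑' k : Fin d → ℤ, wt (-r) k < ⊤ := by
  rcases Nat.eq_zero_or_pos d with rfl | hd
  · simp [tsum_fintype, wt]
  have hd' : (0 : ℝ) < d := by exact_mod_cast hd
  set q : ℝ := r / d with hq
  have hq1 : 1 < q := by rwa [hq, one_lt_div hd']
  have hg : ∑' n : ℤ, ENNReal.ofReal ((1 + |(n : ℝ)|) ^ (-q)) < ⊤ := by
    have hs : Summable fun n : ℤ => (1 + |(n : ℝ)|) ^ (-q) := by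
      have h1 : Summable fun n : ℕ => (1 + (n : ℝ)) ^ (-q) := by
        have := (summable_nat_add_iff 1).2 (Real.summable_nat_rpow.2 (neg_lt_neg hq1))
        refine this.congr fun n => ?_
        push_cast
        rw [add_comm]
      refine Summable.of_nat_of_neg ?_ ?_ <;> simpa using h1
    rw [← ENNReal.ofReal_tsum_of_nonneg (fun n => by positivity) hs]
    exact ENNReal.ofReal_lt_top
  refine lt_of_le_of_lt (ENNReal.tsum_le_tsum fun k => ?_)
    ((ENNReal.tsum_mul_left (a := ENNReal.ofReal (2 ^ r))).trans_lt
      (ENNReal.mul_lt_top ENNReal.ofReal_lt_top (tsum_prod_lt_top _ hg d)))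
  rw [← ENNReal.ofReal_prod_of_nonneg (fun _ _ => by positivity),
    ← ENNReal.ofReal_mul (by positivity), wt]
  apply ENNReal.ofReal_le_ofReal
  have hb := bracket_pos k
  have hP : 0 < ∏ i, (1 + |(k i : ℝ)|) := Finset.prod_pos fun i _ => by positivity
  rw [Real.finsetProd_rpow _ _ (fun i _ => by positivity)]
  have h1 : (2 * bracket k) ^ (-r) ≤ (∏ i, (1 + |(k i : ℝ)|)) ^ (-q) := by
    have e : (2 * bracket k) ^ (-r) = ((2 * bracket k) ^ d) ^ (-q) := by
      rw [← Real.rpow_natCast_mul (by positivity), hq]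
      congr 1
      field_simp
    rw [e]
    exact Real.rpow_le_rpow_of_nonpos hP (prod_le_bracket_pow k) (by linarith)
  rw [Real.mul_rpow (by norm_num) hb.le, Real.rpow_neg (by norm_num : (0 : ℝ) ≤ 2)] at h1
  have h2 : (0 : ℝ) < 2 ^ r := by positivity
  calc bracket k ^ (-r) = 2 ^ r * ((2 ^ r)⁻¹ * bracket k ^ (-r)) := by field_simp
    _ ≤ _ := by gcongr

lemma l2_wt_neg_lt_top {r : ℝ} (hr : (d : ℝ) < 2 * r) : l2 (wt (d := d) (-r)) < ⊤ := by
  rw [l2_lt_top_iff]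
  convert! tsum_wt_neg_lt_top hr using 3 with k
  rw [wt_pow]
  congr 1
  push_cast
  ring

/-! ### The symbol of the commutator -/

/-- For s ≤ 1 because t ≤ t^s, for s ≥ 1 by Bernoulli's inequality; the factor 1 + s serves both
ranges. -/
lemma one_sub_rpow_le {s t : ℝ} (hs : 0 ≤ s) (h0 : 0 ≤ t) (h1 : t ≤ 1) :
    1 - t ^ s ≤ (1 + s) * (1 - t) := by
  rcases le_total s 1 with h | h
  · have := Real.rpow_le_rpow_of_exponent_ge' h0 h1 hs h
    rw [Real.rpow_one] at this
    nlinarith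
  · have := one_add_mul_self_le_rpow_one_add (s := t - 1) (by linarith) h
    rw [add_sub_cancel] at this
    nlinarith

/-- By homogeneity only the ratio t = y/x matters, and 1 − t ≤ (1 − t)^θ because 1 − t lies in [0,
1]. Only a fraction θ of a derivative is moved onto the difference, which is what later keeps the ℓ¹
norm finite. -/
lemma rpow_sub_rpow_le {s θ x y : ℝ} (hθ : 0 ≤ θ) (hθ1 : θ ≤ 1) (hs : 0 ≤ s) (hy : 0 ≤ y)
    (hx : 0 < x) (hyx : y ≤ x) :
    x ^ s - y ^ s ≤ (1 + s) * ((x - y) ^ θ * x ^ (s - θ)) := by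
  set t := y / x with ht
  have ht0 : 0 ≤ t := by positivity
  have ht1 : t ≤ 1 := (div_le_one hx).2 hyx
  have hyt : y = t * x := by rw [ht]; field_simp
  have h1 := one_sub_rpow_le hs ht0 ht1
  have h2 : 1 - t ≤ (1 - t) ^ θ := by
    have := Real.rpow_le_rpow_of_exponent_ge' (x := 1 - t) (by linarith) (by linarith) hθ hθ1
    rwa [Real.rpow_one] at this
  have h3 : (x - y) ^ θ = (1 - t) ^ θ * x ^ θ := by
    rw [← Real.mul_rpow (by linarith) hx.le, hyt]
    ring_nf
  have h4 : x ^ s = x ^ θ * x ^ (s - θ) := by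
    rw [← Real.rpow_add hx]; ring_nf
  have h5 : y ^ s = t ^ s * x ^ s := by rw [hyt, Real.mul_rpow ht0 hx.le]
  have h6 : 0 ≤ x ^ s := by positivity
  calc x ^ s - y ^ s = (1 - t ^ s) * x ^ s := by rw [h5]; ring
    _ ≤ ((1 + s) * (1 - t) ^ θ) * x ^ s := by
        gcongr
        exact h1.trans (by gcongr)
    _ = _ := by rw [h3, h4]; ring

/-- Here x, y, z stand for ⟨k⟩, ⟨m⟩, ⟨k−m⟩. The larger of x and y is at most 2 max(y, z). If z ≤ y
the first term suffices. If y ≤ z everything is bounded by z^s, and inserting (z/y)^ρ ≥ 1 makes the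
weight on y negative. -/
lemma abs_rpow_sub_rpow_le {s θ x y z ρ : ℝ} (hθ : 0 ≤ θ) (hθ1 : θ ≤ 1) (hθs : θ ≤ s)
    (hρ : 0 ≤ ρ) (hx : 1 ≤ x) (hy : 1 ≤ y) (hz : 1 ≤ z) (h : |x - y| ≤ z) :
    |x ^ s - y ^ s| ≤ ((1 + s) * 2 ^ s) * (z ^ θ * y ^ (s - θ) + z ^ (s + ρ) * y ^ (-ρ)) := by
  have hs : 0 ≤ s := hθ.trans hθs
  have hw : ∀ w, 0 < w → w ≤ y + z →
      (1 + s) * (z ^ θ * w ^ (s - θ))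
        ≤ ((1 + s) * 2 ^ s) * (z ^ θ * y ^ (s - θ) + z ^ (s + ρ) * y ^ (-ρ)) := by
    intro w hw hwz
    rw [mul_assoc]
    refine mul_le_mul_of_nonneg_left ?_ (by linarith)
    have hm : w ≤ 2 * max y z := by
      linarith [le_max_left y z, le_max_right y z]
    have h1 : w ^ (s - θ) ≤ 2 ^ s * (max y z) ^ (s - θ) := by
      calc w ^ (s - θ) ≤ (2 * max y z) ^ (s - θ) := by
            apply Real.rpow_le_rpow hw.le hm; linarith
        _ = 2 ^ (s - θ) * (max y z) ^ (s - θ) := by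
            rw [Real.mul_rpow (by norm_num) (by positivity)]
        _ ≤ _ := by
            gcongr
            · norm_num
            · linarith
    have h2 : z ^ θ * (max y z) ^ (s - θ) ≤ z ^ θ * y ^ (s - θ) + z ^ (s + ρ) * y ^ (-ρ) := by
      rcases le_total z y with hzy | hzy
      · rw [max_eq_left hzy]
        have : 0 ≤ z ^ (s + ρ) * y ^ (-ρ) := by positivity
        linarith
      · rw [max_eq_right hzy, ← Real.rpow_add (by linarith), add_sub_cancel]
        have h0 : 0 ≤ z ^ θ * y ^ (s - θ) := by positivity
        have h3 : z ^ s ≤ z ^ (s + ρ) * y ^ (-ρ) := by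
          rw [Real.rpow_add (by linarith), mul_assoc]
          have : 1 ≤ z ^ ρ * y ^ (-ρ) := by
            rw [Real.rpow_neg (by linarith), ← div_eq_mul_inv, one_le_div (by positivity)]
            exact Real.rpow_le_rpow (by linarith) hzy hρ
          have h6 : 0 ≤ z ^ s := by positivity
          nlinarith
        linarith
    calc z ^ θ * w ^ (s - θ) ≤ z ^ θ * (2 ^ s * (max y z) ^ (s - θ)) := by gcongr
      _ = 2 ^ s * (z ^ θ * (max y z) ^ (s - θ)) := by ring
      _ ≤ _ := by gcongr
  have hab := abs_le.1 h
  rcases le_total y x with hyx | hyx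
  · rw [abs_of_nonneg (sub_nonneg.2 (Real.rpow_le_rpow (by linarith) hyx hs))]
    refine (rpow_sub_rpow_le hθ hθ1 hs (by linarith) (by linarith) hyx).trans
      (le_trans ?_ (hw x (by linarith) (by linarith)))
    gcongr
    linarith
  · rw [abs_sub_comm, abs_of_nonneg (sub_nonneg.2 (Real.rpow_le_rpow (by linarith) hyx hs))]
    refine (rpow_sub_rpow_le hθ hθ1 hs (by linarith) (by linarith) hyx).trans
      (le_trans ?_ (hw y (by linarith) (by linarith)))
    gcongr
    linarith

/-- The symbol of the commutator of `(1 - Δ)^{s/2}` with multiplication by a function. -/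
lemma enorm_bracket_rpow_sub_le {s θ ρ : ℝ} (hθ : 0 ≤ θ) (hθ1 : θ ≤ 1) (hθs : θ ≤ s)
    (hρ : 0 ≤ ρ) (k m : Fin d → ℤ) :
    ‖((bracket k ^ s - bracket m ^ s : ℝ) : ℂ)‖ₑ ≤ ENNReal.ofReal ((1 + s) * 2 ^ s) *
      (wt θ (k - m) * wt (s - θ) m + wt (s + ρ) (k - m) * wt (-ρ) m) := by
  have hb := bracket_pos m
  have hc := bracket_pos (k - m)
  have hs : 0 ≤ s := hθ.trans hθs
  simp only [wt]
  rw [← ofReal_norm, Complex.norm_real, Real.norm_eq_abs,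
    ← ENNReal.ofReal_mul (by positivity), ← ENNReal.ofReal_mul (by positivity),
    ← ENNReal.ofReal_add (by positivity) (by positivity), ← ENNReal.ofReal_mul (by positivity)]
  exact ENNReal.ofReal_le_ofReal (abs_rpow_sub_rpow_le hθ hθ1 hθs hρ (one_le_bracket k)
    (one_le_bracket m) (one_le_bracket _) (abs_bracket_sub_le k m))

/-- Interpolation: `N |k|^{s - θ} ≤ ε |k|^s + C_ε N^n` for `s = n θ`. -/
lemma mul_pow_le_interpolation {N x ε : ℝ≥0∞} (hε : ε ≠ 0) (hε' : ε ≠ ⊤) (n : ℕ) :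
    N * x ^ n ≤ ε * x ^ (n + 1) + (ε⁻¹) ^ n * N ^ (n + 1) := by
  -- Either N ≤ εx, and one factor of x absorbs N, or x ≤ N/ε, and all powers of x turn into powers
  -- of N.
  rcases le_total N (ε * x) with h | h
  · calc N * x ^ n ≤ ε * x * x ^ n := by gcongr
      _ = ε * x ^ (n + 1) := by ring
      _ ≤ _ := le_self_add
  · have hx : x ≤ ε⁻¹ * N := by
      rw [mul_comm, ← div_eq_mul_inv, ENNReal.le_div_iff_mul_le (Or.inl hε) (Or.inl hε'), mul_comm]
      exact h
    calc N * x ^ n ≤ N * (ε⁻¹ * N) ^ n := by gcongr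
      _ = (ε⁻¹) ^ n * N ^ (n + 1) := by ring
      _ ≤ _ := le_add_self

/-! ### Fourier series of square integrable functions -/

open UnitAddTorus in
lemma mFourierCoeff_congr_ae {u v : Torus d → ℂ} (h : u =ᵐ[torusMeasure d] v) (k : Fin d → ℤ) :
    mFourierCoeff u k = mFourierCoeff v k := by
  rw [mFourierCoeff_def, mFourierCoeff_def]
  refine integral_congr_ae ?_
  filter_upwards [h] with x hx
  rw [hx]

open UnitAddTorus

lemma norm_mFourier_apply (k : Fin d → ℤ) (x : Torus d) : ‖mFourier k x‖ = 1 := by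
  simp [mFourier, Circle.norm_coe]

lemma integrable_mFourier_mul {u : Torus d → ℂ} (hu : Integrable u (torusMeasure d))
    (k : Fin d → ℤ) : Integrable (fun x => mFourier k x * u x) (torusMeasure d) :=
  hu.bdd_mul (c := 1) (mFourier k).continuous.aestronglyMeasurable
    (Filter.Eventually.of_forall fun x => (norm_mFourier_apply k x).le)

lemma mFourierCoeff_add {u v : Torus d → ℂ} (hu : Integrable u (torusMeasure d))
    (hv : Integrable v (torusMeasure d)) (k : Fin d → ℤ) :
    mFourierCoeff (fun x => u x + v x) k = mFourierCoeff u k + mFourierCoeff v k := by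
  simp only [mFourierCoeff_def, mul_add]
  exact integral_add (integrable_mFourier_mul hu _) (integrable_mFourier_mul hv _)

lemma mFourierCoeff_sub {u v : Torus d → ℂ} (hu : Integrable u (torusMeasure d))
    (hv : Integrable v (torusMeasure d)) (k : Fin d → ℤ) :
    mFourierCoeff (fun x => u x - v x) k = mFourierCoeff u k - mFourierCoeff v k := by
  simp only [mFourierCoeff_def, mul_sub]
  exact integral_sub (integrable_mFourier_mul hu _) (integrable_mFourier_mul hv _)

lemma mFourierCoeff_const_mul (z : ℂ) (u : Torus d → ℂ) (k : Fin d → ℤ) :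
    mFourierCoeff (fun x => z * u x) k = z * mFourierCoeff u k := by
  simp only [mFourierCoeff_def, ← integral_const_mul]
  congr 1
  ext x
  ring

lemma mFourierCoeff_sum {κ : Type*} (s : Finset κ) {u : κ → Torus d → ℂ}
    (hu : ∀ j ∈ s, Integrable (u j) (torusMeasure d)) (k : Fin d → ℤ) :
    mFourierCoeff (fun x => ∑ j ∈ s, u j x) k = ∑ j ∈ s, mFourierCoeff (u j) k := by
  simp only [mFourierCoeff_def, Finset.mul_sum]
  exact integral_finsetSum _ fun j hj => integrable_mFourier_mul (hu j hj) _

lemma mFourierCoeff_coeFn_toLp {u : Torus d → ℂ} (hu : MemLp u 2 (torusMeasure d))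
    (k : Fin d → ℤ) : mFourierCoeff (hu.toLp u) k = mFourierCoeff u k :=
  mFourierCoeff_congr_ae hu.coeFn_toLp k

/-- Parseval's identity. -/
lemma hasSum_conj_mFourierCoeff_mul {u v : Torus d → ℂ} (hu : MemLp u 2 (torusMeasure d))
    (hv : MemLp v 2 (torusMeasure d)) :
    HasSum (fun k => conj (mFourierCoeff u k) * mFourierCoeff v k)
      (∫ x, conj (u x) * v x ∂(torusMeasure d)) := by
  have := hasSum_prod_mFourierCoeff (hu.toLp u) (hv.toLp v)
  simp_rw [mFourierCoeff_coeFn_toLp] at this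
  convert! this using 1
  refine integral_congr_ae ?_
  filter_upwards [hu.coeFn_toLp, hv.coeFn_toLp] with x hx hy
  rw [hx, hy]

lemma hasSum_sq_norm_mFourierCoeff {u : Torus d → ℂ} (hu : MemLp u 2 (torusMeasure d)) :
    HasSum (fun k => ‖mFourierCoeff u k‖ ^ 2) (∫ x, ‖u x‖ ^ 2 ∂(torusMeasure d)) := by
  have := hasSum_sq_mFourierCoeff (hu.toLp u)
  simp_rw [mFourierCoeff_coeFn_toLp] at this
  convert! this using 1
  refine integral_congr_ae ?_
  filter_upwards [hu.coeFn_toLp] with x hx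
  rw [hx]

lemma l2_mFourierCoeff {u : Torus d → ℂ} (hu : MemLp u 2 (torusMeasure d)) :
    l2 (fun k => ‖mFourierCoeff u k‖ₑ) = eLpNorm u 2 (torusMeasure d) := by
  have h := hasSum_sq_norm_mFourierCoeff hu
  have hi : Integrable (fun x => ‖u x‖ ^ 2) (torusMeasure d) := hu.integrable_norm_pow two_ne_zero
  have e1 : ∑' k, ‖mFourierCoeff u k‖ₑ ^ 2
      = ENNReal.ofReal (∫ x, ‖u x‖ ^ 2 ∂(torusMeasure d)) := by
    rw [← h.tsum_eq, ENNReal.ofReal_tsum_of_nonneg (fun k => by positivity) h.summable]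
    congr 1
    ext k
    rw [ENNReal.ofReal_pow (norm_nonneg _), ofReal_norm]
  rw [l2, e1, ofReal_integral_eq_lintegral_ofReal hi (Filter.Eventually.of_forall fun x => by
    positivity), eLpNorm_eq_lintegral_rpow_enorm_toReal two_ne_zero ENNReal.ofNat_ne_top]
  simp [ENNReal.ofReal_pow (norm_nonneg _)]

lemma exists_mFourierCoeff_eq (a : (Fin d → ℤ) → ℂ) (ha : l2 (fun k => ‖a k‖ₑ) < ⊤) :
    ∃ f : Torus d → ℂ, MemLp f 2 (torusMeasure d) ∧ ∀ k, mFourierCoeff f k = a k := by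
  have hsum := l2_lt_top_iff.1 ha
  have hmem : Memℓp a 2 := by
    refine memℓp_gen ?_
    simpa using ENNReal.summable_toReal hsum.ne
  obtain ⟨G, hG⟩ := (mFourierBasis (d := Fin d)).repr.surjective
    (⟨a, hmem⟩ : lp (fun _ : Fin d → ℤ => ℂ) 2)
  refine ⟨G, Lp.memLp G, fun k => ?_⟩
  rw [← mFourierBasis_repr, hG]

lemma eq_ae_of_mFourierCoeff_eq {u v : Torus d → ℂ} (hu : MemLp u 2 (torusMeasure d))
    (hv : MemLp v 2 (torusMeasure d)) (h : ∀ k, mFourierCoeff u k = mFourierCoeff v k) :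
    u =ᵐ[torusMeasure d] v := by
  have h1 := l2_mFourierCoeff (hu.sub hv)
  have h2 : ∀ k, mFourierCoeff (u - v) k = 0 := by
    intro k
    have := mFourierCoeff_sub (hu.integrable (by norm_num)) (hv.integrable (by norm_num)) k
    rw [h k, sub_self] at this
    exact this
  simp_rw [h2, enorm_zero] at h1
  rw [l2_zero, eq_comm, eLpNorm_eq_zero_iff (hu.sub hv).1 two_ne_zero] at h1
  filter_upwards [h1] with x hx
  exact sub_eq_zero.1 hx

/-- Turns Parseval's identity for the pair (ū e_k, v) into the convolution formula for the
coefficients of u v. -/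
lemma mFourierCoeff_conj_mul_mFourier (u : Torus d → ℂ) (k m : Fin d → ℤ) :
    conj (mFourierCoeff (fun x => conj (u x) * mFourier k x) m) = mFourierCoeff u (k - m) := by
  rw [mFourierCoeff_def, mFourierCoeff_def, ← integral_conj]
  congr 1
  ext x
  rw [neg_sub, sub_eq_add_neg, mFourier_add, mFourier_neg, mFourier_neg]
  simp only [map_mul, Complex.conj_conj]
  ring

lemma MemLp.mul_mFourier {u : Torus d → ℂ} {p : ℝ≥0∞} (hu : MemLp u p (torusMeasure d))
    (k : Fin d → ℤ) : MemLp (fun x => u x * mFourier k x) p (torusMeasure d) := by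
  refine hu.of_le (hu.1.mul (mFourier k).continuous.aestronglyMeasurable)
    (Filter.Eventually.of_forall fun x => ?_)
  rw [norm_mul, norm_mFourier_apply, mul_one]

/-- The Fourier coefficients of a product. -/
lemma hasSum_mFourierCoeff_mul {u v : Torus d → ℂ} (hu : MemLp u 2 (torusMeasure d))
    (hv : MemLp v 2 (torusMeasure d)) (k : Fin d → ℤ) :
    HasSum (fun m => mFourierCoeff u (k - m) * mFourierCoeff v m)
      (mFourierCoeff (fun x => u x * v x) k) := by
  have := hasSum_conj_mFourierCoeff_mul (MemLp.mul_mFourier hu.star k) hv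
  convert! this using 1
  · ext m
    rw [← mFourierCoeff_conj_mul_mFourier]
    rfl
  · rw [mFourierCoeff_def]
    congr 1
    ext x
    simp only [Pi.star_apply, RCLike.star_def, map_mul, Complex.conj_conj, mFourier_neg]
    ring

/-- Leibniz' rule on the Fourier side. -/
lemma mFourierCoeff_leibniz {u v u' v' : Torus d → ℂ} (hu : MemLp u 2 (torusMeasure d))
    (hv : MemLp v 2 (torusMeasure d)) (hu' : MemLp u' 2 (torusMeasure d))
    (hv' : MemLp v' 2 (torusMeasure d)) (i : Fin d)
    (h1 : ∀ k, mFourierCoeff u' k = 2 * Real.pi * Complex.I * k i * mFourierCoeff u k)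
    (h2 : ∀ k, mFourierCoeff v' k = 2 * Real.pi * Complex.I * k i * mFourierCoeff v k)
    (k : Fin d → ℤ) :
    2 * Real.pi * Complex.I * k i * mFourierCoeff (fun x => u x * v x) k
      = mFourierCoeff (fun x => u' x * v x) k + mFourierCoeff (fun x => u x * v' x) k := by
  refine ((hasSum_mFourierCoeff_mul hu hv k).mul_left _).unique ?_
  convert! (hasSum_mFourierCoeff_mul hu' hv k).add (hasSum_mFourierCoeff_mul hu hv' k) using 1
  ext m
  rw [h1, h2]
  push_cast [Pi.sub_apply]
  ring

lemma MemLp.bdd_mul_two {b u : Torus d → ℂ} {p : ℝ≥0∞} (hb : MemLp b ∞ (torusMeasure d))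
    (hu : MemLp u p (torusMeasure d)) : MemLp (fun x => b x * u x) p (torusMeasure d) :=
  hu.mul (r := p) hb

lemma eLpNorm_bdd_mul_le {b u : Torus d → ℂ} {p : ℝ≥0∞}
    (hu : AEStronglyMeasurable u (torusMeasure d)) :
    eLpNorm (fun x => b x * u x) p (torusMeasure d)
      ≤ eLpNorm b ∞ (torusMeasure d) * eLpNorm u p (torusMeasure d) := by
  have := eLpNorm_smul_le_eLpNorm_top_mul_eLpNorm p hu b
  exact this

/-! ### Sobolev norms -/

/-- The `H^σ` norm of a complex function. -/
def hn (σ : ℝ) (u : Torus d → ℂ) : ℝ≥0∞ := l2 (fun k => wt σ k * ‖mFourierCoeff u k‖ₑ)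

lemma sobolevNorm_eq_hn (s : ℝ) (f : Torus d → ℝ) : sobolevNorm s f = hn s (fun x => (f x : ℂ)) := by
  unfold sobolevNorm hn l2
  congr 2
  ext k
  rw [mul_pow, wt_pow, wt]
  congr 2
  rw [← bracket_sq, ← Real.rpow_natCast_mul (bracket_pos k).le]

lemma hn_mono {σ τ : ℝ} (h : σ ≤ τ) (u : Torus d → ℂ) : hn σ u ≤ hn τ u :=
  l2_mono fun k => by gcongr; exact wt_mono h k

lemma hn_zero_eq {u : Torus d → ℂ} (hu : MemLp u 2 (torusMeasure d)) :
    hn 0 u = eLpNorm u 2 (torusMeasure d) := by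
  simp only [hn, wt_zero, one_mul, l2_mFourierCoeff hu]

lemma eLpNorm_le_hn {σ : ℝ} (hσ : 0 ≤ σ) {u : Torus d → ℂ} (hu : MemLp u 2 (torusMeasure d)) :
    eLpNorm u 2 (torusMeasure d) ≤ hn σ u :=
  (hn_zero_eq hu).symm.trans_le (hn_mono hσ u)

lemma hn_congr {u v : Torus d → ℂ} (h : ∀ k, mFourierCoeff u k = mFourierCoeff v k) (σ : ℝ) :
    hn σ u = hn σ v := by
  simp only [hn, h]

lemma hn_const_mul (σ : ℝ) (z : ℂ) (u : Torus d → ℂ) :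
    hn σ (fun x => z * u x) = ‖z‖ₑ * hn σ u := by
  unfold hn
  rw [← l2_const_mul]
  congr 1
  ext k
  rw [mFourierCoeff_const_mul, enorm_mul]
  ring

lemma hn_add_le (σ : ℝ) {u v : Torus d → ℂ} (hu : Integrable u (torusMeasure d))
    (hv : Integrable v (torusMeasure d)) : hn σ (fun x => u x + v x) ≤ hn σ u + hn σ v := by
  refine (l2_mono fun k => ?_).trans (l2_add_le _ _)
  rw [mFourierCoeff_add hu hv, ← mul_add]
  gcongr
  exact enorm_add_le _ _

lemma hn_sub_le (σ : ℝ) {u v : Torus d → ℂ} (hu : Integrable u (torusMeasure d))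
    (hv : Integrable v (torusMeasure d)) : hn σ (fun x => u x - v x) ≤ hn σ u + hn σ v := by
  refine (l2_mono fun k => ?_).trans (l2_add_le _ _)
  rw [mFourierCoeff_sub hu hv, ← mul_add]
  gcongr
  exact enorm_sub_le

/-- Cauchy–Schwarz against ⟨k⟩^{σ−τ}. The dimension enters through the constant, which is finite
when 2(τ − σ) > d. -/
lemma tsum_wt_mul_mFourierCoeff_le (σ τ : ℝ) (u : Torus d → ℂ) :
    ∑' k, wt σ k * ‖mFourierCoeff u k‖ₑ ≤ l2 (wt (d := d) (σ - τ)) * hn τ u := by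
  refine le_trans (le_of_eq ?_) (tsum_mul_le_l2 _ _)
  congr 1
  ext k
  rw [← mul_assoc, ← wt_add, sub_add_cancel]

lemma enorm_two_pi_I_mul (x : ℤ) (z : ℂ) :
    ‖2 * Real.pi * Complex.I * x * z‖ₑ
      = ENNReal.ofReal (2 * Real.pi) * (ENNReal.ofReal |(x : ℝ)| * ‖z‖ₑ) := by
  rw [← mul_assoc, ← ENNReal.ofReal_mul (by positivity), enorm_mul]
  congr 1
  rw [← ofReal_norm]
  congr 1
  simp [abs_of_pos Real.pi_pos]

/-- Differentiation loses one derivative. -/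
lemma wt_mul_enorm_deriv_le (σ : ℝ) (i : Fin d) (k : Fin d → ℤ) (z : ℂ) :
    wt σ k * ‖2 * Real.pi * Complex.I * k i * z‖ₑ
      ≤ ENNReal.ofReal (2 * Real.pi) * (wt (σ + 1) k * ‖z‖ₑ) := by
  rw [enorm_two_pi_I_mul, wt_add]
  calc _ = ENNReal.ofReal (2 * Real.pi) * (wt σ k * ENNReal.ofReal |(k i : ℝ)| * ‖z‖ₑ) := by ring
    _ ≤ _ := by gcongr; exact ofReal_abs_le_wt k i

lemma hn_deriv_le (σ : ℝ) (i : Fin d) {u u' : Torus d → ℂ}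
    (h : ∀ k, mFourierCoeff u' k = 2 * Real.pi * Complex.I * k i * mFourierCoeff u k) :
    hn σ u' ≤ ENNReal.ofReal (2 * Real.pi) * hn (σ + 1) u := by
  unfold hn
  rw [← l2_const_mul]
  refine l2_mono fun k => ?_
  rw [h]
  exact wt_mul_enorm_deriv_le σ i k _

lemma ofReal_two_pi_ge_one : 1 ≤ ENNReal.ofReal (2 * Real.pi) := by
  rw [← ENNReal.ofReal_one]
  exact ENNReal.ofReal_le_ofReal (by linarith [Real.pi_gt_three])

/-- The `H^{σ+1}` norm is controlled by the `H^σ` norms of the function and its gradient. -/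
lemma hn_add_one_le (σ : ℝ) {u : Torus d → ℂ} {u' : Fin d → Torus d → ℂ}
    (h : ∀ i k, mFourierCoeff (u' i) k = 2 * Real.pi * Complex.I * k i * mFourierCoeff u k) :
    hn (σ + 1) u ≤ hn σ u + ∑ i, hn σ (u' i) := by
  refine (l2_mono fun k => ?_).trans ((l2_add_le _ _).trans
    (add_le_add le_rfl
      (l2_sum_le Finset.univ (fun i k => wt σ k * ‖mFourierCoeff (u' i) k‖ₑ))))
  rw [wt_add, ← Finset.mul_sum, ← mul_add, mul_assoc]
  gcongr
  simp_rw [h, enorm_two_pi_I_mul, ← Finset.mul_sum, ← Finset.sum_mul, ← mul_assoc]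
  calc wt 1 k * ‖mFourierCoeff u k‖ₑ
      ≤ (1 + ∑ i, ENNReal.ofReal |(k i : ℝ)|) * ‖mFourierCoeff u k‖ₑ := by
        gcongr
        rw [wt, Real.rpow_one, ← ENNReal.ofReal_one, ← ENNReal.ofReal_sum_of_nonneg
          (fun _ _ => abs_nonneg _), ← ENNReal.ofReal_add zero_le_one (by positivity)]
        exact ENNReal.ofReal_le_ofReal (bracket_le_one_add_sum k)
    _ = 1 * ‖mFourierCoeff u k‖ₑ
        + 1 * (∑ i, ENNReal.ofReal |(k i : ℝ)|) * ‖mFourierCoeff u k‖ₑ := by ring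
    _ ≤ _ := by
        rw [one_mul]
        gcongr
        exact ofReal_two_pi_ge_one

lemma enorm_bracket_rpow_mul (s : ℝ) (k : Fin d → ℤ) (z : ℂ) :
    ‖((bracket k ^ s : ℝ) : ℂ) * z‖ₑ = wt s k * ‖z‖ₑ := by
  have := bracket_pos k
  rw [enorm_mul, wt, ← ofReal_norm (_ : ℂ), Complex.norm_real, Real.norm_of_nonneg (by positivity)]

/-- The Bessel potential `(1 - Δ)^{s/2} u` of a function `u` in `H^s`. -/
lemma exists_bessel (s : ℝ) {u : Torus d → ℂ} (h : hn s u < ⊤) :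
    ∃ f : Torus d → ℂ, MemLp f 2 (torusMeasure d) ∧
      (∀ k, mFourierCoeff f k = ((bracket k ^ s : ℝ) : ℂ) * mFourierCoeff u k) ∧
      eLpNorm f 2 (torusMeasure d) = hn s u := by
  obtain ⟨f, hf, hf'⟩ := exists_mFourierCoeff_eq
    (fun k => ((bracket k ^ s : ℝ) : ℂ) * mFourierCoeff u k) (by simpa only [enorm_bracket_rpow_mul, hn] using h)
  refine ⟨f, hf, hf', ?_⟩
  rw [← l2_mFourierCoeff hf, hn]
  simp_rw [hf', enorm_bracket_rpow_mul]

/-- The commutator of `(1 - Δ)^{s/2}` with multiplication by `b`. -/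
lemma l2_commutator_le {s θ ρ : ℝ} (hθ : 0 ≤ θ) (hθ1 : θ ≤ 1) (hθs : θ ≤ s) (hρ : 0 ≤ ρ)
    {b u f : Torus d → ℂ} (hb : MemLp b 2 (torusMeasure d)) (hu : MemLp u 2 (torusMeasure d))
    (hf : MemLp f 2 (torusMeasure d))
    (hfu : ∀ k, mFourierCoeff f k = ((bracket k ^ s : ℝ) : ℂ) * mFourierCoeff u k) :
    l2 (fun k => ‖((bracket k ^ s : ℝ) : ℂ) * mFourierCoeff (fun x => b x * u x) k
        - mFourierCoeff (fun x => b x * f x) k‖ₑ)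
      ≤ ENNReal.ofReal ((1 + s) * 2 ^ s) *
        ((∑' k, wt θ k * ‖mFourierCoeff b k‖ₑ) * hn (s - θ) u
          + hn (s + ρ) b * ∑' k, wt (-ρ) k * ‖mFourierCoeff u k‖ₑ) := by
  set A := ENNReal.ofReal ((1 + s) * 2 ^ s)
  have key : ∀ k, ‖((bracket k ^ s : ℝ) : ℂ) * mFourierCoeff (fun x => b x * u x) k
        - mFourierCoeff (fun x => b x * f x) k‖ₑ
      ≤ A * (∑' m, (wt θ (k - m) * ‖mFourierCoeff b (k - m)‖ₑ)
            * (wt (s - θ) m * ‖mFourierCoeff u m‖ₑ)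
          + ∑' m, (wt (s + ρ) (k - m) * ‖mFourierCoeff b (k - m)‖ₑ)
            * (wt (-ρ) m * ‖mFourierCoeff u m‖ₑ)) := by
    intro k
    have h := ((hasSum_mFourierCoeff_mul hb hu k).mul_left ((bracket k ^ s : ℝ) : ℂ)).sub
      (hasSum_mFourierCoeff_mul hb hf k)
    rw [← h.tsum_eq, ← ENNReal.tsum_add, ← ENNReal.tsum_mul_left]
    refine (enorm_tsum_le_tsum_enorm).trans (ENNReal.tsum_le_tsum fun m => ?_)
    rw [hfu]
    -- In the convolution the commutator appears as multiplication by the difference of the two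
    -- symbols.
    have e : ((bracket k ^ s : ℝ) : ℂ) * (mFourierCoeff b (k - m) * mFourierCoeff u m)
        - mFourierCoeff b (k - m) * (((bracket m ^ s : ℝ) : ℂ) * mFourierCoeff u m)
        = ((bracket k ^ s - bracket m ^ s : ℝ) : ℂ)
          * (mFourierCoeff b (k - m) * mFourierCoeff u m) := by
      push_cast
      ring
    rw [e, enorm_mul, enorm_mul]
    refine (mul_le_mul_left (enorm_bracket_rpow_sub_le hθ hθ1 hθs hρ k m) _).trans_eq ?_
    ring
  refine (l2_mono key).trans ?_
  rw [l2_const_mul]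
  gcongr
  refine (l2_add_le _ _).trans ?_
  gcongr
  -- The first term places b in ℓ¹ and u in ℓ²; the second reverses the roles.
  · exact l2_conv_le (fun k => wt θ k * ‖mFourierCoeff b k‖ₑ)
      (fun k => wt (s - θ) k * ‖mFourierCoeff u k‖ₑ)
  · exact l2_conv_le' (fun k => wt (s + ρ) k * ‖mFourierCoeff b k‖ₑ)
      (fun k => wt (-ρ) k * ‖mFourierCoeff u k‖ₑ)

/-! ### De la Vallée-Poussin means and products of bounded Sobolev functions -/

/-- The frequencies in `[-N, N]^d`. -/
def box (d N : ℕ) : Finset (Fin d → ℤ) := Fintype.piFinset fun _ => Finset.Icc (-(N : ℤ)) N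

lemma mem_box {N : ℕ} {k : Fin d → ℤ} : k ∈ box d N ↔ ∀ i, |k i| ≤ N := by
  simp [box, abs_le]

lemma card_box (N : ℕ) : (box d N).card = (2 * N + 1) ^ d := by
  simp only [box, Fintype.card_piFinset, Int.card_Icc, Finset.prod_const, Finset.card_univ,
    Fintype.card_fin]
  congr 1
  omega

lemma box_mono {N M : ℕ} (h : N ≤ M) : box d N ⊆ box d M := fun k hk =>
  mem_box.2 fun i => (mem_box.1 hk i).trans (by exact_mod_cast h)

lemma add_mem_box {N M : ℕ} {a b : Fin d → ℤ} (ha : a ∈ box d N) (hb : b ∈ box d M) :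
    a + b ∈ box d (N + M) := mem_box.2 fun i => by
  have h1 := mem_box.1 ha i
  have h2 := mem_box.1 hb i
  rw [Pi.add_apply]
  push_cast
  exact (abs_add_le _ _).trans (add_le_add h1 h2)

lemma neg_mem_box {N : ℕ} {a : Fin d → ℤ} (ha : a ∈ box d N) : -a ∈ box d N :=
  mem_box.2 fun i => by simpa using mem_box.1 ha i

lemma memLp_mFourier (k : Fin d → ℤ) (p : ℝ≥0∞) :
    MemLp (fun x => mFourier k x) p (torusMeasure d) :=
  MemLp.of_bound (mFourier k).continuous.aestronglyMeasurable 1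
    (Filter.Eventually.of_forall fun x => (norm_mFourier_apply k x).le)

lemma mFourierCoeff_mFourier (m k : Fin d → ℤ) :
    mFourierCoeff (fun x => mFourier m x) k = if k = m then 1 else 0 := by
  have h := orthonormal_iff_ite.1 (orthonormal_mFourier (d := Fin d)) k m
  rw [← h, L2.inner_def, mFourierCoeff_def]
  refine integral_congr_ae ?_
  filter_upwards [coeFn_mFourierLp 2 k, coeFn_mFourierLp 2 m] with x hx hy
  rw [hx, hy, mFourier_neg, RCLike.inner_apply, mul_comm]

/-- A trigonometric polynomial. -/
def trigPoly (S : Finset (Fin d → ℤ)) (a : (Fin d → ℤ) → ℂ) (x : Torus d) : ℂ :=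
  ∑ k ∈ S, a k * mFourier k x

lemma memLp_trigPoly (S : Finset (Fin d → ℤ)) (a : (Fin d → ℤ) → ℂ) (p : ℝ≥0∞) :
    MemLp (trigPoly S a) p (torusMeasure d) :=
  memLp_finsetSum _ fun k _ => (memLp_mFourier k p).const_mul (a k)

lemma mFourierCoeff_trigPoly (S : Finset (Fin d → ℤ)) (a : (Fin d → ℤ) → ℂ) (k : Fin d → ℤ) :
    mFourierCoeff (trigPoly S a) k = if k ∈ S then a k else 0 := by
  unfold trigPoly
  rw [mFourierCoeff_sum _ fun m _ =>
    ((memLp_mFourier m 2).const_mul (a m)).integrable (by norm_num)]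
  simp_rw [mFourierCoeff_const_mul, mFourierCoeff_mFourier]
  simp

lemma eLpNorm_trigPoly_one (S : Finset (Fin d → ℤ)) {a : (Fin d → ℤ) → ℂ} (ha : ∀ k, ‖a k‖ = 1) :
    eLpNorm (trigPoly S a) 2 (torusMeasure d) ^ 2 = S.card := by
  rw [← l2_mFourierCoeff (memLp_trigPoly S a 2), l2_sq]
  simp_rw [mFourierCoeff_trigPoly]
  rw [tsum_eq_sum (s := S) (fun k hk => by simp [hk])]
  rw [Finset.sum_congr rfl (g := fun _ => (1 : ℝ≥0∞)) (fun k hk => ?_)]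
  · simp
  · rw [if_pos hk, ← ofReal_norm, ha]
    simp

/-- The weights of the de la Vallée-Poussin means. -/
def vpWeight (N : ℕ) (k : Fin d → ℤ) : ℝ :=
  ((box d N).filter (fun a => k - a ∈ box d (2 * N))).card / (box d N).card

lemma card_box_pos (N : ℕ) : (0 : ℝ) < (box d N).card := by
  rw [card_box]
  positivity

lemma vpWeight_nonneg (N : ℕ) (k : Fin d → ℤ) : 0 ≤ vpWeight N k := by
  unfold vpWeight
  positivity

lemma vpWeight_le_one (N : ℕ) (k : Fin d → ℤ) : vpWeight N k ≤ 1 :=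
  div_le_one_of_le₀ (by exact_mod_cast Finset.card_filter_le _ _) (card_box_pos N).le

/-- The difference of two frequencies of the box N lies in the box 2N, so every a is counted.
Likewise a sum of frequencies of the boxes N and 2N stays in the box 3N, so the weight vanishes
beyond it. -/
lemma vpWeight_eq_one {N : ℕ} {k : Fin d → ℤ} (hk : k ∈ box d N) : vpWeight N k = 1 := by
  unfold vpWeight
  rw [Finset.filter_true_of_mem, div_self (card_box_pos N).ne']
  intro a ha
  rw [sub_eq_add_neg, two_mul]
  exact add_mem_box hk (neg_mem_box ha)

lemma vpWeight_eq_zero {N : ℕ} {k : Fin d → ℤ} (hk : k ∉ box d (3 * N)) : vpWeight N k = 0 := by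
  unfold vpWeight
  rw [Finset.filter_false_of_mem, Finset.card_empty, Nat.cast_zero, zero_div]
  intro a ha hb
  refine hk ?_
  have := add_mem_box hb ha
  rw [sub_add_cancel] at this
  convert! this using 2
  ring

/-- The de la Vallée-Poussin means of a function on the torus. -/
def vpMean (N : ℕ) (u : Torus d → ℂ) : Torus d → ℂ :=
  trigPoly (box d (3 * N)) fun k => vpWeight N k * mFourierCoeff u k

lemma mFourierCoeff_vpMean (N : ℕ) (u : Torus d → ℂ) (k : Fin d → ℤ) :
    mFourierCoeff (vpMean N u) k = vpWeight N k * mFourierCoeff u k := by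
  unfold vpMean
  rw [mFourierCoeff_trigPoly]
  split_ifs with h
  · rfl
  · rw [vpWeight_eq_zero h]
    simp

/-- The weight counts the representations k = a + b, so the kernel of the mean factors as a product
of two Dirichlet kernels, divided by the number of frequencies in the box N. -/
lemma vpMean_eq_sum (N : ℕ) (u : Torus d → ℂ) (x : Torus d) :
    vpMean N u x = ((box d N).card : ℂ)⁻¹ * ∑ a ∈ box d N, ∑ b ∈ box d (2 * N),
      mFourierCoeff u (a + b) * mFourier (a + b) x := by
  have h1 : ∀ a ∈ box d N, ∑ b ∈ box d (2 * N), mFourierCoeff u (a + b) * mFourier (a + b) x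
      = ∑ k ∈ box d (3 * N), if k - a ∈ box d (2 * N) then mFourierCoeff u k * mFourier k x
        else 0 := by
    intro a ha
    rw [← Finset.sum_filter]
    refine Finset.sum_bij (fun b _ => a + b) (fun b hb => ?_) (fun _ _ _ _ h => add_left_cancel h)
      (fun k hk => ⟨k - a, (Finset.mem_filter.1 hk).2, add_sub_cancel a k⟩) (fun _ _ => rfl)
    refine Finset.mem_filter.2 ⟨?_, by simpa using hb⟩
    have := add_mem_box ha hb
    convert! this using 2
    ring
  rw [Finset.sum_congr rfl h1, Finset.sum_comm, Finset.mul_sum]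
  refine Finset.sum_congr rfl fun k _ => ?_
  rw [← Finset.sum_filter, Finset.sum_const, nsmul_eq_mul]
  unfold vpWeight
  push_cast
  ring

lemma vpMean_eq_integral (N : ℕ) {u : Torus d → ℂ} (hu : Integrable u (torusMeasure d))
    (x : Torus d) :
    vpMean N u x = ((box d N).card : ℂ)⁻¹ * ∫ y, u y * (trigPoly (box d N)
      (fun a => mFourier (-a) x) y * trigPoly (box d (2 * N)) (fun a => mFourier (-a) x) y)
      ∂(torusMeasure d) := by
  have hneg : ∀ (M : ℕ) (F : (Fin d → ℤ) → ℂ),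
      ∑ a ∈ box d M, F a = ∑ a ∈ box d M, F (-a) := fun M F =>
    Finset.sum_equiv (Equiv.neg _) (fun a => ⟨fun h => neg_mem_box h, fun h => by
      simpa using neg_mem_box h⟩) (fun a _ => by simp)
  -- The boxes are symmetric; replacing a and b by their negatives turns the conjugate exponentials
  -- in the Fourier coefficients into e_a(y) and e_b(y).
  rw [vpMean_eq_sum, hneg, Finset.sum_congr rfl fun a _ => hneg (2 * N) _]
  congr 1
  simp only [trigPoly, Finset.sum_mul_sum]
  simp only [Finset.mul_sum]
  have hi : ∀ a b, Integrable (fun y => u y * (mFourier (-a) x * mFourier a y *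
      (mFourier (-b) x * mFourier b y))) (torusMeasure d) := by
    intro a b
    have := (integrable_mFourier_mul hu (a + b)).const_mul (mFourier (-a) x * mFourier (-b) x)
    refine this.congr (Filter.Eventually.of_forall fun y => ?_)
    simp only [mFourier_add]
    ring
  rw [integral_finsetSum _ fun a _ => integrable_finsetSum _ fun b _ => hi a b]
  refine Finset.sum_congr rfl fun a _ => ?_
  rw [integral_finsetSum _ fun b _ => hi a b]
  refine Finset.sum_congr rfl fun b _ => ?_
  rw [mFourierCoeff_def, mul_comm, ← integral_const_mul]
  congr 1
  ext y
  rw [← neg_add, neg_neg, mFourier_add, neg_add, mFourier_add]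
  ring

lemma enorm_integral_mul_mul_le {u A B : Torus d → ℂ} (hA : MemLp A 2 (torusMeasure d))
    (hB : MemLp B 2 (torusMeasure d)) :
    ‖∫ y, u y * (A y * B y) ∂(torusMeasure d)‖ₑ
      ≤ eLpNorm u ∞ (torusMeasure d) *
        (eLpNorm A 2 (torusMeasure d) * eLpNorm B 2 (torusMeasure d)) := by
  refine (enorm_integral_le_lintegral_enorm _).trans ?_
  rw [← eLpNorm_one_eq_lintegral_enorm]
  refine (eLpNorm_bdd_mul_le (hA.1.mul hB.1)).trans (mul_le_mul_right ?_ _)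
  have := eLpNorm_smul_le_mul_eLpNorm (p := 2) (q := 2) (r := 1) hB.1 hA.1
  exact this

/-- By Cauchy–Schwarz the L¹ norm of the kernel is at most the product of the L² norms of the two
Dirichlet kernels over the size of the box N. These norms are square roots of numbers of
frequencies, so the quotient is bounded uniformly in N; a sharp Dirichlet truncation has no such
bound. -/
lemma enorm_vpMean_le (N : ℕ) {u : Torus d → ℂ} (hu : MemLp u ∞ (torusMeasure d))
    (x : Torus d) : ‖vpMean N u x‖ₑ ≤ 2 ^ d * eLpNorm u ∞ (torusMeasure d) := by
  set A := trigPoly (box d N) (fun a => mFourier (-a) x)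
  set B := trigPoly (box d (2 * N)) (fun a => mFourier (-a) x)
  have hA : MemLp A 2 (torusMeasure d) := memLp_trigPoly _ _ _
  have hB : MemLp B 2 (torusMeasure d) := memLp_trigPoly _ _ _
  have h1 := enorm_integral_mul_mul_le (u := u) hA hB
  have h2 : eLpNorm A 2 (torusMeasure d) * eLpNorm B 2 (torusMeasure d)
      ≤ (2 ^ d : ℝ≥0∞) * (box d N).card := by
    refine (ENNReal.pow_le_pow_left_iff two_ne_zero).1 ?_
    have e : ∀ k : Fin d → ℤ, ‖mFourier (-k) x‖ = 1 := fun k => norm_mFourier_apply _ _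
    rw [mul_pow, eLpNorm_trigPoly_one _ e, eLpNorm_trigPoly_one _ e, card_box, card_box]
    have hn : (2 * N + 1) ^ d * (2 * (2 * N) + 1) ^ d ≤ (2 ^ d * (2 * N + 1) ^ d) ^ 2 := by
      rw [← mul_pow, ← mul_pow, pow_right_comm]
      gcongr
      nlinarith
    exact_mod_cast hn
  have hc : (box d N).card ≠ 0 := by exact_mod_cast (card_box_pos (d := d) N).ne'
  rw [vpMean_eq_integral N (hu.integrable (by norm_num)), enorm_mul]
  calc _ ≤ ‖((box d N).card : ℂ)⁻¹‖ₑ * (eLpNorm u ∞ (torusMeasure d) *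
        ((2 ^ d : ℝ≥0∞) * (box d N).card)) := by gcongr; exact h1.trans (by gcongr)
    _ = (‖((box d N).card : ℂ)⁻¹‖ₑ * (box d N).card) *
        (2 ^ d * eLpNorm u ∞ (torusMeasure d)) := by ring
    _ = _ := by
        rw [enorm_inv (by exact_mod_cast hc)]
        have : ‖((box d N).card : ℂ)‖ₑ = (box d N).card := by
          rw [← ofReal_norm, Complex.norm_natCast, ENNReal.ofReal_natCast]
        rw [this, ENNReal.inv_mul_cancel (by exact_mod_cast hc) (ENNReal.natCast_ne_top _), one_mul]

/-- The `L²` norm of the part of `u` with frequencies outside `[-N, N]^d`. -/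
def tail (N : ℕ) (u : Torus d → ℂ) : ℝ≥0∞ :=
  l2 fun k => if k ∈ box d N then 0 else ‖mFourierCoeff u k‖ₑ

/-- The multiplier 1 − weight vanishes on the box N and lies in [0, 1] elsewhere. -/
lemma eLpNorm_sub_vpMean_le (N : ℕ) {u : Torus d → ℂ} (hu : MemLp u 2 (torusMeasure d)) :
    eLpNorm (fun x => u x - vpMean N u x) 2 (torusMeasure d) ≤ tail N u := by
  have hV : MemLp (vpMean N u) 2 (torusMeasure d) := memLp_trigPoly _ _ _
  have hd : MemLp (fun x => u x - vpMean N u x) 2 (torusMeasure d) := hu.sub hV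
  rw [← l2_mFourierCoeff hd]
  refine l2_mono fun k => ?_
  rw [mFourierCoeff_sub (hu.integrable (by norm_num)) (hV.integrable (by norm_num)),
    mFourierCoeff_vpMean]
  split_ifs with h
  · simp [vpWeight_eq_one h]
  · have e : mFourierCoeff u k - vpWeight N k * mFourierCoeff u k
        = ((1 - vpWeight N k : ℝ) : ℂ) * mFourierCoeff u k := by
      push_cast
      ring
    rw [e, enorm_mul]
    have h1 : ‖((1 - vpWeight N k : ℝ) : ℂ)‖ₑ ≤ 1 := by
      rw [← ofReal_norm, Complex.norm_real, ← ENNReal.ofReal_one]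
      refine ENNReal.ofReal_le_ofReal (abs_le.2 ⟨?_, ?_⟩)
      · linarith [vpWeight_le_one N k]
      · linarith [vpWeight_nonneg N k]
    exact (mul_le_mul_left h1 _).trans_eq (one_mul _)

/-- With V the mean at level N, the product Vu · Vw has frequencies in the box 6N and does not
contribute to the tail. The remainder is w(u − Vu) + Vu(w − Vw), where one factor is bounded in L^∞,
uniformly in N, and the other is a tail in L². -/
lemma tail_mul_le (N : ℕ) {u w : Torus d → ℂ} (hu : MemLp u ∞ (torusMeasure d))
    (hw : MemLp w ∞ (torusMeasure d)) :
    tail (6 * N) (fun x => u x * w x) ≤ 2 ^ d * (eLpNorm w ∞ (torusMeasure d) * tail N u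
      + eLpNorm u ∞ (torusMeasure d) * tail N w) := by
  have hu2 : MemLp u 2 (torusMeasure d) := hu.mono_exponent le_top
  have hw2 : MemLp w 2 (torusMeasure d) := hw.mono_exponent le_top
  have hVu : ∀ p, MemLp (vpMean N u) p (torusMeasure d) := fun p => memLp_trigPoly _ _ _
  have hVw : ∀ p, MemLp (vpMean N w) p (torusMeasure d) := fun p => memLp_trigPoly _ _ _
  have huw : MemLp (fun x => u x * w x) 2 (torusMeasure d) := MemLp.bdd_mul_two hu hw2
  have hVV : MemLp (fun x => vpMean N u x * vpMean N w x) 2 (torusMeasure d) :=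
    MemLp.bdd_mul_two (hVu _) (hVw 2)
  have h0 : ∀ k ∉ box d (6 * N), mFourierCoeff (fun x => vpMean N u x * vpMean N w x) k = 0 := by
    intro k hk
    rw [← (hasSum_mFourierCoeff_mul (hVu 2) (hVw 2) k).tsum_eq]
    convert! tsum_zero with m
    rw [mFourierCoeff_vpMean, mFourierCoeff_vpMean]
    by_cases h1 : m ∈ box d (3 * N)
    · by_cases h2 : k - m ∈ box d (3 * N)
      · refine absurd ?_ hk
        have := add_mem_box h2 h1
        rw [sub_add_cancel] at this
        convert! this using 2
        ring
      · simp [vpWeight_eq_zero h2]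
    · simp [vpWeight_eq_zero h1]
  have h1 : tail (6 * N) (fun x => u x * w x)
      ≤ eLpNorm (fun x => u x * w x - vpMean N u x * vpMean N w x) 2 (torusMeasure d) := by
    have hd : MemLp (fun x => u x * w x - vpMean N u x * vpMean N w x) 2 (torusMeasure d) :=
      huw.sub hVV
    rw [← l2_mFourierCoeff hd]
    refine l2_mono fun k => ?_
    split_ifs with h
    · exact zero_le
    · rw [mFourierCoeff_sub (huw.integrable (by norm_num)) (hVV.integrable (by norm_num)), h0 k h,
        sub_zero]
  have hdu : MemLp (fun x => u x - vpMean N u x) 2 (torusMeasure d) := hu2.sub (hVu 2)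
  have hdw : MemLp (fun x => w x - vpMean N w x) 2 (torusMeasure d) := hw2.sub (hVw 2)
  have e : (fun x => u x * w x - vpMean N u x * vpMean N w x)
      = (fun x => w x * (u x - vpMean N u x)) + fun x => vpMean N u x * (w x - vpMean N w x) := by
    ext x
    simp only [Pi.add_apply]
    ring
  refine h1.trans ?_
  rw [e]
  refine (eLpNorm_add_le (hw.1.mul hdu.1) ((hVu 2).1.mul hdw.1) one_le_two).trans ?_
  rw [mul_add]
  refine add_le_add ((eLpNorm_bdd_mul_le hdu.1).trans ?_) ((eLpNorm_bdd_mul_le hdw.1).trans ?_)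
  · calc _ ≤ eLpNorm w ∞ (torusMeasure d) * tail N u := by
          gcongr; exact eLpNorm_sub_vpMean_le N hu2
      _ ≤ _ := le_mul_of_one_le_left zero_le (one_le_pow₀ one_le_two)
  · rw [← mul_assoc]
    gcongr
    · rw [eLpNorm_exponent_top]
      exact eLpNormEssSup_le_of_ae_enorm_bound
        (Filter.Eventually.of_forall fun x => enorm_vpMean_le N hu x)
    · exact eLpNorm_sub_vpMean_le N hw2

/-! ### Sobolev norms through dyadic tails. -/

lemma exists_abs_eq_of_notMem_box {N : ℕ} {k : Fin d → ℤ} (hk : k ∉ box d N) :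
    ∃ i, (N : ℤ) < |k i| := by
  simpa [mem_box] using hk

lemma bracket_le_of_mem_box {N : ℕ} {k : Fin d → ℤ} (hk : k ∈ box d N) :
    bracket k ≤ 1 + d * N := by
  refine (bracket_le_one_add_sum k).trans ?_
  have : ∑ i, |(k i : ℝ)| ≤ ∑ _i : Fin d, (N : ℝ) :=
    Finset.sum_le_sum fun i _ => by exact_mod_cast mem_box.1 hk i
  simpa using this

lemma exists_dyadic {k : Fin d → ℤ} (hk : k ∉ box d 6) :
    ∃ l : ℕ, k ∉ box d (6 * 2 ^ l) ∧ bracket k ≤ (1 + 12 * d) * 2 ^ l := by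
  have hex : ∃ l : ℕ, k ∈ box d (6 * 2 ^ l) := by
    refine ⟨∑ i, (k i).natAbs, mem_box.2 fun i => ?_⟩
    have h1 : (k i).natAbs ≤ ∑ i, (k i).natAbs :=
      Finset.single_le_sum (f := fun i => (k i).natAbs) (fun _ _ => Nat.zero_le _)
        (Finset.mem_univ i)
    have h2 := (Nat.lt_two_pow_self (n := ∑ i, (k i).natAbs)).le
    rw [Int.abs_eq_natAbs]
    exact_mod_cast (by omega : (k i).natAbs ≤ 6 * 2 ^ (∑ i, (k i).natAbs))
  classical
  have hspec := Nat.find_spec hex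
  have hpos : Nat.find hex ≠ 0 := by
    intro h
    rw [h] at hspec
    exact hk (by simpa using hspec)
  -- The level is the last one whose box misses k. The next box contains k, so ⟨k⟩ ≤ 1 + d · 6 ·
  -- 2^{l+1}, which explains the constant 1 + 12d.
  obtain ⟨l, hl⟩ := Nat.exists_eq_succ_of_ne_zero hpos
  refine ⟨l, Nat.find_min hex (by omega), ?_⟩
  rw [hl] at hspec
  refine (bracket_le_of_mem_box hspec).trans ?_
  have : (1 : ℝ) ≤ 2 ^ l := one_le_pow₀ one_le_two
  push_cast [pow_succ]
  nlinarith

/-- The dyadic square function of the tails. -/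
def tailNorm (σ : ℝ) (N : ℕ) (u : Torus d → ℂ) : ℝ≥0∞ :=
  l2 fun l : ℕ => ENNReal.ofReal (((2 : ℝ) ^ l) ^ σ) * tail (N * 2 ^ l) u

/-- Exchanging the sums exhibits the square function as a Fourier weight, to be compared frequency
by frequency with ⟨k⟩^{2σ}. -/
lemma tailNorm_sq (σ : ℝ) (N : ℕ) (u : Torus d → ℂ) :
    tailNorm σ N u ^ 2 = ∑' k : Fin d → ℤ, (∑' l : ℕ, if k ∈ box d (N * 2 ^ l) then 0 else
      ENNReal.ofReal (((2 : ℝ) ^ l) ^ σ) ^ 2) * ‖mFourierCoeff u k‖ₑ ^ 2 := by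
  unfold tailNorm tail
  rw [l2_sq]
  simp_rw [mul_pow, l2_sq, ← ENNReal.tsum_mul_left, ← ENNReal.tsum_mul_right]
  rw [ENNReal.tsum_comm]
  congr 1
  ext k
  congr 1
  ext l
  split_ifs <;> simp

/-- Outside the box 6 a single dyadic level with 2^l comparable to ⟨k⟩ already pays for the weight;
the remaining frequencies are bounded and covered by the L² norm. -/
lemma hn_le_tailNorm {σ : ℝ} (hσ : 0 ≤ σ) {u : Torus d → ℂ} (hu : MemLp u 2 (torusMeasure d)) :
    hn σ u ≤ ENNReal.ofReal ((1 + 12 * d) ^ σ)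
      * (eLpNorm u 2 (torusMeasure d) + tailNorm σ 6 u) := by
  set C := ENNReal.ofReal ((1 + 12 * (d : ℝ)) ^ σ)
  have h2 : eLpNorm u 2 (torusMeasure d) ^ 2 = ∑' k, ‖mFourierCoeff u k‖ₑ ^ 2 := by
    rw [← l2_mFourierCoeff hu, l2_sq]
  have hle : eLpNorm u 2 (torusMeasure d) ^ 2 + tailNorm σ 6 u ^ 2
      ≤ (eLpNorm u 2 (torusMeasure d) + tailNorm σ 6 u) ^ 2 := by
    rw [add_sq]
    exact add_le_add (le_self_add) le_rfl
  unfold hn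
  rw [l2_le_iff, mul_pow]
  refine le_trans ?_ (mul_le_mul_right hle _)
  rw [h2, tailNorm_sq, ← ENNReal.tsum_add, ← ENNReal.tsum_mul_left]
  refine ENNReal.tsum_le_tsum fun k => ?_
  rw [mul_pow, ← one_add_mul, ← mul_assoc]
  gcongr
  have hb := bracket_pos k
  by_cases hk : k ∈ box d 6
  · refine le_trans ?_ (mul_le_mul_right (le_self_add (a := 1)) (C ^ 2))
    rw [mul_one]
    gcongr
    refine ENNReal.ofReal_le_ofReal (Real.rpow_le_rpow hb.le ?_ hσ)
    have := bracket_le_of_mem_box hk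
    have hd : (0 : ℝ) ≤ d := d.cast_nonneg
    push_cast at this
    linarith
  · obtain ⟨l, hl, hl'⟩ := exists_dyadic hk
    refine le_trans ?_ (mul_le_mul_right ((ENNReal.le_tsum l).trans le_add_self) _)
    rw [if_neg hl, ← mul_pow]
    gcongr
    rw [← ENNReal.ofReal_mul (by positivity), ← Real.mul_rpow (by positivity) (by positivity)]
    exact ENNReal.ofReal_le_ofReal (Real.rpow_le_rpow hb.le hl' hσ)

lemma sum_pow_le_two_mul {q : ℝ≥0∞} (hq : 2 ≤ q) (n : ℕ) :
    ∑ l ∈ Finset.range (n + 1), q ^ l ≤ 2 * q ^ n := by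
  induction n with
  | zero => simp
  | succ n ih =>
    rw [Finset.sum_range_succ]
    calc _ ≤ 2 * q ^ n + q ^ (n + 1) := by gcongr
      _ ≤ q * q ^ n + q ^ (n + 1) := by gcongr
      _ = _ := by ring

/-- A frequency k contributes only at levels with 2^l < ⟨k⟩. The weights there form a geometric sum
of ratio q = 2^{2σ} ≥ 2, dominated by twice its last term. -/
lemma tailNorm_le_hn {σ : ℝ} (hσ : 1 ≤ σ) (u : Torus d → ℂ) :
    tailNorm σ 1 u ≤ 2 * hn σ u := by
  rw [← ENNReal.pow_le_pow_left_iff two_ne_zero, tailNorm_sq, mul_pow, hn, l2_sq,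
    ← ENNReal.tsum_mul_left]
  refine ENNReal.tsum_le_tsum fun k => ?_
  rw [mul_pow, ← mul_assoc]
  gcongr
  set q : ℝ≥0∞ := ENNReal.ofReal ((2 : ℝ) ^ σ) ^ 2 with hq
  have hq2 : 2 ≤ q := by
    have : (2 : ℝ) ≤ 2 ^ σ := Real.self_le_rpow_of_one_le one_le_two hσ
    calc (2 : ℝ≥0∞) = ENNReal.ofReal 2 := by simp
      _ ≤ ENNReal.ofReal (2 ^ σ) := ENNReal.ofReal_le_ofReal this
      _ ≤ q := by
          rw [hq, sq]
          refine le_mul_of_one_le_left zero_le ?_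
          rw [← ENNReal.ofReal_one]
          exact ENNReal.ofReal_le_ofReal (one_le_two.trans this)
  have e : ∀ l : ℕ, ENNReal.ofReal (((2 : ℝ) ^ l) ^ σ) ^ 2 = q ^ l := by
    intro l
    rw [← Real.rpow_pow_comm (by norm_num), ENNReal.ofReal_pow (by positivity), hq,
      pow_right_comm]
  simp_rw [e]
  obtain ⟨n, hn1, hn2⟩ := exists_nat_pow_near (one_le_bracket k) one_lt_two
  rw [tsum_eq_sum (s := Finset.range (n + 1))]
  · calc _ ≤ ∑ l ∈ Finset.range (n + 1), q ^ l :=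
          Finset.sum_le_sum fun l _ => by split_ifs <;> simp
      _ ≤ 2 * q ^ n := sum_pow_le_two_mul hq2 n
      _ ≤ _ := by
          rw [← e]
          gcongr
          · norm_num
          · exact ENNReal.ofReal_le_ofReal (Real.rpow_le_rpow (by positivity) hn1 (by linarith))
  · intro l hl
    rw [Finset.mem_range, not_lt] at hl
    rw [if_pos]
    by_contra h
    obtain ⟨i, hi⟩ := exists_abs_eq_of_notMem_box h
    have h1 : ((2 : ℝ) ^ l) < |(k i : ℝ)| := by exact_mod_cast (one_mul (2 ^ l : ℕ)) ▸ hi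
    have h2 : (2 : ℝ) ^ (n + 1) ≤ 2 ^ l := pow_le_pow_right₀ one_le_two hl
    linarith [abs_le_bracket k i]

/-- Products of bounded functions in `H^σ`. -/
lemma hn_mul_le (d : ℕ) {σ : ℝ} (hσ : 1 ≤ σ) : ∃ C : ℝ≥0, ∀ u w : Torus d → ℂ,
    MemLp u ∞ (torusMeasure d) → MemLp w ∞ (torusMeasure d) →
    hn σ (fun x => u x * w x) ≤ C * (eLpNorm w ∞ (torusMeasure d) * hn σ u
      + eLpNorm u ∞ (torusMeasure d) * hn σ w) := by
  refine ⟨Real.toNNReal ((1 + 12 * d) ^ σ) * (1 + 2 ^ d * 2), fun u w hu hw => ?_⟩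
  have hu2 : MemLp u 2 (torusMeasure d) := hu.mono_exponent le_top
  have hw2 : MemLp w 2 (torusMeasure d) := hw.mono_exponent le_top
  set U := eLpNorm u ∞ (torusMeasure d)
  set W := eLpNorm w ∞ (torusMeasure d)
  -- The tail estimate at N = 2^l, weighted and summed over l; the factor 6 lost in frequency is why
  -- the two comparisons use different base boxes.
  have h1 : tailNorm σ 6 (fun x => u x * w x)
      ≤ 2 ^ d * (W * tailNorm σ 1 u + U * tailNorm σ 1 w) := by
    unfold tailNorm
    rw [← l2_const_mul, ← l2_const_mul]
    refine le_trans ?_ (mul_le_mul_right (l2_add_le _ _) _)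
    rw [← l2_const_mul]
    refine l2_mono fun l => ?_
    refine (mul_le_mul_right (tail_mul_le (2 ^ l) hu hw) _).trans_eq ?_
    rw [one_mul]
    ring
  have h2 : eLpNorm (fun x => u x * w x) 2 (torusMeasure d) ≤ W * hn σ u + U * hn σ w :=
    (eLpNorm_bdd_mul_le hw2.1).trans ((mul_le_mul_right
      (eLpNorm_le_hn (zero_le_one.trans hσ) hw2) _).trans le_add_self)
  refine (hn_le_tailNorm (zero_le_one.trans hσ) (MemLp.bdd_mul_two hu hw2)).trans ?_
  push_cast
  rw [mul_assoc]
  refine mul_le_mul_right ?_ _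
  calc _ ≤ (W * hn σ u + U * hn σ w) + 2 ^ d * (W * (2 * hn σ u) + U * (2 * hn σ w)) := by
        refine add_le_add h2 (h1.trans ?_)
        gcongr <;> exact tailNorm_le_hn hσ _
    _ = _ := by ring

/-! ### Truncated Fourier series -/

lemma isSmooth_trigPoly (S : Finset (Fin d → ℤ)) (a : (Fin d → ℤ) → ℂ) :
    IsSmooth (trigPoly S a) := by
  have h : ∀ k ∈ S, ContDiff ℝ ∞ fun y : Fin d → ℝ =>
      a k * mFourier k (fun i => (y i : UnitAddCircle)) :=
    fun k _ => contDiff_const.mul (isSmooth_mFourier k)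
  exact ContDiff.sum h

lemma partialDeriv_trigPoly (i : Fin d) (S : Finset (Fin d → ℤ)) (a : (Fin d → ℤ) → ℂ)
    (x : Torus d) :
    partialDeriv i (trigPoly S a) x
      = trigPoly S (fun k => 2 * Real.pi * Complex.I * k i * a k) x := by
  have h : ∀ k ∈ S, HasDerivAt
      (fun t : ℝ => a k * mFourier k (x + Pi.single i (t : UnitAddCircle)))
      (a k * partialDeriv i (fun x => mFourier k x) x) 0 := fun k _ =>
    ((isSmooth_mFourier k).hasDerivAt_zero i x).const_mul (a k)
  have h2 := (HasDerivAt.fun_sum h).deriv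
  unfold trigPoly
  refine h2.trans (Finset.sum_congr rfl fun k _ => ?_)
  rw [partialDeriv_mFourier]
  ring

lemma memLp_of_continuous {E : Type*} [NormedAddCommGroup E] [SecondCountableTopology E]
    {f : Torus d → E} (hf : Continuous f) (p : ℝ≥0∞) : MemLp f p (torusMeasure d) := by
  obtain ⟨B, hB⟩ := isCompact_univ.exists_bound_of_continuousOn hf.continuousOn
  exact MemLp.of_bound hf.aestronglyMeasurable B
    (Filter.Eventually.of_forall fun x => hB x (Set.mem_univ x))

/-- The real part of the truncated Fourier series. -/
def truncate (R : ℕ) (c : Torus d → ℝ) (x : Torus d) : ℝ :=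
  (trigPoly (box d R) (mFourierCoeff fun x => (c x : ℂ)) x).re

lemma isSmooth_truncate (R : ℕ) (c : Torus d → ℝ) : IsSmooth (truncate R c) :=
  (isSmooth_trigPoly _ _).clm_comp Complex.reCLM

lemma partialDeriv_truncate (i : Fin d) (R : ℕ) (c : Torus d → ℝ) (x : Torus d) :
    partialDeriv i (truncate R c) x = (trigPoly (box d R)
      (fun k => 2 * Real.pi * Complex.I * k i * mFourierCoeff (fun x => (c x : ℂ)) k) x).re := by
  rw [← partialDeriv_trigPoly]
  exact partialDeriv_clm_comp Complex.reCLM (isSmooth_trigPoly _ _) i x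

lemma partialDeriv_partialDeriv_truncate (i : Fin d) (R : ℕ) (c : Torus d → ℝ) (x : Torus d) :
    partialDeriv i (partialDeriv i (truncate R c)) x = (trigPoly (box d R)
      (fun k => 2 * Real.pi * Complex.I * k i * (2 * Real.pi * Complex.I * k i *
        mFourierCoeff (fun x => (c x : ℂ)) k)) x).re := by
  rw [← partialDeriv_trigPoly, funext (partialDeriv_truncate i R c)]
  exact partialDeriv_clm_comp Complex.reCLM (isSmooth_trigPoly _ _) i x

lemma eLpNorm_re_le (u : Torus d → ℂ) (p : ℝ≥0∞) :
    eLpNorm (fun x => (u x).re) p (torusMeasure d) ≤ eLpNorm u p (torusMeasure d) :=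
  eLpNorm_mono fun _ => Complex.abs_re_le_norm _

lemma tendsto_box_atTop : Filter.Tendsto (box d) Filter.atTop Filter.atTop := by
  refine Filter.tendsto_atTop_finset_of_monotone (fun _ _ h => box_mono h) fun k => ?_
  refine ⟨∑ i, (k i).natAbs, mem_box.2 fun i => ?_⟩
  have h1 : (k i).natAbs ≤ ∑ i, (k i).natAbs :=
    Finset.single_le_sum (f := fun i => (k i).natAbs) (fun _ _ => Nat.zero_le _)
      (Finset.mem_univ i)
  rw [Int.abs_eq_natAbs]
  exact_mod_cast h1

lemma tendsto_tail {u : Torus d → ℂ} (hu : MemLp u 2 (torusMeasure d)) :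
    Filter.Tendsto (fun R => tail R u) Filter.atTop (nhds 0) := by
  have h0 : ∑' k, ‖mFourierCoeff u k‖ₑ ^ 2 ≠ ⊤ := by
    rw [← l2_sq, l2_mFourierCoeff hu]
    exact (ENNReal.pow_lt_top hu.2).ne
  have h1 := (ENNReal.tendsto_tsum_compl_atTop_zero h0).comp (tendsto_box_atTop (d := d))
  have h2 := (ENNReal.continuous_rpow_const (y := (1 / 2 : ℝ))).tendsto 0 |>.comp h1
  rw [ENNReal.zero_rpow_of_pos (by norm_num)] at h2
  refine h2.congr fun R => ?_
  simp only [Function.comp, tail, l2]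
  congr 1
  refine (tsum_subtype {x | x ∉ box d R} (fun k => ‖mFourierCoeff u k‖ₑ ^ 2)).trans ?_
  congr 1
  ext k
  by_cases h : k ∈ box d R <;> simp [Set.indicator, h]

lemma eLpNorm_trigPoly_sub_le (R : ℕ) {u : Torus d → ℂ} (hu : MemLp u 2 (torusMeasure d)) :
    eLpNorm (fun x => trigPoly (box d R) (mFourierCoeff u) x - u x) 2 (torusMeasure d)
      ≤ tail R u := by
  have hd : MemLp (fun x => trigPoly (box d R) (mFourierCoeff u) x - u x) 2 (torusMeasure d) :=
    (memLp_trigPoly _ _ _).sub hu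
  rw [← l2_mFourierCoeff hd]
  refine l2_mono fun k => ?_
  rw [mFourierCoeff_sub ((memLp_trigPoly _ _ 2).integrable (by norm_num))
    (hu.integrable (by norm_num)), mFourierCoeff_trigPoly]
  split_ifs <;> simp

lemma eLpNorm_trigPoly_le (S : Finset (Fin d → ℤ)) (a : (Fin d → ℤ) → ℂ) :
    eLpNorm (trigPoly S a) 2 (torusMeasure d) ≤ l2 (fun k => ‖a k‖ₑ) := by
  rw [← l2_mFourierCoeff (memLp_trigPoly _ _ _)]
  refine l2_mono fun k => ?_
  rw [mFourierCoeff_trigPoly]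
  split_ifs <;> simp

/-- A function with summable Fourier coefficients is the uniform limit of its Fourier series. -/
lemma exists_tendstoUniformly_trigPoly {u : Torus d → ℂ} (hu : MemLp u 2 (torusMeasure d))
    (hs : ∑' k, ‖mFourierCoeff u k‖ₑ < ⊤) : ∃ g : Torus d → ℂ, u =ᵐ[torusMeasure d] g ∧
      TendstoUniformly (fun R => trigPoly (box d R) (mFourierCoeff u)) g Filter.atTop := by
  have hsum : Summable fun k => ‖mFourierCoeff u k‖ := by
    have := ENNReal.summable_toReal hs.ne
    simpa using this
  have hb : ∀ k x, ‖mFourierCoeff u k * mFourier k x‖ ≤ ‖mFourierCoeff u k‖ := fun k x => by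
    rw [norm_mul, norm_mFourier_apply, mul_one]
  have hunif := tendstoUniformly_tsum hsum hb
  set g : Torus d → ℂ := fun x => ∑' k, mFourierCoeff u k * mFourier k x with hg
  have hunif' : TendstoUniformly (fun R => trigPoly (box d R) (mFourierCoeff u)) g Filter.atTop :=
    fun V hV => (tendsto_box_atTop (d := d)).eventually (hunif V hV)
  have hgc : Continuous g :=
    hunif'.continuous (Filter.Frequently.of_forall fun R => (isSmooth_trigPoly _ _).continuous)
  -- The uniform sum is identified with u by its Fourier coefficients, computed termwise.
  refine ⟨g, eq_ae_of_mFourierCoeff_eq hu (memLp_of_continuous hgc 2) fun k => ?_, hunif'⟩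
  have hint : ∀ m, Integrable (fun x => mFourier (-k) x * (mFourierCoeff u m * mFourier m x))
      (torusMeasure d) := fun m => integrable_mFourier_mul
    (((memLp_mFourier m 2).const_mul _).integrable (by norm_num)) _
  have h := hasSum_integral_of_summable_integral_norm hint (by
    refine hsum.congr fun m => ?_
    simp [norm_mFourier_apply])
  have e : ∀ m, ∫ x, mFourier (-k) x * (mFourierCoeff u m * mFourier m x) ∂(torusMeasure d)
      = if k = m then mFourierCoeff u m else 0 := by
    intro m
    have := mFourierCoeff_const_mul (mFourierCoeff u m) (fun x => mFourier m x) k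
    rw [mFourierCoeff_def, mFourierCoeff_mFourier] at this
    rw [this]
    simp
  simp_rw [e, tsum_mul_left] at h
  rw [mFourierCoeff_def g, hg]
  refine HasSum.unique ?_ h
  convert! hasSum_ite_eq k (mFourierCoeff u k) using 2 with m
  by_cases hm : m = k
  · subst hm; simp
  · rw [if_neg hm, if_neg (Ne.symm hm)]

lemma exists_tendstoUniformly_truncate {c : Torus d → ℝ} (hc : MemLp c 2 (torusMeasure d))
    (hs : ∑' k, ‖mFourierCoeff (fun x => (c x : ℂ)) k‖ₑ < ⊤) :
    ∃ g : Torus d → ℝ, c =ᵐ[torusMeasure d] g ∧ Continuous g ∧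
      TendstoUniformly (fun R => truncate R c) g Filter.atTop := by
  obtain ⟨g, hg, hu⟩ := exists_tendstoUniformly_trigPoly (u := fun x => (c x : ℂ)) hc.ofReal hs
  have hgc : Continuous g :=
    hu.continuous (Filter.Frequently.of_forall fun R => (isSmooth_trigPoly _ _).continuous)
  refine ⟨fun x => (g x).re, ?_, Complex.continuous_re.comp hgc, ?_⟩
  · filter_upwards [hg] with x hx
    rw [← hx, Complex.ofReal_re]
  · exact Complex.uniformContinuous_re.comp_tendstoUniformly hu

/-! ### Composition with smooth functions -/

lemma IsSmooth.comp_real {f : Torus d → ℝ} (hf : IsSmooth f) {B : ℝ → ℝ} (hB : ContDiff ℝ ∞ B) :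
    IsSmooth (fun x => B (f x)) :=
  hB.comp hf

lemma IsSmooth.ofReal {f : Torus d → ℝ} (hf : IsSmooth f) : IsSmooth (fun x => (f x : ℂ)) :=
  hf.clm_comp Complex.ofRealCLM

lemma partialDeriv_ofReal {f : Torus d → ℝ} (hf : IsSmooth f) (i : Fin d) (x : Torus d) :
    partialDeriv i (fun x => (f x : ℂ)) x = ((partialDeriv i f x : ℝ) : ℂ) :=
  partialDeriv_clm_comp Complex.ofRealCLM hf i x

lemma partialDeriv_comp_real {f : Torus d → ℝ} (hf : IsSmooth f) {B : ℝ → ℝ}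
    (hB : ContDiff ℝ ∞ B) (i : Fin d) (x : Torus d) :
    partialDeriv i (fun x => B (f x)) x = deriv B (f x) * partialDeriv i f x := by
  have h1 : HasDerivAt B (deriv B (f x)) (f x) :=
    (hB.differentiable (by simp) (f x)).hasDerivAt
  exact (HasDerivAt.comp_of_eq (0 : ℝ) h1 (hf.hasDerivAt_zero i x) (by simp)).deriv

lemma IsSmooth.mul_real {f g : Torus d → ℝ} (hf : IsSmooth f) (hg : IsSmooth g) :
    IsSmooth (fun x => f x * g x) :=
  ContDiff.mul hf hg

lemma partialDeriv_mul_real {f g : Torus d → ℝ} (hf : IsSmooth f) (hg : IsSmooth g) (i : Fin d)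
    (x : Torus d) : partialDeriv i (fun x => f x * g x) x
      = partialDeriv i f x * g x + f x * partialDeriv i g x := by
  have := ((hf.hasDerivAt_zero i x).fun_mul (hg.hasDerivAt_zero i x)).deriv
  simp only [QuotientAddGroup.mk_zero, Pi.single_zero, add_zero] at this
  exact this

lemma integral_partialDeriv_real {f : Torus d → ℝ} (hf : IsSmooth f) (i : Fin d) :
    ∫ x, partialDeriv i f x ∂(torusMeasure d) = 0 := by
  have h := integral_partialDeriv_eq_zero hf.ofReal i
  simp_rw [partialDeriv_ofReal hf] at h
  rw [integral_complex_ofReal] at h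
  exact_mod_cast h

/-- The Gagliardo-Nirenberg inequality `‖∂f‖_{L⁴}² ≤ 3 ‖f‖_{L^∞} ‖∂²f‖_{L²}`. -/
lemma integral_partialDeriv_pow_four_le {f : Torus d → ℝ} (hf : IsSmooth f) (i : Fin d) {M : ℝ}
    (hM : ∀ x, |f x| ≤ M) :
    ∫ x, (partialDeriv i f x ^ 2) ^ 2 ∂(torusMeasure d)
      ≤ (3 * M) ^ 2 * ∫ x, partialDeriv i (partialDeriv i f) x ^ 2 ∂(torusMeasure d) := by
  set f' := partialDeriv i f
  have hf' : IsSmooth f' := hf.isSmooth_partialDeriv i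
  set f'' := partialDeriv i f'
  have hf'' : IsSmooth f'' := hf'.isSmooth_partialDeriv i
  have hi : ∀ {g : Torus d → ℝ}, Continuous g → Integrable g (torusMeasure d) := fun hg =>
    (memLp_of_continuous hg 2).integrable (by norm_num)
  -- The derivative of f (∂f)³ is (∂f)⁴ + 3 f (∂f)² ∂²f, and it has integral zero.
  have h1 := integral_partialDeriv_real (hf.mul_real (hf'.comp_real (contDiff_id.pow 3))) i
  have e : ∀ x, partialDeriv i (fun x => f x * (id (f' x)) ^ 3) x
      = (f' x ^ 2) ^ 2 + 3 * (f x * f' x ^ 2 * f'' x) := by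
    intro x
    have hd : deriv (fun r : ℝ => id r ^ 3) (f' x) = 3 * f' x ^ 2 := by simp
    have := partialDeriv_mul_real hf (hf'.comp_real (contDiff_id.pow 3)) i x
    rw [partialDeriv_comp_real hf' (contDiff_id.pow 3)] at this
    refine this.trans ?_
    rw [hd]
    simp only [id]
    ring
  have c1 : Continuous fun x => (f' x ^ 2) ^ 2 := (hf'.continuous.pow 2).pow 2
  have c2 : Continuous fun x => 3 * (f x * f' x ^ 2 * f'' x) :=
    continuous_const.mul ((hf.continuous.mul (hf'.continuous.pow 2)).mul hf''.continuous)
  have c3 : Continuous fun x => f'' x ^ 2 := hf''.continuous.pow 2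
  have h2 : ∫ x, partialDeriv i (fun x => f x * (id (f' x)) ^ 3) x ∂(torusMeasure d) = 0 := h1
  simp_rw [e] at h2
  rw [integral_add (hi c1) (hi c2)] at h2
  -- Young's inequality; half of the integral of (∂f)⁴ is absorbed on the left.
  have h3 : ∫ x, -(3 * (f x * f' x ^ 2 * f'' x)) ∂(torusMeasure d)
      ≤ ∫ x, (1 / 2 * (f' x ^ 2) ^ 2 + (3 * M) ^ 2 / 2 * f'' x ^ 2) ∂(torusMeasure d) := by
    refine integral_mono (hi c2).neg (((hi c1).const_mul _).add ((hi c3).const_mul _)) fun x => ?_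
    have hM0 : f x ^ 2 ≤ M ^ 2 := sq_le_sq' (by linarith [abs_le.1 (hM x)]) (abs_le.1 (hM x)).2
    have h5 : f x ^ 2 * f'' x ^ 2 ≤ M ^ 2 * f'' x ^ 2 := by gcongr
    simp only
    nlinarith [sq_nonneg (f' x ^ 2 + 3 * (f x * f'' x))]
  rw [integral_neg, integral_add ((hi c1).const_mul _) ((hi c3).const_mul _), integral_const_mul,
    integral_const_mul] at h3
  rw [integral_const_mul] at h2 h3
  linarith

lemma eLpNorm_two_sq_eq {f : Torus d → ℝ} (hf : Continuous f) :
    eLpNorm f 2 (torusMeasure d) ^ 2 = ENNReal.ofReal (∫ x, f x ^ 2 ∂(torusMeasure d)) := by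
  have hi : Integrable (fun x => f x ^ 2) (torusMeasure d) :=
    (memLp_of_continuous (hf.pow 2) 2).integrable (by norm_num)
  rw [ofReal_integral_eq_lintegral_ofReal hi (Filter.Eventually.of_forall fun x => by
    positivity), eLpNorm_eq_lintegral_rpow_enorm_toReal two_ne_zero ENNReal.ofNat_ne_top,
    ← ENNReal.rpow_natCast, ← ENNReal.rpow_mul]
  have : ∀ x, ENNReal.ofReal (f x ^ 2) = ‖f x‖ₑ ^ 2 := fun x => by
    rw [← sq_abs, ENNReal.ofReal_pow (abs_nonneg _), Real.enorm_eq_ofReal_abs]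
  simp [this]

lemma eLpNorm_partialDeriv_sq_le {f : Torus d → ℝ} (hf : IsSmooth f) (i : Fin d) {M : ℝ≥0}
    (hM : ∀ x, |f x| ≤ M) :
    eLpNorm (fun x => partialDeriv i f x ^ 2) 2 (torusMeasure d)
      ≤ 3 * M * eLpNorm (partialDeriv i (partialDeriv i f)) 2 (torusMeasure d) := by
  have hf' := hf.isSmooth_partialDeriv i
  refine (ENNReal.pow_le_pow_left_iff two_ne_zero).1 ?_
  have hc : Continuous fun x => partialDeriv i f x ^ 2 := hf'.continuous.pow 2
  rw [mul_pow, eLpNorm_two_sq_eq hc,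
    eLpNorm_two_sq_eq (hf'.isSmooth_partialDeriv i).continuous]
  refine (ENNReal.ofReal_le_ofReal (integral_partialDeriv_pow_four_le hf i hM)).trans_eq ?_
  rw [ENNReal.ofReal_mul (by positivity)]
  congr 1
  rw [ENNReal.ofReal_pow (by positivity), ENNReal.ofReal_mul (by norm_num)]
  simp

lemma exists_bound_deriv {B : ℝ → ℝ} (hB : ContDiff ℝ ∞ B) (M : ℝ≥0) :
    ∃ β : ℝ≥0, ∀ r : ℝ, |r| ≤ M → |B r| ≤ β := by
  obtain ⟨C, hC⟩ := isCompact_Icc.exists_bound_of_continuousOn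
    (s := Set.Icc (-(M : ℝ)) M) hB.continuous.continuousOn
  exact ⟨C.toNNReal, fun r hr => (hC r (abs_le.1 hr)).trans (Real.le_coe_toNNReal C)⟩

lemma contDiff_deriv {B : ℝ → ℝ} (hB : ContDiff ℝ ∞ B) : ContDiff ℝ ∞ (deriv B) := by
  rw [contDiff_infty_iff_deriv] at hB
  exact hB.2

/-- A smooth function vanishing at the origin is Lipschitz at the origin. -/
lemma exists_bound_mul_abs {B : ℝ → ℝ} (hB : ContDiff ℝ ∞ B) (hB0 : B 0 = 0) (M : ℝ≥0) :
    ∃ β : ℝ≥0, ∀ r : ℝ, |r| ≤ M → |B r| ≤ β * |r| := by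
  obtain ⟨β, hβ⟩ := exists_bound_deriv (contDiff_deriv hB) M
  refine ⟨β, fun r hr => ?_⟩
  have := (convex_Icc (-(M : ℝ)) M).norm_image_sub_le_of_norm_deriv_le (f := B) (C := β)
    (x := 0) (y := r) (fun x _ => hB.differentiable (by simp) x)
    (fun x hx => hβ x (abs_le.2 hx)) (abs_le.1 (by simp)) (abs_le.1 hr)
  simpa [hB0] using this

/-- Fatou's lemma on the Fourier side: finite partial sums pass to the limit. Bounds proved for
smooth truncations transfer to c in this way. -/
lemma hn_le_of_tendsto {σ : ℝ} {u : ℕ → Torus d → ℂ} {v : Torus d → ℂ} {C : ℝ≥0∞}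
    (h : ∀ k, Filter.Tendsto (fun R => mFourierCoeff (u R) k) Filter.atTop
      (nhds (mFourierCoeff v k)))
    (hC : ∀ᶠ R in Filter.atTop, hn σ (u R) ≤ C) : hn σ v ≤ C := by
  unfold hn at hC ⊢
  simp only [l2_le_iff] at hC ⊢
  rw [ENNReal.tsum_eq_iSup_sum]
  refine iSup_le fun S => ?_
  have ht : Filter.Tendsto (fun R => ∑ k ∈ S, (wt σ k * ‖mFourierCoeff (u R) k‖ₑ) ^ 2)
      Filter.atTop (nhds (∑ k ∈ S, (wt σ k * ‖mFourierCoeff v k‖ₑ) ^ 2)) := by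
    refine tendsto_finsetSum _ fun k _ => ?_
    refine ((ENNReal.continuous_pow 2).tendsto _).comp ?_
    exact ENNReal.Tendsto.const_mul ((continuous_enorm.tendsto _).comp (h k))
      (Or.inr (wt_ne_top σ k))
  refine le_of_tendsto ht ?_
  filter_upwards [hC] with R hR
  exact (ENNReal.sum_le_tsum S).trans hR

/-- The weight 1 + |k|² involves the squares kᵢ² alone, so mixed second derivatives are not needed.
-/
lemma hn_two_le {u : Torus d → ℂ} (hu : MemLp u 2 (torusMeasure d)) {u'' : Fin d → Torus d → ℂ}
    (hu'' : ∀ i, MemLp (u'' i) 2 (torusMeasure d))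
    (h : ∀ i k, mFourierCoeff (u'' i) k = 2 * Real.pi * Complex.I * k i *
      (2 * Real.pi * Complex.I * k i * mFourierCoeff u k)) :
    hn 2 u ≤ eLpNorm u 2 (torusMeasure d) + ∑ i, eLpNorm (u'' i) 2 (torusMeasure d) := by
  simp_rw [← l2_mFourierCoeff hu, fun i => (l2_mFourierCoeff (hu'' i)).symm]
  refine (l2_mono fun k => ?_).trans ((l2_add_le _ _).trans
    (add_le_add le_rfl (l2_sum_le Finset.univ (fun i k => ‖mFourierCoeff (u'' i) k‖ₑ))))
  rw [wt_two, ENNReal.ofReal_add zero_le_one (Finset.sum_nonneg fun _ _ => sq_nonneg _), add_mul,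
    ENNReal.ofReal_one, one_mul, ENNReal.ofReal_sum_of_nonneg (fun _ _ => sq_nonneg _),
    Finset.sum_mul]
  gcongr with i
  rw [h, enorm_two_pi_I_mul, enorm_two_pi_I_mul, ← sq_abs, ENNReal.ofReal_pow (abs_nonneg _)]
  calc _ = 1 * (ENNReal.ofReal |(k i : ℝ)| * (1 * (ENNReal.ofReal |(k i : ℝ)|
        * ‖mFourierCoeff u k‖ₑ))) := by ring
    _ ≤ _ := by gcongr <;> exact ofReal_two_pi_ge_one

lemma enorm_mFourierCoeff_le {u : Torus d → ℂ} (hu : MemLp u 2 (torusMeasure d)) (k : Fin d → ℤ) :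
    ‖mFourierCoeff u k‖ₑ ≤ eLpNorm u 2 (torusMeasure d) := by
  rw [← l2_mFourierCoeff hu]
  exact le_l2 (fun k => ‖mFourierCoeff u k‖ₑ) k

lemma tendsto_mFourierCoeff_comp_mul {f : ℕ → Torus d → ℝ} {g : Torus d → ℝ} {B : ℝ → ℝ}
    (hB : Continuous B) {β : ℝ} (hf : ∀ R, Continuous (f R))
    (hβ : ∀ᶠ R in Filter.atTop, ∀ x, |B (f R x)| ≤ β)
    (hfg : ∀ x, Filter.Tendsto (fun R => f R x) Filter.atTop (nhds (g x)))
    {w : Torus d → ℝ} (hw : Integrable w (torusMeasure d)) (k : Fin d → ℤ) :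
    Filter.Tendsto (fun R => mFourierCoeff (fun x => ((B (f R x) * w x : ℝ) : ℂ)) k) Filter.atTop
      (nhds (mFourierCoeff (fun x => ((B (g x) * w x : ℝ) : ℂ)) k)) := by
  simp only [mFourierCoeff_def]
  refine tendsto_integral_filter_of_dominated_convergence (fun x => β * ‖w x‖) ?_ ?_
    (hw.norm.const_mul β) ?_
  · refine Filter.Eventually.of_forall fun R => ?_
    exact (mFourier (-k)).continuous.aestronglyMeasurable.mul
      (Complex.continuous_ofReal.comp_aestronglyMeasurable
        ((hB.comp (hf R)).aestronglyMeasurable.mul hw.1))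
  · filter_upwards [hβ] with R hR
    refine Filter.Eventually.of_forall fun x => ?_
    rw [norm_mul, norm_mFourier_apply, one_mul, Complex.norm_real, norm_mul]
    gcongr
    exact hR x
  · refine Filter.Eventually.of_forall fun x => ?_
    refine Filter.Tendsto.const_mul _ ((Complex.continuous_ofReal.tendsto _).comp ?_)
    exact ((hB.tendsto _).comp (hfg x)).mul_const _

lemma memLp_ofReal_of_continuous {f : Torus d → ℝ} (hf : Continuous f) (p : ℝ≥0∞) :
    MemLp (fun x => (f x : ℂ)) p (torusMeasure d) :=
  memLp_of_continuous (Complex.continuous_ofReal.comp hf) p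

lemma eventually_abs_truncate_le {c g : Torus d → ℝ} {M : ℝ} (hg : ∀ x, |g x| ≤ M)
    (h : TendstoUniformly (fun R => truncate R c) g Filter.atTop) :
    ∀ᶠ R in Filter.atTop, ∀ x, |truncate R c x| ≤ M + 1 := by
  filter_upwards [Metric.tendstoUniformly_iff.1 h 1 one_pos] with R hR x
  have h1 := hR x
  rw [Real.dist_eq, abs_sub_comm] at h1
  have h2 := abs_sub_abs_le_abs_sub (truncate R c x) (g x)
  linarith [hg x]

lemma enorm_ofReal_complex (r : ℝ) : ‖(r : ℂ)‖ₑ = ‖r‖ₑ := by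
  rw [← ofReal_norm, ← ofReal_norm, Complex.norm_real]

lemma eLpNorm_ofReal (f : Torus d → ℝ) (p : ℝ≥0∞) :
    eLpNorm (fun x => (f x : ℂ)) p (torusMeasure d) = eLpNorm f p (torusMeasure d) :=
  eLpNorm_congr_norm_ae (Filter.Eventually.of_forall fun _ => Complex.norm_real _)

/-- The chain rule on the Fourier side. -/
lemma mFourierCoeff_chain {c w : Torus d → ℝ} (hc : MemLp c 2 (torusMeasure d))
    (hs : ∑' k, ‖mFourierCoeff (fun x => (c x : ℂ)) k‖ₑ < ⊤) (hw : MemLp w 2 (torusMeasure d))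
    {i : Fin d} (hwc : ∀ k, mFourierCoeff (fun x => (w x : ℂ)) k
      = 2 * Real.pi * Complex.I * k i * mFourierCoeff (fun x => (c x : ℂ)) k)
    {B : ℝ → ℝ} (hB : ContDiff ℝ ∞ B) (k : Fin d → ℤ) :
    mFourierCoeff (fun x => ((deriv B (c x) * w x : ℝ) : ℂ)) k
      = 2 * Real.pi * Complex.I * k i * mFourierCoeff (fun x => (B (c x) : ℂ)) k := by
  obtain ⟨g, hcg, hgc, hunif⟩ := exists_tendstoUniformly_truncate hc hs
  obtain ⟨G, hG⟩ := isCompact_univ.exists_bound_of_continuousOn hgc.continuousOn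
  have hev := eventually_abs_truncate_le (M := G) (fun x => hG x (Set.mem_univ x)) hunif
  obtain ⟨β, hβ⟩ := exists_bound_deriv hB (G + 1).toNNReal
  obtain ⟨β', hβ'⟩ := exists_bound_deriv (contDiff_deriv hB) (G + 1).toNNReal
  have hB' : Continuous (deriv B) := (contDiff_deriv hB).continuous
  have hsm := fun R => isSmooth_truncate R c
  have hpt := fun x => hunif.tendsto_at x
  have hev1 : ∀ᶠ R in Filter.atTop, ∀ x, |B (truncate R c x)| ≤ β := by
    filter_upwards [hev] with R hR x
    exact hβ _ ((hR x).trans (Real.le_coe_toNNReal _))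
  have hev2 : ∀ᶠ R in Filter.atTop, ∀ x, |deriv B (truncate R c x)| ≤ β' := by
    filter_upwards [hev] with R hR x
    exact hβ' _ ((hR x).trans (Real.le_coe_toNNReal _))
  have t1 := tendsto_mFourierCoeff_comp_mul hB.continuous (fun R => (hsm R).continuous) hev1 hpt
    (integrable_const 1) k
  have t2 := tendsto_mFourierCoeff_comp_mul hB' (fun R => (hsm R).continuous) hev2 hpt
    (hw.integrable (by norm_num)) k
  simp only [mul_one] at t1
  have hd : ∀ R, MemLp (fun x => partialDeriv i (truncate R c) x - w x) 2 (torusMeasure d) :=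
    fun R => (memLp_of_continuous ((hsm R).isSmooth_partialDeriv i).continuous 2).sub hw
  have hdle : ∀ R, eLpNorm (fun x => partialDeriv i (truncate R c) x - w x) 2 (torusMeasure d)
      ≤ tail R (fun x => (w x : ℂ)) := by
    intro R
    refine le_trans ?_ (eLpNorm_trigPoly_sub_le R hw.ofReal)
    refine eLpNorm_mono fun x => ?_
    rw [funext hwc, partialDeriv_truncate]
    simpa using Complex.abs_re_le_norm (trigPoly (box d R) (fun k => 2 * Real.pi * Complex.I * k i *
      mFourierCoeff (fun x => (c x : ℂ)) k) x - (w x : ℂ))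
  have hb : ∀ R, MemLp (fun x => ((deriv B (truncate R c x) : ℝ) : ℂ)) ∞ (torusMeasure d) :=
    fun R => memLp_ofReal_of_continuous (hB'.comp (hsm R).continuous) ∞
  -- The derivatives of the truncations converge to w in L² while B′ stays uniformly bounded along
  -- them, so the error in the smooth chain rule vanishes in the limit.
  have t3 : Filter.Tendsto (fun R => mFourierCoeff (fun x => ((deriv B (truncate R c x) *
      (partialDeriv i (truncate R c) x - w x) : ℝ) : ℂ)) k) Filter.atTop (nhds 0) := by
    rw [tendsto_zero_iff_enorm_tendsto_zero]
    have t4 : Filter.Tendsto (fun R => (β' : ℝ≥0∞) * tail R (fun x => (w x : ℂ))) Filter.atTop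
        (nhds 0) := by
      simpa using ENNReal.Tendsto.const_mul (tendsto_tail (u := fun x => (w x : ℂ)) hw.ofReal)
        (Or.inr (ENNReal.coe_ne_top (r := β')))
    refine tendsto_of_tendsto_of_tendsto_of_le_of_le' tendsto_const_nhds t4
      (Filter.Eventually.of_forall fun _ => zero_le) ?_
    filter_upwards [hev2] with R hR
    have hd' : MemLp (fun x => ((partialDeriv i (truncate R c) x - w x : ℝ) : ℂ)) 2
      (torusMeasure d) := (hd R).ofReal
    have hm := MemLp.bdd_mul_two (hb R) hd'
    simp_rw [← Complex.ofReal_mul] at hm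
    refine (enorm_mFourierCoeff_le hm k).trans ?_
    simp_rw [Complex.ofReal_mul]
    refine (eLpNorm_bdd_mul_le hd'.1).trans ?_
    rw [eLpNorm_ofReal, eLpNorm_ofReal]
    refine mul_le_mul' ?_ (hdle R)
    rw [eLpNorm_exponent_top]
    refine eLpNormEssSup_le_of_ae_enorm_bound (Filter.Eventually.of_forall fun x => ?_)
    rw [Real.enorm_eq_ofReal_abs, ← ENNReal.ofReal_coe_nnreal]
    exact ENNReal.ofReal_le_ofReal (hR x)
  have e1 : ∀ R, mFourierCoeff (fun x => ((deriv B (truncate R c x) *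
      (partialDeriv i (truncate R c) x - w x) : ℝ) : ℂ)) k
      + mFourierCoeff (fun x => ((deriv B (truncate R c x) * w x : ℝ) : ℂ)) k
      = 2 * Real.pi * Complex.I * k i *
        mFourierCoeff (fun x => (B (truncate R c x) : ℂ)) k := by
    intro R
    have hsB := (hsm R).comp_real hB
    have i1 : Integrable (fun x => ((deriv B (truncate R c x) *
      (partialDeriv i (truncate R c) x - w x) : ℝ) : ℂ)) (torusMeasure d) := by
      have := (MemLp.bdd_mul_two (hb R) (hd R).ofReal).integrable (by norm_num)
      simpa using this
    have i2 : Integrable (fun x => ((deriv B (truncate R c x) * w x : ℝ) : ℂ))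
        (torusMeasure d) := by
      have := (MemLp.bdd_mul_two (hb R) hw.ofReal).integrable (by norm_num)
      simpa using this
    rw [← mFourierCoeff_partialDeriv hsB.ofReal, ← mFourierCoeff_add i1 i2]
    congr 1
    ext x
    rw [partialDeriv_ofReal hsB, partialDeriv_comp_real (hsm R) hB]
    push_cast
    ring
  have t5 := t3.add t2
  simp_rw [e1, zero_add] at t5
  have e2 := tendsto_nhds_unique t5 (t1.const_mul (2 * Real.pi * Complex.I * k i))
  rw [mFourierCoeff_congr_ae (v := fun x => ((deriv B (g x) * w x : ℝ) : ℂ)) (by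
      filter_upwards [hcg] with x hx
      rw [hx]) k,
    mFourierCoeff_congr_ae (u := fun x => (B (c x) : ℂ)) (v := fun x => (B (g x) : ℂ)) (by
      filter_upwards [hcg] with x hx
      rw [hx]) k]
  exact e2

/-- For continuous g the exceptional set is open and null, and the measure charges every nonempty
open set. -/
lemma abs_le_of_eLpNorm_top_le {g : Torus d → ℝ} (hg : Continuous g) {M : ℝ≥0}
    (h : eLpNorm g ∞ (torusMeasure d) ≤ M) (x : Torus d) : |g x| ≤ M := by
  have h1 : ∀ᵐ x ∂(torusMeasure d), ‖g x‖ₑ ≤ M := by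
    filter_upwards [enorm_ae_le_eLpNormEssSup g (torusMeasure d)] with x hx
    rw [← eLpNorm_exponent_top] at hx
    exact hx.trans h
  have hopen : IsOpen {x | ¬ ‖g x‖ₑ ≤ M} := by
    simp only [not_le]
    exact isOpen_lt continuous_const hg.enorm
  have h2 := hopen.eq_empty_of_measure_zero (ae_iff.1 h1)
  have h3 : ‖g x‖ₑ ≤ M := by
    by_contra h
    exact (Set.eq_empty_iff_forall_notMem.1 h2) x h
  rw [enorm_le_coe] at h3
  exact_mod_cast h3

/-- The function `x ↦ B (c x)` is bounded in `H²`. -/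
lemma hn_two_comp_le (d : ℕ) {B : ℝ → ℝ} (hB : ContDiff ℝ ∞ B) (hB0 : B 0 = 0) (M : ℝ≥0) :
    ∃ C : ℝ≥0, ∀ c : Torus d → ℝ, MemLp c 2 (torusMeasure d) →
      ∑' k, ‖mFourierCoeff (fun x => (c x : ℂ)) k‖ₑ < ⊤ →
      eLpNorm c ∞ (torusMeasure d) ≤ M →
      hn 2 (fun x => (B (c x) : ℂ)) ≤ C * hn 2 (fun x => (c x : ℂ)) := by
  -- The truncations converge uniformly, so they are eventually bounded by M + 1; the constants are
  -- taken on that larger interval.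
  obtain ⟨β₀, hβ₀⟩ := exists_bound_mul_abs hB hB0 (M + 1)
  obtain ⟨β₁, hβ₁⟩ := exists_bound_deriv (contDiff_deriv hB) (M + 1)
  obtain ⟨β₂, hβ₂⟩ := exists_bound_deriv (contDiff_deriv (contDiff_deriv hB)) (M + 1)
  set P : ℝ≥0 := Real.toNNReal (2 * Real.pi)
  refine ⟨β₀ + d * ((β₁ + β₂ * (3 * (M + 1))) * (P * P)), fun c hc hs hM => ?_⟩
  obtain ⟨g, hcg, hgc, hunif⟩ := exists_tendstoUniformly_truncate hc hs
  rw [eLpNorm_congr_ae hcg] at hM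
  have hev := eventually_abs_truncate_le (abs_le_of_eLpNorm_top_le hgc hM) hunif
  have hsm := fun R => isSmooth_truncate R c
  set N := hn 2 (fun x => (c x : ℂ))
  refine hn_le_of_tendsto (u := fun R x => (B (truncate R c x) : ℂ)) (fun k => ?_) ?_
  · have hev1 : ∀ᶠ R in Filter.atTop, ∀ x, |B (truncate R c x)| ≤ β₀ * (M + 1) := by
      filter_upwards [hev] with R hR x
      exact (hβ₀ _ (hR x)).trans (by gcongr; exact hR x)
    have t1 := tendsto_mFourierCoeff_comp_mul hB.continuous (fun R => (hsm R).continuous) hev1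
      (fun x => hunif.tendsto_at x) (integrable_const 1) k
    simp only [mul_one] at t1
    rw [mFourierCoeff_congr_ae (u := fun x => (B (c x) : ℂ)) (v := fun x => (B (g x) : ℂ)) (by
      filter_upwards [hcg] with x hx
      rw [hx]) k]
    exact t1
  · filter_upwards [hev] with R hR
    set f := truncate R c with hf
    have hfs : IsSmooth f := hsm R
    have hgs : IsSmooth (fun x => B (f x)) := hfs.comp_real hB
    have hg' := hgs.isSmooth_partialDeriv
    have hg'' := fun i => (hg' i).isSmooth_partialDeriv i
    have h0 : eLpNorm (fun x => (B (f x) : ℂ)) 2 (torusMeasure d) ≤ β₀ * N := by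
      have h1 : eLpNorm f 2 (torusMeasure d) ≤ N := by
        refine (eLpNorm_re_le _ 2).trans ((eLpNorm_trigPoly_le _ _).trans (l2_mono fun k => ?_))
        exact le_mul_of_one_le_left zero_le (one_le_wt zero_le_two k)
      rw [eLpNorm_ofReal]
      have := eLpNorm_le_nnreal_smul_eLpNorm_of_ae_le_mul (μ := torusMeasure d)
        (f := fun x => B (f x)) (g := f) (c := β₀)
        (Filter.Eventually.of_forall fun x => by
          have := hβ₀ (f x) (hR x)
          exact_mod_cast this) 2
      refine this.trans ?_
      rw [ENNReal.smul_def, smul_eq_mul]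
      gcongr
    have h2 : ∀ i, eLpNorm (fun x => ((partialDeriv i (partialDeriv i (fun x => B (f x))) x : ℝ)
        : ℂ)) 2 (torusMeasure d) ≤ (β₁ + β₂ * (3 * (M + 1))) * (P * P) * N := by
      intro i
      have hf' := hfs.isSmooth_partialDeriv i
      have hf'' := hf'.isSmooth_partialDeriv i
      -- The quadratic term B″(f)(∂f)² is the dangerous one; Gagliardo–Nirenberg bounds it by
      -- M‖∂²f‖_{L²}, so the estimate stays linear in the H² norm.
      have e : ∀ x, partialDeriv i (partialDeriv i (fun x => B (f x))) x
          = deriv B (f x) * partialDeriv i (partialDeriv i f) x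
            + deriv (deriv B) (f x) * partialDeriv i f x ^ 2 := by
        intro x
        rw [funext (partialDeriv_comp_real hfs hB i),
          partialDeriv_mul_real (hfs.comp_real (contDiff_deriv hB)) hf',
          partialDeriv_comp_real hfs (contDiff_deriv hB)]
        ring
      have hD : eLpNorm (partialDeriv i (partialDeriv i f)) 2 (torusMeasure d) ≤ P * P * N := by
        rw [hf, funext (partialDeriv_partialDeriv_truncate i R c)]
        refine (eLpNorm_re_le _ 2).trans ((eLpNorm_trigPoly_le _ _).trans ?_)
        change _ ≤ (P : ℝ≥0∞) * P *
          l2 (fun k => wt 2 k * ‖mFourierCoeff (fun x => (c x : ℂ)) k‖ₑ)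
        rw [← l2_const_mul]
        refine l2_mono fun k => ?_
        rw [enorm_two_pi_I_mul, enorm_two_pi_I_mul]
        calc _ = ENNReal.ofReal (2 * Real.pi) * ENNReal.ofReal (2 * Real.pi) *
              (ENNReal.ofReal |(k i : ℝ)| * ENNReal.ofReal |(k i : ℝ)|
                * ‖mFourierCoeff (fun x => (c x : ℂ)) k‖ₑ) := by ring
          _ ≤ ENNReal.ofReal (2 * Real.pi) * ENNReal.ofReal (2 * Real.pi) *
              (wt 1 k * wt 1 k * ‖mFourierCoeff (fun x => (c x : ℂ)) k‖ₑ) := by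
              gcongr <;> exact ofReal_abs_le_wt k i
          _ = _ := by
              rw [← wt_add, one_add_one_eq_two]
              rfl
      have hS := eLpNorm_partialDeriv_sq_le hfs i (M := M + 1) (by exact_mod_cast hR)
      rw [eLpNorm_ofReal, funext e]
      refine (eLpNorm_add_le (f := fun x => deriv B (f x) * partialDeriv i (partialDeriv i f) x)
        (g := fun x => deriv (deriv B) (f x) * partialDeriv i f x ^ 2)
        (((contDiff_deriv hB).continuous.comp hfs.continuous).mul
          hf''.continuous).aestronglyMeasurable
        (((contDiff_deriv (contDiff_deriv hB)).continuous.comp hfs.continuous).mul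
          (hf'.continuous.pow 2)).aestronglyMeasurable one_le_two).trans ?_
      have a1 := eLpNorm_le_nnreal_smul_eLpNorm_of_ae_le_mul (μ := torusMeasure d)
        (f := fun x => deriv B (f x) * partialDeriv i (partialDeriv i f) x)
        (g := partialDeriv i (partialDeriv i f)) (c := β₁)
        (Filter.Eventually.of_forall fun x => by
          rw [nnnorm_mul]
          gcongr
          have := hβ₁ (f x) (hR x)
          exact_mod_cast this) 2
      have a2 := eLpNorm_le_nnreal_smul_eLpNorm_of_ae_le_mul (μ := torusMeasure d)
        (f := fun x => deriv (deriv B) (f x) * partialDeriv i f x ^ 2)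
        (g := fun x => partialDeriv i f x ^ 2) (c := β₂)
        (Filter.Eventually.of_forall fun x => by
          rw [nnnorm_mul]
          gcongr
          have := hβ₂ (f x) (hR x)
          exact_mod_cast this) 2
      rw [ENNReal.smul_def, smul_eq_mul] at a1 a2
      calc _ ≤ β₁ * (P * P * N) + β₂ * ((3 * (M + 1)) * (P * P * N)) := by
            refine add_le_add (a1.trans ?_) (a2.trans ?_)
            · gcongr
            · gcongr
              refine hS.trans ?_
              push_cast
              gcongr
        _ = _ := by ring
    have hco : ∀ i k, mFourierCoeff (fun x => ((partialDeriv i (partialDeriv i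
        (fun x => B (f x))) x : ℝ) : ℂ)) k = 2 * Real.pi * Complex.I * k i *
        (2 * Real.pi * Complex.I * k i * mFourierCoeff (fun x => (B (f x) : ℂ)) k) := by
      intro i k
      rw [← mFourierCoeff_partialDeriv hgs.ofReal, funext (partialDeriv_ofReal hgs i),
        ← mFourierCoeff_partialDeriv (hg' i).ofReal, funext (partialDeriv_ofReal (hg' i) i)]
    refine (hn_two_le (memLp_ofReal_of_continuous hgs.continuous 2)
      (fun i => memLp_ofReal_of_continuous (hg'' i).continuous 2) hco).trans ?_
    calc _ ≤ β₀ * N + ∑ _i : Fin d, (β₁ + β₂ * (3 * (M + 1))) * (P * P) * N :=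
          add_le_add h0 (Finset.sum_le_sum fun i _ => h2 i)
      _ = _ := by
          rw [Finset.sum_const, Finset.card_univ, Fintype.card_fin, nsmul_eq_mul]
          push_cast
          ring

/-! ### Composition in Sobolev spaces of higher order -/

/-- With J = (1 − Δ)^{s/2}, split J(bu) = b Ju + [J, b]u. Here u itself may be unbounded, unlike in
`hn_mul_le`. -/
lemma hn_mul_le_commutator {s θ ρ : ℝ} (hθ : 0 ≤ θ) (hθ1 : θ ≤ 1) (hθs : θ ≤ s) (hρ : 0 ≤ ρ)
    {b u : Torus d → ℂ} (hb : MemLp b ∞ (torusMeasure d)) (hu : MemLp u 2 (torusMeasure d))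
    (hsu : hn s u < ⊤) :
    hn s (fun x => b x * u x) ≤ eLpNorm b ∞ (torusMeasure d) * hn s u
      + ENNReal.ofReal ((1 + s) * 2 ^ s) *
        ((∑' k, wt θ k * ‖mFourierCoeff b k‖ₑ) * hn (s - θ) u
          + hn (s + ρ) b * ∑' k, wt (-ρ) k * ‖mFourierCoeff u k‖ₑ) := by
  obtain ⟨f, hf, hfu, hfn⟩ := exists_bessel s hsu
  refine le_trans ?_ (add_le_add le_rfl (l2_commutator_le hθ hθ1 hθs hρ
    (hb.mono_exponent le_top) hu hf hfu))
  rw [← hfn]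
  refine le_trans ?_ (add_le_add (eLpNorm_bdd_mul_le hf.1) le_rfl)
  rw [← l2_mFourierCoeff (MemLp.bdd_mul_two hb hf)]
  refine (l2_mono fun k => ?_).trans (l2_add_le _ _)
  rw [← enorm_bracket_rpow_mul]
  refine le_trans (le_of_eq ?_) (enorm_add_le _ _)
  rw [add_sub_cancel]

/-- Square summability needs 2(2 − θ) > d. In dimension three this is exactly θ < 1/2, the
restriction behind the exponent [2s]. -/
lemma l2_wt_lt_top (hd : d ≤ 3) {θ : ℝ} (hθ : θ < 1 / 2) : l2 (wt (d := d) (θ - 2)) < ⊤ := by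
  have hd' : (d : ℝ) ≤ 3 := by exact_mod_cast hd
  rw [← neg_sub]
  exact l2_wt_neg_lt_top (by linarith)

lemma MemSobolev.hn_lt_top {s : ℝ} {f : Torus d → ℝ} (hf : MemSobolev s f) :
    hn s (fun x => (f x : ℂ)) < ⊤ := by
  rw [← sobolevNorm_eq_hn]
  exact hf.2

lemma MemSobolev.mono {s t : ℝ} (h : s ≤ t) {f : Torus d → ℝ} (hf : MemSobolev t f) :
    MemSobolev s f :=
  ⟨hf.1, by
    rw [sobolevNorm_eq_hn]
    exact (hn_mono h _).trans_lt hf.hn_lt_top⟩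

lemma tsum_wt_mul_le_hn_two (θ : ℝ) (u : Torus d → ℂ) :
    ∑' k, wt θ k * ‖mFourierCoeff u k‖ₑ ≤ l2 (wt (d := d) (θ - 2)) * hn 2 u :=
  tsum_wt_mul_mFourierCoeff_le θ 2 u

/-- In dimension at most three H² embeds in the Wiener algebra; the uniform approximation of c by
truncated Fourier series rests on this. -/
lemma MemSobolev.tsum_lt_top (hd : d ≤ 3) {c : Torus d → ℝ} (hc : MemSobolev 2 c) :
    ∑' k, ‖mFourierCoeff (fun x => (c x : ℂ)) k‖ₑ < ⊤ := by
  have h := tsum_wt_mul_le_hn_two 0 (fun x => (c x : ℂ))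
  simp_rw [wt_zero, one_mul] at h
  exact h.trans_lt (ENNReal.mul_lt_top (l2_wt_lt_top hd (by norm_num)) hc.hn_lt_top)

lemma MemSobolev.exists_weakPartial {s : ℝ} (hs : 0 ≤ s) {c : Torus d → ℝ}
    (hc : MemSobolev (s + 1) c) (i : Fin d) : MemSobolev s (weakPartial i c) ∧
      ∀ k, mFourierCoeff (fun x => (weakPartial i c x : ℂ)) k
        = 2 * Real.pi * Complex.I * k i * mFourierCoeff (fun x => (c x : ℂ)) k :=
  ⟨(hasWeakPartial_weakPartial hs hc i).2, fun k =>
    (hasWeakPartial_weakPartial hs hc i).1.mFourierCoeff (hc.1.integrable (by norm_num)) k⟩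

lemma ae_abs_le {c : Torus d → ℝ} {M : ℝ≥0} (h : eLpNorm c ∞ (torusMeasure d) ≤ M) :
    ∀ᵐ x ∂(torusMeasure d), |c x| ≤ M := by
  filter_upwards [enorm_ae_le_eLpNormEssSup c (torusMeasure d)] with x hx
  rw [← eLpNorm_exponent_top] at hx
  have h3 : ‖c x‖ₑ ≤ M := hx.trans h
  rw [enorm_le_coe] at h3
  exact_mod_cast h3

lemma eLpNorm_comp_le {c : Torus d → ℝ} {M β : ℝ≥0} (h : eLpNorm c ∞ (torusMeasure d) ≤ M)
    {B : ℝ → ℝ} (hβ : ∀ r : ℝ, |r| ≤ M → |B r| ≤ β) :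
    eLpNorm (fun x => (B (c x) : ℂ)) ∞ (torusMeasure d) ≤ β := by
  rw [eLpNorm_ofReal, eLpNorm_exponent_top]
  refine eLpNormEssSup_le_of_ae_enorm_bound ?_
  filter_upwards [ae_abs_le h] with x hx
  rw [enorm_le_coe]
  exact_mod_cast hβ _ hx

lemma memLp_comp {c : Torus d → ℝ} (hc : AEStronglyMeasurable c (torusMeasure d)) {M : ℝ≥0}
    (h : eLpNorm c ∞ (torusMeasure d) ≤ M) {B : ℝ → ℝ} (hB : ContDiff ℝ ∞ B) (p : ℝ≥0∞) :
    MemLp (fun x => (B (c x) : ℂ)) p (torusMeasure d) := by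
  obtain ⟨β, hβ⟩ := exists_bound_deriv hB M
  have : MemLp (fun x => (B (c x) : ℂ)) ∞ (torusMeasure d) :=
    ⟨Complex.continuous_ofReal.comp_aestronglyMeasurable
      (hB.continuous.comp_aestronglyMeasurable hc),
      (eLpNorm_comp_le h hβ).trans_lt ENNReal.coe_lt_top⟩
  exact this.mono_exponent le_top

/-- Composition with a smooth function in `H^{2 + jθ}`. -/
lemma hn_comp_le (hd : d ≤ 3) {θ : ℝ} (hθ : 0 ≤ θ) (hθ1 : θ < 1 / 2) (j : ℕ) :
    ∀ B : ℝ → ℝ, ContDiff ℝ ∞ B → B 0 = 0 → ∀ M : ℝ≥0, ∃ C : ℝ≥0, ∀ c : Torus d → ℝ,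
      MemSobolev 2 c → eLpNorm c ∞ (torusMeasure d) ≤ M →
      hn (2 + j * θ) (fun x => (B (c x) : ℂ))
        ≤ C * (1 + hn 2 (fun x => (c x : ℂ))) ^ j * hn (2 + j * θ) (fun x => (c x : ℂ)) := by
  induction j with
  | zero =>
    intro B hB hB0 M
    obtain ⟨C, hC⟩ := hn_two_comp_le d hB hB0 M
    refine ⟨C, fun c hc hM => ?_⟩
    simpa using hC c hc.1 (hc.tsum_lt_top hd) hM
  | succ j ih =>
    intro B hB hB0 M
    -- Subtracting B′(0) gives a function vanishing at 0, to which the induction hypothesis applies;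
    -- the constant part only contributes B′(0)∂c.
    set G : ℝ → ℝ := fun r => deriv B r - deriv B 0 with hG
    have hGs : ContDiff ℝ ∞ G := (contDiff_deriv hB).sub contDiff_const
    have hG0 : G 0 = 0 := sub_self _
    obtain ⟨C₁, hC₁⟩ := ih B hB hB0 M
    obtain ⟨C₂, hC₂⟩ := ih G hGs hG0 M
    obtain ⟨C₃, hC₃⟩ := hn_two_comp_le d hGs hG0 M
    obtain ⟨β, hβ⟩ := exists_bound_deriv hGs M
    set S : ℝ≥0 := (l2 (wt (d := d) (θ - 2))).toNNReal
    have hS : l2 (wt (d := d) (θ - 2)) = S :=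
      (ENNReal.coe_toNNReal (l2_wt_lt_top hd hθ1).ne).symm
    set P : ℝ≥0 := Real.toNNReal (2 * Real.pi)
    have hP : ENNReal.ofReal (2 * Real.pi) = P := rfl
    set σ : ℝ := 2 + (j + 1 : ℕ) * θ with hσ
    have hjθ : 0 ≤ (j : ℝ) * θ := by positivity
    have hσ' : σ = 2 + j * θ + θ := by rw [hσ]; push_cast; ring
    set A : ℝ≥0 := Real.toNNReal ((1 + (σ - 1)) * 2 ^ (σ - 1))
    have hA : ENNReal.ofReal ((1 + (σ - 1)) * 2 ^ (σ - 1)) = A := rfl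
    refine ⟨1 + C₁ + d * (‖deriv B 0‖₊ * P + (β * P + A * (S * C₃ * P + C₂ * (P * S)))),
      fun c hc hM => ?_⟩
    set N := hn 2 (fun x => (c x : ℂ)) with hN
    set T := hn σ (fun x => (c x : ℂ)) with hT
    have h1N : 1 ≤ 1 + N := le_self_add
    -- If c is not in H^σ the right side is infinite: the summand 1 in the constant prevents a
    -- product 0 · ∞.
    by_cases hTtop : T = ⊤
    · rw [hTtop, ENNReal.mul_top]
      · exact le_top
      · refine mul_ne_zero ?_ (pow_ne_zero _ (zero_lt_one.trans_le h1N).ne')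
        push_cast
        rw [add_assoc]
        exact (zero_lt_one.trans_le le_self_add).ne'
    have hcσ : MemSobolev (σ - 1 + 1) c := by
      rw [sub_add_cancel]
      exact ⟨hc.1, by rw [sobolevNorm_eq_hn]; exact lt_top_iff_ne_top.2 hTtop⟩
    have hw := fun i => hcσ.exists_weakPartial (by linarith) i
    have hTj : hn (2 + j * θ) (fun x => (c x : ℂ)) ≤ T := hn_mono (by linarith) _
    have hDc := fun i => mFourierCoeff_chain hc.1 (hc.tsum_lt_top hd) (hw i).1.1 (hw i).2 hB
    have hGm := memLp_comp hc.1.1 hM hGs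
    have e := hn_add_one_le (σ - 1) (u := fun x => (B (c x) : ℂ))
      (u' := fun i x => ((deriv B (c x) * weakPartial i c x : ℝ) : ℂ)) hDc
    rw [sub_add_cancel] at e
    have b0 : hn (σ - 1) (fun x => (B (c x) : ℂ)) ≤ C₁ * ((1 + N) ^ (j + 1) * T) := by
      calc _ ≤ hn (2 + j * θ) (fun x => (B (c x) : ℂ)) := hn_mono (by linarith) _
        _ ≤ C₁ * (1 + N) ^ j * T := (hC₁ c hc hM).trans (by gcongr)
        _ ≤ C₁ * (1 + N) ^ (j + 1) * T := by
          gcongr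
          simp
        _ = _ := by ring
    have hwσ : ∀ i, hn (σ - 1) (fun x => (weakPartial i c x : ℂ)) ≤ P * T := by
      intro i
      have := hn_deriv_le (σ - 1) i (hw i).2
      rwa [sub_add_cancel] at this
    have bi : ∀ i, hn (σ - 1) (fun x => ((deriv B (c x) * weakPartial i c x : ℝ) : ℂ))
        ≤ (‖deriv B 0‖₊ * P + (β * P + A * (S * C₃ * P + C₂ * (P * S))) : ℝ≥0)
          * ((1 + N) ^ (j + 1) * T) := by
      intro i
      have hwm : MemLp (fun x => (weakPartial i c x : ℂ)) 2 (torusMeasure d) := (hw i).1.1.ofReal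
      have e1 : (fun x => ((deriv B (c x) * weakPartial i c x : ℝ) : ℂ))
          = fun x => ((deriv B 0 : ℝ) : ℂ) * (weakPartial i c x : ℂ)
            + (G (c x) : ℂ) * (weakPartial i c x : ℂ) := by
        ext x
        rw [hG]
        push_cast
        ring
      rw [e1]
      -- With ρ = 1 − θ, G(c) is needed only in H^{σ−θ} = H^{2+jθ}, the previous stage of the
      -- induction. The weight −ρ on ∂c amounts to weight θ on c, summable by the H² norm; this
      -- costs one factor N.
      have c1 := hn_mul_le_commutator (s := σ - 1) (θ := θ) (ρ := 1 - θ) hθ (by linarith)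
        (by linarith) (by linarith) (hGm ∞) hwm (hw i).1.hn_lt_top
      have c2 : ∑' k, wt θ k * ‖mFourierCoeff (fun x => (G (c x) : ℂ)) k‖ₑ ≤ S * (C₃ * N) := by
        refine (tsum_wt_mul_le_hn_two θ _).trans ?_
        rw [hS]
        gcongr
        exact hC₃ c hc.1 (hc.tsum_lt_top hd) hM
      have c3 : hn (σ - 1 - θ) (fun x => (weakPartial i c x : ℂ)) ≤ P * T :=
        (hn_mono (by linarith) _).trans (hwσ i)
      have c4 : hn (σ - 1 + (1 - θ)) (fun x => (G (c x) : ℂ)) ≤ C₂ * (1 + N) ^ j * T := by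
        rw [show σ - 1 + (1 - θ) = 2 + j * θ by rw [hσ']; ring]
        exact (hC₂ c hc hM).trans (by gcongr)
      have c5 : ∑' k, wt (-(1 - θ)) k * ‖mFourierCoeff (fun x => (weakPartial i c x : ℂ)) k‖ₑ
          ≤ P * (S * N) := by
        calc _ ≤ ∑' k, P * (wt θ k * ‖mFourierCoeff (fun x => (c x : ℂ)) k‖ₑ) := by
              refine ENNReal.tsum_le_tsum fun k => ?_
              rw [(hw i).2]
              have := wt_mul_enorm_deriv_le (-(1 - θ)) i k (mFourierCoeff (fun x => (c x : ℂ)) k)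
              rwa [show -(1 - θ) + 1 = θ by ring] at this
          _ ≤ _ := by
              rw [ENNReal.tsum_mul_left, ← hS]
              gcongr
              exact tsum_wt_mul_le_hn_two θ _
      have hNle : N ≤ 1 + N := le_add_self
      refine (hn_add_le _ (hwm.const_mul _ |>.integrable (by norm_num))
        ((MemLp.bdd_mul_two (hGm ∞) hwm).integrable (by norm_num))).trans ?_
      rw [hn_const_mul, enorm_ofReal_complex]
      have hpow : 1 ≤ (1 + N) ^ (j + 1) := one_le_pow₀ h1N
      have hpow' : (1 + N) ≤ (1 + N) ^ (j + 1) := le_self_pow₀ h1N (by omega)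
      calc _ ≤ ‖deriv B 0‖ₑ * (P * T) + (β * (P * T) + A * ((S * (C₃ * N)) * (P * T)
            + (C₂ * (1 + N) ^ j * T) * (P * (S * N)))) := by
            refine add_le_add (by gcongr; exact hwσ i) (c1.trans ?_)
            rw [hA]
            gcongr
            · exact eLpNorm_comp_le hM hβ
            · exact hwσ i
        _ ≤ ‖deriv B 0‖ₑ * (P * (((1 + N) ^ (j + 1)) * T)) + (β * (P * (((1 + N) ^ (j + 1)) * T))
            + A * ((S * (C₃ * (1 + N) ^ (j + 1))) * (P * T)
            + (C₂ * (1 + N) ^ j * T) * (P * (S * (1 + N))))) := by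
            have hT' : T ≤ (1 + N) ^ (j + 1) * T := le_mul_of_one_le_left zero_le hpow
            gcongr
            exact hNle.trans hpow'
        _ = _ := by
            have hnn : ((‖deriv B 0‖₊ : ℝ≥0) : ℝ≥0∞) = ‖deriv B 0‖ₑ := rfl
            push_cast
            rw [hnn]
            ring
    calc _ ≤ C₁ * ((1 + N) ^ (j + 1) * T) + ∑ _i : Fin d, (‖deriv B 0‖₊ * P + (β * P + A *
          (S * C₃ * P + C₂ * (P * S))) : ℝ≥0) * ((1 + N) ^ (j + 1) * T) :=
          e.trans (add_le_add b0 (Finset.sum_le_sum fun i _ => bi i))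
      _ ≤ (1 + C₁ + d * (‖deriv B 0‖₊ * P + (β * P + A * (S * C₃ * P + C₂ * (P * S)))) : ℝ≥0)
          * ((1 + N) ^ (j + 1) * T) := by
          rw [Finset.sum_const, Finset.card_univ, Fintype.card_fin, nsmul_eq_mul]
          refine (le_add_self (b := (1 + N) ^ (j + 1) * T)).trans_eq ?_
          push_cast
          ring
      _ = _ := by ring

/-! ### The capillary force `μ(c) ∇c` -/

lemma contDiff_doubleWell : ContDiff ℝ ∞ doubleWell := by
  unfold doubleWell
  fun_prop

lemma deriv_doubleWell_zero : deriv doubleWell 0 = 0 := by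
  have : HasDerivAt doubleWell (2 * (0 ^ 2 - 1) ^ (2 - 1) * (2 * 0 ^ (2 - 1) * 1)) (0 : ℝ) :=
    (((hasDerivAt_id (0 : ℝ)).pow 2).sub_const 1).pow 2
  rw [this.deriv]
  norm_num

/-- The components of the force `μ(c) ∇c`. -/
def force (C : ℝ) (c : Torus d → ℝ) (i : Fin d) (x : Torus d) : ℝ :=
  weakPartial i c x * chemPotential C c x

lemma eLpNorm_weakPartial_le (c : Torus d → ℝ) (i : Fin d) (p : ℝ≥0∞) :
    eLpNorm (weakPartial i c) p (torusMeasure d) ≤ eLpNorm (weakGrad c) p (torusMeasure d) :=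
  eLpNorm_mono fun x => PiLp.norm_apply_le (weakGrad c x) i

lemma eLpNorm_deriv_le {u u' : Torus d → ℂ} (hu' : MemLp u' 2 (torusMeasure d)) (i : Fin d)
    (h : ∀ k, mFourierCoeff u' k = 2 * Real.pi * Complex.I * k i * mFourierCoeff u k) :
    eLpNorm u' 2 (torusMeasure d) ≤ ENNReal.ofReal (2 * Real.pi) * hn 1 u := by
  rw [← hn_zero_eq hu']
  simpa using hn_deriv_le 0 i h

/-- The `L²` bound for the chemical potential. -/
lemma exists_eLpNorm_chemPotential_le (d : ℕ) (C : ℝ) (M : ℝ≥0) :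
    ∃ A : ℝ≥0, ∀ c : Torus d → ℝ, MemSobolev 2 c → eLpNorm c ∞ (torusMeasure d) ≤ M →
      MemLp (chemPotential C c) 2 (torusMeasure d) ∧
      eLpNorm (chemPotential C c) 2 (torusMeasure d) ≤ A * hn 2 (fun x => (c x : ℂ)) := by
  obtain ⟨β, hβ⟩ := exists_bound_mul_abs (contDiff_deriv contDiff_doubleWell)
    deriv_doubleWell_zero M
  set P : ℝ≥0 := Real.toNNReal (2 * Real.pi)
  refine ⟨β + ‖C‖₊ * (d * (P * P)), fun c hc hM => ?_⟩
  set N := hn 2 (fun x => (c x : ℂ)) with hN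
  have hw := fun i => MemSobolev.exists_weakPartial zero_le_one
    (by rwa [one_add_one_eq_two] : MemSobolev (1 + 1) c) i
  have hww := fun i => MemSobolev.exists_weakPartial le_rfl
    (by simpa using (hw i).1 : MemSobolev (0 + 1) (weakPartial i c)) i
  have h1 : eLpNorm (fun x => deriv doubleWell (c x)) 2 (torusMeasure d) ≤ β * N := by
    have := eLpNorm_le_nnreal_smul_eLpNorm_of_ae_le_mul (μ := torusMeasure d)
        (f := fun x => deriv doubleWell (c x)) (g := c) (c := β) (by
          filter_upwards [ae_abs_le hM] with x hx
          have := hβ (c x) hx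
          exact_mod_cast this) 2
    refine this.trans ?_
    rw [ENNReal.smul_def, smul_eq_mul, ← eLpNorm_ofReal c]
    gcongr
    exact eLpNorm_le_hn zero_le_two hc.1.ofReal
  have h2 : ∀ i, eLpNorm (weakPartial i (weakPartial i c)) 2 (torusMeasure d) ≤ P * P * N := by
    intro i
    rw [← eLpNorm_ofReal]
    refine (eLpNorm_deriv_le (hww i).1.1.ofReal i (hww i).2).trans ?_
    rw [mul_assoc]
    refine mul_le_mul_right ?_ _
    have := hn_deriv_le 1 i (hw i).2
    rwa [one_add_one_eq_two] at this
  have m1 : MemLp (fun x => deriv doubleWell (c x)) 2 (torusMeasure d) := by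
    have := (memLp_comp hc.1.1 hM (contDiff_deriv contDiff_doubleWell) 2).re
    simpa using this
  have m2 : MemLp (weakLaplacian c) 2 (torusMeasure d) :=
    memLp_finsetSum _ fun i _ => (hww i).1.1
  have h3 : eLpNorm (weakLaplacian c) 2 (torusMeasure d) ≤ d * (P * P) * N := by
    have e : weakLaplacian c = ∑ i, weakPartial i (weakPartial i c) := by
      ext x
      simp [weakLaplacian]
    rw [e]
    refine (eLpNorm_sum_le (fun i _ => (hww i).1.1.1) one_le_two).trans ?_
    refine (Finset.sum_le_sum fun i _ => h2 i).trans_eq ?_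
    rw [Finset.sum_const, Finset.card_univ, Fintype.card_fin, nsmul_eq_mul]
    ring
  refine ⟨m1.sub (m2.const_mul C), (eLpNorm_sub_le m1.1 (m2.const_mul C).1 one_le_two).trans ?_⟩
  have h4 : eLpNorm (fun x => C * weakLaplacian c x) 2 (torusMeasure d)
      = ‖C‖ₑ * eLpNorm (weakLaplacian c) 2 (torusMeasure d) := eLpNorm_const_smul C _ _ _
  rw [h4]
  have hnn : ((‖C‖₊ : ℝ≥0) : ℝ≥0∞) = ‖C‖ₑ := rfl
  calc _ ≤ β * N + ‖C‖ₑ * (d * (P * P) * N) := by gcongr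
    _ = _ := by
        push_cast
        rw [hnn]
        ring

/-- `(Δc) ∇c` is the divergence of `∇c ⊗ ∇c - |∇c|² / 2`, on the Fourier side. -/
lemma mFourierCoeff_mul_laplacian {w : Fin d → Torus d → ℂ} {w' : Fin d → Fin d → Torus d → ℂ}
    {u : Torus d → ℂ} (hw : ∀ i, MemLp (w i) 2 (torusMeasure d))
    (hw' : ∀ i j, MemLp (w' i j) 2 (torusMeasure d))
    (h : ∀ i k, mFourierCoeff (w i) k = 2 * Real.pi * Complex.I * k i * mFourierCoeff u k)
    (h' : ∀ i j k, mFourierCoeff (w' i j) k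
      = 2 * Real.pi * Complex.I * k i * mFourierCoeff (w j) k) (i j : Fin d) (k : Fin d → ℤ) :
    mFourierCoeff (fun x => w i x * w' j j x) k
      = 2 * Real.pi * Complex.I * k j * mFourierCoeff (fun x => w j x * w i x) k
        - (1 / 2) * (2 * Real.pi * Complex.I * k i * mFourierCoeff (fun x => w j x * w j x) k) := by
  -- The symmetry ∂ⱼwᵢ = ∂ᵢwⱼ, visible on the Fourier side since w is a gradient, makes the cross
  -- term equal to ½ ∂ᵢ(wⱼ²).
  have h1 := mFourierCoeff_leibniz (hw j) (hw i) (hw' j j) (hw' i j) j (h' j j) (fun k => by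
    rw [h', h j, h i]
    ring) k
  have h2 := mFourierCoeff_leibniz (hw j) (hw j) (hw' i j) (hw' i j) i (h' i j) (h' i j) k
  rw [h1, h2]
  simp only [mul_comm]
  ring

lemma hn_le_of_coeff_eq {s : ℝ} {f u v : Torus d → ℂ} {i j : Fin d}
    (h : ∀ k, mFourierCoeff f k = 2 * Real.pi * Complex.I * k j * mFourierCoeff u k
        - (1 / 2) * (2 * Real.pi * Complex.I * k i * mFourierCoeff v k)) :
    hn s f ≤ ENNReal.ofReal (2 * Real.pi) * (hn (s + 1) u + hn (s + 1) v) := by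
  unfold hn
  rw [mul_add, ← l2_const_mul, ← l2_const_mul]
  refine (l2_mono fun k => ?_).trans (l2_add_le _ _)
  rw [h]
  refine le_trans (mul_le_mul_right enorm_sub_le _) ?_
  rw [mul_add]
  refine add_le_add (wt_mul_enorm_deriv_le s j k _) ?_
  rw [enorm_mul]
  have hhalf : ‖(1 / 2 : ℂ)‖ₑ ≤ 1 := by
    rw [← ofReal_norm]
    norm_num
  calc _ ≤ wt s k * (1 * ‖2 * Real.pi * Complex.I * k i * mFourierCoeff v k‖ₑ) := by gcongr
    _ ≤ _ := by
        rw [one_mul]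
        exact wt_mul_enorm_deriv_le s i k _

/-- Bounds for the force `μ(c) ∇c` in `L²` and in `H^s`. -/
lemma exists_force_le (d : ℕ) (hd : d ≤ 3) (C : ℝ) {s : ℝ} (hs : 0 ≤ s) (M : ℝ≥0) :
    ∃ A : ℝ≥0, ∀ c : Torus d → ℝ, MemSobolev (s + 2) c → eLpNorm c ∞ (torusMeasure d) ≤ M →
      eLpNorm (weakGrad c) ∞ (torusMeasure d) < ⊤ → ∀ i,
      MemLp (force C c i) 2 (torusMeasure d) ∧
      eLpNorm (force C c i) 2 (torusMeasure d)
        ≤ A * (eLpNorm (weakGrad c) ∞ (torusMeasure d) * hn 2 (fun x => (c x : ℂ))) ∧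
      hn s (fun x => (force C c i x : ℂ))
        ≤ A * ((1 + eLpNorm (weakGrad c) ∞ (torusMeasure d))
          * hn (s + 2) (fun x => (c x : ℂ))) := by
  obtain ⟨A₀, hA₀⟩ := exists_eLpNorm_chemPotential_le d C M
  obtain ⟨A₁, hA₁⟩ := hn_mul_le d (σ := s + 1) (by linarith)
  set P : ℝ≥0 := Real.toNNReal (2 * Real.pi)
  have hP : ENNReal.ofReal (2 * Real.pi) = P := rfl
  refine ⟨A₀ + (P * (A₁ * (2 * M ^ 2 * (A₁ * (2 * M))) + 2 * (A₁ * (2 * M)))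
    + ‖C‖₊ * (d * (P * (4 * (A₁ * P))))), fun c hc hM hK i => ?_⟩
  set K := eLpNorm (weakGrad c) ∞ (torusMeasure d)
  set N := hn 2 (fun x => (c x : ℂ)) with hN
  set T := hn (s + 2) (fun x => (c x : ℂ)) with hT
  have hc2 : MemSobolev 2 c := hc.mono (by linarith)
  have hw := fun i => MemSobolev.exists_weakPartial (s := s + 1) (by linarith)
    (by rwa [add_assoc, one_add_one_eq_two] : MemSobolev (s + 1 + 1) c) i
  have hww := fun i j => MemSobolev.exists_weakPartial hs (hw j).1 i
  have hwb : ∀ i, MemLp (fun x => (weakPartial i c x : ℂ)) ∞ (torusMeasure d) := fun i =>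
    ⟨(hw i).1.1.ofReal.1, by
      rw [eLpNorm_ofReal]
      exact (eLpNorm_weakPartial_le c i ∞).trans_lt hK⟩
  have hwK : ∀ i, eLpNorm (fun x => (weakPartial i c x : ℂ)) ∞ (torusMeasure d) ≤ K := fun i => by
    rw [eLpNorm_ofReal]
    exact eLpNorm_weakPartial_le c i ∞
  obtain ⟨m1, h1⟩ := hA₀ c hc2 hM
  have m1C : MemLp (fun x => (chemPotential C c x : ℂ)) 2 (torusMeasure d) := m1.ofReal
  have e0 : eLpNorm (force C c i) 2 (torusMeasure d)
      = eLpNorm (fun x => (weakPartial i c x : ℂ) * (chemPotential C c x : ℂ)) 2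
        (torusMeasure d) := by
    rw [← eLpNorm_ofReal]
    simp [force]
  have m2 : MemLp (force C c i) 2 (torusMeasure d) := by
    have h2 : MemLp (fun x => weakPartial i c x * chemPotential C c x) 2 (torusMeasure d) := by
      simpa [← Complex.ofReal_mul] using (MemLp.bdd_mul_two (hwb i) m1C).re
    exact h2
  refine ⟨m2, ?_, ?_⟩
  · rw [e0]
    refine (eLpNorm_bdd_mul_le m1C.1).trans ?_
    rw [eLpNorm_ofReal (chemPotential C c)]
    calc _ ≤ K * (A₀ * N) := mul_le_mul' (hwK i) h1
      _ = A₀ * (K * N) := by ring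
      _ ≤ _ := by
          gcongr
          exact le_self_add
  -- Removing the value at 0 leaves r⁴ − 2r² with the same derivative; its H^{s+1} norm is linear in
  -- that of c by repeated use of the product estimate.
  set B : ℝ → ℝ := fun r => doubleWell r - 1 with hB
  have hBs : ContDiff ℝ ∞ B := contDiff_doubleWell.sub contDiff_const
  have hdB : deriv B = deriv doubleWell := by
    ext r
    rw [hB, deriv_sub_const]
  have hcm : MemLp (fun x => (c x : ℂ)) ∞ (torusMeasure d) :=
    ⟨hc.1.ofReal.1, by rw [eLpNorm_ofReal]; exact hM.trans_lt ENNReal.coe_lt_top⟩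
  have hcM : eLpNorm (fun x => (c x : ℂ)) ∞ (torusMeasure d) ≤ M := by rwa [eLpNorm_ofReal]
  have hccm : MemLp (fun x => (c x : ℂ) * (c x : ℂ)) ∞ (torusMeasure d) :=
    MemLp.bdd_mul_two hcm hcm
  have hccM : eLpNorm (fun x => (c x : ℂ) * (c x : ℂ)) ∞ (torusMeasure d) ≤ M ^ 2 := by
    rw [sq]
    exact (eLpNorm_bdd_mul_le hcm.1).trans (mul_le_mul' hcM hcM)
  have hT1 : hn (s + 1) (fun x => (c x : ℂ)) ≤ T := hn_mono (by linarith) _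
  have hcc : hn (s + 1) (fun x => (c x : ℂ) * (c x : ℂ)) ≤ A₁ * (2 * M) * T := by
    refine (hA₁ _ _ hcm hcm).trans ?_
    calc _ ≤ A₁ * (M * T + M * T) := by gcongr
      _ = _ := by ring
  have hcccc : hn (s + 1) (fun x => ((c x : ℂ) * (c x : ℂ)) * ((c x : ℂ) * (c x : ℂ)))
      ≤ A₁ * (2 * M ^ 2 * (A₁ * (2 * M))) * T := by
    refine (hA₁ _ _ hccm hccm).trans ?_
    calc _ ≤ A₁ * (M ^ 2 * (A₁ * (2 * M) * T) + M ^ 2 * (A₁ * (2 * M) * T)) := by gcongr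
      _ = _ := by ring
  have hBn : hn (s + 1) (fun x => (B (c x) : ℂ))
      ≤ (A₁ * (2 * M ^ 2 * (A₁ * (2 * M))) + 2 * (A₁ * (2 * M))) * T := by
    have e : (fun x => (B (c x) : ℂ)) = fun x => ((c x : ℂ) * (c x : ℂ)) * ((c x : ℂ) * (c x : ℂ))
        - 2 * ((c x : ℂ) * (c x : ℂ)) := by
      ext x
      simp only [hB, doubleWell]
      push_cast
      ring
    rw [e]
    have i1 := (MemLp.bdd_mul_two hccm hccm).integrable (by norm_num)
    have i2 := (hccm.const_mul 2).integrable (by norm_num)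
    refine (hn_sub_le (s + 1) i1 i2).trans ?_
    rw [hn_const_mul]
    have h2 : ‖(2 : ℂ)‖ₑ = 2 := by
      rw [← ofReal_norm]
      norm_num
    rw [h2]
    refine (add_le_add hcccc (mul_le_mul_right hcc 2)).trans_eq ?_
    ring
  have hB1 : hn s (fun x => ((deriv B (c x) * weakPartial i c x : ℝ) : ℂ))
      ≤ P * ((A₁ * (2 * M ^ 2 * (A₁ * (2 * M))) + 2 * (A₁ * (2 * M))) * T) :=
    (hn_deriv_le s i (mFourierCoeff_chain hc.1 (hc2.tsum_lt_top hd) (hw i).1.1 (hw i).2 hBs)).trans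
      (mul_le_mul_right hBn _)
  -- The tame bound for two bounded first derivatives is where the linear factor ‖∇c‖_∞ arises.
  have hprod : ∀ i j, hn (s + 1) (fun x => (weakPartial i c x : ℂ) * (weakPartial j c x : ℂ))
      ≤ 2 * (A₁ * P) * (K * T) := by
    intro i j
    have hwT : ∀ i, hn (s + 1) (fun x => (weakPartial i c x : ℂ)) ≤ P * T := by
      intro i
      have := hn_deriv_le (s + 1) i (hw i).2
      rwa [add_assoc, one_add_one_eq_two] at this
    refine (hA₁ _ _ (hwb i) (hwb j)).trans ?_
    calc _ ≤ A₁ * (K * (P * T) + K * (P * T)) := by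
          gcongr
          · exact hwK j
          · exact hwT i
          · exact hwK i
          · exact hwT j
      _ = _ := by ring
  have hlap : ∀ j, hn s (fun x => (weakPartial i c x : ℂ)
      * (weakPartial j (weakPartial j c) x : ℂ)) ≤ P * (4 * (A₁ * P)) * (K * T) := by
    intro j
    have hco := mFourierCoeff_mul_laplacian (w := fun i x => (weakPartial i c x : ℂ))
      (w' := fun i j x => (weakPartial i (weakPartial j c) x : ℂ)) (u := fun x => (c x : ℂ))
      (fun i => (hw i).1.1.ofReal) (fun i j => (hww i j).1.1.ofReal) (fun i => (hw i).2)
      (fun i j => (hww i j).2) i j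
    refine (hn_le_of_coeff_eq hco).trans ?_
    calc _ ≤ P * (2 * (A₁ * P) * (K * T) + 2 * (A₁ * P) * (K * T)) := by
          rw [hP]
          gcongr
          · exact hprod j i
          · exact hprod j j
      _ = _ := by ring
  have hm1 : MemLp (fun x => ((deriv B (c x) * weakPartial i c x : ℝ) : ℂ)) 2
      (torusMeasure d) := by
    have := MemLp.bdd_mul_two (memLp_comp hc.1.1 hM (contDiff_deriv hBs) ∞) (hw i).1.1.ofReal
    simpa using this
  have hm2 : ∀ j, MemLp (fun x => (weakPartial i c x : ℂ)
      * (weakPartial j (weakPartial j c) x : ℂ)) 2 (torusMeasure d) := fun j =>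
    MemLp.bdd_mul_two (hwb i) (hww j j).1.1.ofReal
  have hms : MemLp (fun x => ∑ j, (weakPartial i c x : ℂ)
      * (weakPartial j (weakPartial j c) x : ℂ)) 2 (torusMeasure d) :=
    memLp_finsetSum _ fun j _ => hm2 j
  have eF : (fun x => (force C c i x : ℂ))
      = fun x => ((deriv B (c x) * weakPartial i c x : ℝ) : ℂ) - (C : ℂ) * ∑ j,
        (weakPartial i c x : ℂ) * (weakPartial j (weakPartial j c) x : ℂ) := by
    ext x
    rw [hdB, ← Finset.mul_sum]
    simp only [force, chemPotential, weakLaplacian]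
    push_cast
    ring
  have hsum : hn s (fun x => ∑ j, (weakPartial i c x : ℂ)
      * (weakPartial j (weakPartial j c) x : ℂ)) ≤ d * (P * (4 * (A₁ * P))) * (K * T) := by
    have h2 : hn s (fun x => ∑ j, (weakPartial i c x : ℂ)
      * (weakPartial j (weakPartial j c) x : ℂ)) ≤ ∑ j, hn s (fun x => (weakPartial i c x : ℂ)
      * (weakPartial j (weakPartial j c) x : ℂ)) := by
      refine (l2_mono fun k => ?_).trans (l2_sum_le Finset.univ _)
      rw [mFourierCoeff_sum _ fun j _ => (hm2 j).integrable (by norm_num), ← Finset.mul_sum]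
      gcongr
      exact enorm_sum_le _ _
    refine h2.trans ((Finset.sum_le_sum fun j _ => hlap j).trans_eq ?_)
    rw [Finset.sum_const, Finset.card_univ, Fintype.card_fin, nsmul_eq_mul]
    ring
  rw [eF]
  refine (hn_sub_le s (hm1.integrable (by norm_num))
    ((hms.const_mul (C : ℂ)).integrable (by norm_num))).trans ?_
  rw [hn_const_mul, enorm_ofReal_complex]
  have hnn : ((‖C‖₊ : ℝ≥0) : ℝ≥0∞) = ‖C‖ₑ := rfl
  have hKT : K * T ≤ (1 + K) * T := by
    gcongr
    exact le_add_self
  have hTK : T ≤ (1 + K) * T := le_mul_of_one_le_left zero_le le_self_add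
  calc _ ≤ P * ((A₁ * (2 * M ^ 2 * (A₁ * (2 * M))) + 2 * (A₁ * (2 * M))) * ((1 + K) * T))
        + ‖C‖ₑ * (d * (P * (4 * (A₁ * P))) * ((1 + K) * T)) := by
        refine add_le_add (hB1.trans (by gcongr)) ?_
        gcongr
        exact hsum.trans (by gcongr)
    _ ≤ A₀ * ((1 + K) * T) + (P * ((A₁ * (2 * M ^ 2 * (A₁ * (2 * M))) + 2 * (A₁ * (2 * M)))
        * ((1 + K) * T)) + ‖C‖ₑ * (d * (P * (4 * (A₁ * P))) * ((1 + K) * T))) := le_add_self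
    _ = _ := by
        push_cast
        rw [hnn]
        ring

/-! ### The energy estimate -/

lemma integrable_conj_mul {u v : Torus d → ℂ} (hu : MemLp u 2 (torusMeasure d))
    (hv : MemLp v 2 (torusMeasure d)) :
    Integrable (fun x => conj (u x) * v x) (torusMeasure d) :=
  hu.star.integrable_mul hv

lemma enorm_integral_conj_mul_le {u v : Torus d → ℂ} (hu : MemLp u 2 (torusMeasure d))
    (hv : MemLp v 2 (torusMeasure d)) : ‖∫ x, conj (u x) * v x ∂(torusMeasure d)‖ₑ
      ≤ eLpNorm u 2 (torusMeasure d) * eLpNorm v 2 (torusMeasure d) := by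
  rw [← (hasSum_conj_mFourierCoeff_mul hu hv).tsum_eq, ← l2_mFourierCoeff hu,
    ← l2_mFourierCoeff hv]
  refine enorm_tsum_le_tsum_enorm.trans (le_trans (le_of_eq ?_) (tsum_mul_le_l2 _ _))
  congr 1
  ext k
  rw [enorm_mul, RCLike.enorm_conj]

lemma eLpNorm_two_sq {u : Torus d → ℂ} (hu : MemLp u 2 (torusMeasure d)) :
    eLpNorm u 2 (torusMeasure d) ^ 2 = ENNReal.ofReal (∫ x, ‖u x‖ ^ 2 ∂(torusMeasure d)) := by
  have h := hasSum_sq_norm_mFourierCoeff hu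
  rw [← l2_mFourierCoeff hu, l2_sq, ← h.tsum_eq,
    ENNReal.ofReal_tsum_of_nonneg (fun k => by positivity) h.summable]
  congr 1
  ext k
  rw [ENNReal.ofReal_pow (norm_nonneg _), ofReal_norm]

/-- Summing the orthogonality relations over k gives, by Parseval, Σᵢ ∫ conj(fᵢ + rᵢ)(a fᵢ + gᵢ) =
0. The terms ∫ a|fᵢ|² control the left side from below; all others go to the right. In use, f + r is
a Bessel potential of ∇p (or ∇p itself) and g is a commutator (or zero). -/
lemma energy_inequality {a : Torus d → ℝ} (ha : AEStronglyMeasurable a (torusMeasure d))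
    {lo hi : ℝ} (hlo : 0 < lo) (hb : ∀ x, lo ≤ a x ∧ a x ≤ hi) {f r g : Fin d → Torus d → ℂ}
    (hf : ∀ i, MemLp (f i) 2 (torusMeasure d)) (hr : ∀ i, MemLp (r i) 2 (torusMeasure d))
    (hg : ∀ i, MemLp (g i) 2 (torusMeasure d))
    (h : ∀ k, ∑ i, conj (mFourierCoeff (f i) k + mFourierCoeff (r i) k) *
      (mFourierCoeff (fun x => (a x : ℂ) * f i x) k + mFourierCoeff (g i) k) = 0) :
    ENNReal.ofReal lo * ∑ i, eLpNorm (f i) 2 (torusMeasure d) ^ 2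
      ≤ ∑ i, ((eLpNorm (f i) 2 (torusMeasure d) + eLpNorm (r i) 2 (torusMeasure d))
          * eLpNorm (g i) 2 (torusMeasure d)
        + ENNReal.ofReal hi * (eLpNorm (r i) 2 (torusMeasure d)
          * eLpNorm (f i) 2 (torusMeasure d))) := by
  have haC : MemLp (fun x => (a x : ℂ)) ∞ (torusMeasure d) := by
    refine memLp_top_of_bound (Complex.continuous_ofReal.comp_aestronglyMeasurable ha) hi
      (Filter.Eventually.of_forall fun x => ?_)
    rw [Complex.norm_real, Real.norm_of_nonneg (hlo.le.trans (hb x).1)]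
    exact (hb x).2
  have haN : eLpNorm (fun x => (a x : ℂ)) ∞ (torusMeasure d) ≤ ENNReal.ofReal hi := by
    rw [eLpNorm_ofReal, eLpNorm_exponent_top]
    refine eLpNormEssSup_le_of_ae_enorm_bound (Filter.Eventually.of_forall fun x => ?_)
    rw [Real.enorm_eq_ofReal (hlo.le.trans (hb x).1)]
    exact ENNReal.ofReal_le_ofReal (hb x).2
  have haf : ∀ i, MemLp (fun x => (a x : ℂ) * f i x) 2 (torusMeasure d) := fun i =>
    MemLp.bdd_mul_two haC (hf i)
  have hq : ∀ i, MemLp (fun x => f i x + r i x) 2 (torusMeasure d) := fun i => (hf i).add (hr i)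
  have ht : ∀ i, MemLp (fun x => (a x : ℂ) * f i x + g i x) 2 (torusMeasure d) :=
    fun i => (haf i).add (hg i)
  have h0 : ∑ i, ∫ x, conj (f i x + r i x) * ((a x : ℂ) * f i x + g i x) ∂(torusMeasure d)
      = 0 := by
    have hs := hasSum_sum (s := Finset.univ)
      (fun i _ => hasSum_conj_mFourierCoeff_mul (hq i) (ht i))
    refine hs.unique ?_
    convert! hasSum_zero with k
    rw [← h k]
    refine Finset.sum_congr rfl fun i _ => ?_
    rw [mFourierCoeff_add ((hf i).integrable (by norm_num)) ((hr i).integrable (by norm_num)),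
      mFourierCoeff_add ((haf i).integrable (by norm_num)) ((hg i).integrable (by norm_num))]
  have hsplit : ∀ i, ∫ x, conj (f i x + r i x) * ((a x : ℂ) * f i x + g i x) ∂(torusMeasure d)
      = ((∫ x, a x * ‖f i x‖ ^ 2 ∂(torusMeasure d) : ℝ) : ℂ)
        + (∫ x, conj (r i x) * ((a x : ℂ) * f i x) ∂(torusMeasure d)
        + ∫ x, conj (f i x + r i x) * g i x ∂(torusMeasure d)) := by
    intro i
    rw [← integral_complex_ofReal, ← integral_add (integrable_conj_mul (hr i) (haf i))
      (integrable_conj_mul (hq i) (hg i)), ← integral_add]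
    · congr 1
      ext x
      have := Complex.conj_mul' (f i x)
      push_cast
      rw [← this]
      simp only [map_add]
      ring
    · refine (integrable_conj_mul (hf i) (haf i)).congr (Filter.Eventually.of_forall fun x => ?_)
      have := Complex.conj_mul' (f i x)
      push_cast
      rw [← this]
      ring
    · exact (integrable_conj_mul (hr i) (haf i)).add (integrable_conj_mul (hq i) (hg i))
  simp_rw [hsplit, Finset.sum_add_distrib (f := fun i =>
    ((∫ x, a x * ‖f i x‖ ^ 2 ∂(torusMeasure d) : ℝ) : ℂ))] at h0
  have hlow : ENNReal.ofReal lo * ∑ i, eLpNorm (f i) 2 (torusMeasure d) ^ 2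
      ≤ ‖∑ i, ((∫ x, a x * ‖f i x‖ ^ 2 ∂(torusMeasure d) : ℝ) : ℂ)‖ₑ := by
    have hi2 : ∀ i, Integrable (fun x => ‖f i x‖ ^ 2) (torusMeasure d) :=
      fun i => (hf i).integrable_norm_pow two_ne_zero
    have hia : ∀ i, Integrable (fun x => a x * ‖f i x‖ ^ 2) (torusMeasure d) := by
      intro i
      refine (hi2 i).bdd_mul (c := hi) ha (Filter.Eventually.of_forall fun x => ?_)
      rw [Real.norm_of_nonneg (hlo.le.trans (hb x).1)]
      exact (hb x).2
    have hge : ∀ i, lo * ∫ x, ‖f i x‖ ^ 2 ∂(torusMeasure d)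
        ≤ ∫ x, a x * ‖f i x‖ ^ 2 ∂(torusMeasure d) := by
      intro i
      rw [← integral_const_mul]
      exact integral_mono ((hi2 i).const_mul lo) (hia i) fun x =>
        mul_le_mul_of_nonneg_right (hb x).1 (by positivity)
    have hn : ∀ i, 0 ≤ ∫ x, ‖f i x‖ ^ 2 ∂(torusMeasure d) := fun i =>
      integral_nonneg fun x => by positivity
    rw [← Complex.ofReal_sum, enorm_ofReal_complex, Real.enorm_eq_ofReal
      (Finset.sum_nonneg fun i _ => (mul_nonneg hlo.le (hn i)).trans (hge i))]
    simp_rw [eLpNorm_two_sq (hf _)]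
    rw [← ENNReal.ofReal_sum_of_nonneg fun i _ => hn i, ← ENNReal.ofReal_mul hlo.le,
      Finset.mul_sum]
    exact ENNReal.ofReal_le_ofReal (Finset.sum_le_sum fun i _ => hge i)
  refine hlow.trans ?_
  rw [eq_neg_of_add_eq_zero_left h0, enorm_neg]
  refine (enorm_sum_le _ _).trans (Finset.sum_le_sum fun i _ => (enorm_add_le _ _).trans ?_)
  rw [add_comm]
  refine add_le_add ((enorm_integral_conj_mul_le (hq i) (hg i)).trans ?_)
    ((enorm_integral_conj_mul_le (hr i) (haf i)).trans ?_)
  · gcongr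
    exact eLpNorm_add_le (hf i).1 (hr i).1 one_le_two
  · rw [mul_left_comm]
    gcongr
    exact (eLpNorm_bdd_mul_le (hf i).1).trans (by gcongr)

/-- Absorption for real numbers. If X ≤ Z + D nothing is needed. Otherwise Z and D are at most X;
the small coefficient lo/(4(n+1)), multiplied by n, is at most lo/4, so the X² term is absorbed and
one factor X cancels. -/
lemma le_of_energy_inequality {lo hi X Z D n : ℝ} (hlo : 0 < lo) (hhi : 0 ≤ hi) (hX : 0 ≤ X)
    (hZ : 0 ≤ Z) (hD : 0 ≤ D) (hn : 0 ≤ n)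
    (h : lo * X ^ 2 ≤ n * ((X + Z) * (lo / (4 * (n + 1)) * X + D) + hi * (Z * X))) :
    X ≤ (1 + 2 / lo * (lo + 2 * n + n * hi)) * (Z + D) := by
  set S := Z + D with hS
  have hS0 : 0 ≤ S := by positivity
  rcases le_total X S with hXS | hXS
  · refine hXS.trans (le_mul_of_one_le_left hS0 ?_)
    have : 0 ≤ 2 / lo * (lo + 2 * n + n * hi) := by positivity
    linarith
  · have hne : n * (lo / (4 * (n + 1))) ≤ lo / 4 := by
      rw [mul_div_assoc', div_le_div_iff₀ (by positivity) (by norm_num)]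
      nlinarith
    have h1 : n * ((X + Z) * (lo / (4 * (n + 1)) * X + D) + hi * (Z * X))
        ≤ lo / 4 * X ^ 2 + (lo / 4 + 2 * n + n * hi) * (X * S) := by
      have e : n * ((X + Z) * (lo / (4 * (n + 1)) * X + D) + hi * (Z * X))
          = (n * (lo / (4 * (n + 1)))) * ((X + Z) * X) + n * ((X + Z) * D) + n * hi * (Z * X) := by
        ring
      rw [e]
      have a1 : (n * (lo / (4 * (n + 1)))) * ((X + Z) * X) ≤ lo / 4 * ((X + Z) * X) := by gcongr
      have a2 : (X + Z) * D ≤ 2 * (X * S) := by nlinarith [mul_nonneg hZ hD, mul_nonneg hX hZ]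
      have a3 : Z * X ≤ X * S := by nlinarith
      have a4 : n * ((X + Z) * D) ≤ n * (2 * (X * S)) := by gcongr
      have a5 : n * hi * (Z * X) ≤ n * hi * (X * S) := by gcongr
      have a6 : lo / 4 * (X * Z) ≤ lo / 4 * (X * S) := by
        have : X * Z ≤ X * S := by linarith
        gcongr
      nlinarith
    have h2 : X * X ≤ X * (2 / lo * (lo + 2 * n + n * hi) * S) := by
      have h3 : lo / 2 * (X * X) ≤ (lo + 2 * n + n * hi) * (X * S) := by
        have : 0 ≤ lo * (X * S) := by positivity
        nlinarith [mul_nonneg hlo.le (mul_nonneg hX hX)]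
      calc X * X = 2 / lo * (lo / 2 * (X * X)) := by field_simp
        _ ≤ 2 / lo * ((lo + 2 * n + n * hi) * (X * S)) := by gcongr
        _ = _ := by ring
    rcases hX.eq_or_lt with h0 | h0
    · rw [← h0]
      positivity
    · have := le_of_mul_le_mul_left h2 h0
      nlinarith

/-- The elliptic estimate with a perturbation that is absorbed. -/
lemma sum_eLpNorm_le_of_energy {a : Torus d → ℝ} (ha : AEStronglyMeasurable a (torusMeasure d))
    {lo hi : ℝ} (hlo : 0 < lo) (hhi : 0 ≤ hi) (hb : ∀ x, lo ≤ a x ∧ a x ≤ hi)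
    {f r g : Fin d → Torus d → ℂ}
    (hf : ∀ i, MemLp (f i) 2 (torusMeasure d)) (hr : ∀ i, MemLp (r i) 2 (torusMeasure d))
    (hg : ∀ i, MemLp (g i) 2 (torusMeasure d))
    (h : ∀ k, ∑ i, conj (mFourierCoeff (f i) k + mFourierCoeff (r i) k) *
      (mFourierCoeff (fun x => (a x : ℂ) * f i x) k + mFourierCoeff (g i) k) = 0)
    {D : ℝ≥0∞} (hgD : ∑ i, eLpNorm (g i) 2 (torusMeasure d) ≤
      ENNReal.ofReal (lo / (4 * (d + 1))) * ∑ i, eLpNorm (f i) 2 (torusMeasure d) + D) :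
    ∑ i, eLpNorm (f i) 2 (torusMeasure d)
      ≤ ENNReal.ofReal (1 + 2 / lo * (lo + 2 * d + d * hi))
        * (∑ i, eLpNorm (r i) 2 (torusMeasure d) + D) := by
  have hC : 0 < 1 + 2 / lo * (lo + 2 * d + d * hi) := by positivity
  -- An infinite D makes the bound trivial; otherwise every quantity is finite and the argument
  -- moves to real numbers.
  rcases eq_or_ne D ⊤ with rfl | hD
  · rw [add_top, ENNReal.mul_top (by simpa using hC)]
    exact le_top
  have he := energy_inequality ha hlo hb hf hr hg h
  set x : Fin d → ℝ := fun i => (eLpNorm (f i) 2 (torusMeasure d)).toReal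
  set z : Fin d → ℝ := fun i => (eLpNorm (r i) 2 (torusMeasure d)).toReal
  set y : Fin d → ℝ := fun i => (eLpNorm (g i) 2 (torusMeasure d)).toReal
  have hx : ∀ i, eLpNorm (f i) 2 (torusMeasure d) = ENNReal.ofReal (x i) := fun i =>
    (ENNReal.ofReal_toReal (hf i).2.ne).symm
  have hz : ∀ i, eLpNorm (r i) 2 (torusMeasure d) = ENNReal.ofReal (z i) := fun i =>
    (ENNReal.ofReal_toReal (hr i).2.ne).symm
  have hy : ∀ i, eLpNorm (g i) 2 (torusMeasure d) = ENNReal.ofReal (y i) := fun i =>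
    (ENNReal.ofReal_toReal (hg i).2.ne).symm
  have hx0 : ∀ i, 0 ≤ x i := fun i => ENNReal.toReal_nonneg
  have hz0 : ∀ i, 0 ≤ z i := fun i => ENNReal.toReal_nonneg
  have hy0 : ∀ i, 0 ≤ y i := fun i => ENNReal.toReal_nonneg
  have hD' : D = ENNReal.ofReal D.toReal := (ENNReal.ofReal_toReal hD).symm
  have hD0 : 0 ≤ D.toReal := ENNReal.toReal_nonneg
  have hXn : 0 ≤ ∑ i, x i := Finset.sum_nonneg fun i _ => hx0 i
  have hZn : 0 ≤ ∑ i, z i := Finset.sum_nonneg fun i _ => hz0 i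
  simp_rw [hx, hz, hy] at he ⊢
  simp_rw [hx, hy] at hgD
  rw [hD'] at hgD ⊢
  rw [← ENNReal.ofReal_sum_of_nonneg fun i _ => hx0 i,
    ← ENNReal.ofReal_sum_of_nonneg fun i _ => hy0 i, ← ENNReal.ofReal_mul (by positivity),
    ← ENNReal.ofReal_add (by positivity) hD0,
    ENNReal.ofReal_le_ofReal_iff (by positivity)] at hgD
  rw [← ENNReal.ofReal_sum_of_nonneg fun i _ => hx0 i,
    ← ENNReal.ofReal_sum_of_nonneg fun i _ => hz0 i, ← ENNReal.ofReal_add hZn hD0,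
    ← ENNReal.ofReal_mul hC.le]
  refine ENNReal.ofReal_le_ofReal ?_
  have he' : lo * ∑ i, x i ^ 2 ≤ ∑ i, ((x i + z i) * y i + hi * (z i * x i)) := by
    have e1 : ∀ i, (ENNReal.ofReal (x i) + ENNReal.ofReal (z i)) * ENNReal.ofReal (y i)
        + ENNReal.ofReal hi * (ENNReal.ofReal (z i) * ENNReal.ofReal (x i))
        = ENNReal.ofReal ((x i + z i) * y i + hi * (z i * x i)) := by
      intro i
      have := hx0 i
      have := hy0 i
      have := hz0 i
      rw [← ENNReal.ofReal_add (by positivity) (by positivity), ← ENNReal.ofReal_mul (by positivity),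
        ← ENNReal.ofReal_mul (by positivity), ← ENNReal.ofReal_mul (by positivity),
        ← ENNReal.ofReal_add (by positivity) (by positivity)]
    have hnn : ∀ i, 0 ≤ (x i + z i) * y i + hi * (z i * x i) := fun i => by
      have := hx0 i
      have := hy0 i
      have := hz0 i
      positivity
    simp_rw [e1, ← ENNReal.ofReal_pow (hx0 _)] at he
    rw [← ENNReal.ofReal_sum_of_nonneg fun i _ => sq_nonneg _,
      ← ENNReal.ofReal_sum_of_nonneg fun i _ => hnn i, ← ENNReal.ofReal_mul hlo.le,
      ENNReal.ofReal_le_ofReal_iff (Finset.sum_nonneg fun i _ => hnn i)] at he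
    exact he
  refine le_of_energy_inequality (n := d) hlo hhi hXn hZn hD0 (Nat.cast_nonneg d) ?_
  -- Passing from sums of squares to the square of the sum costs the factor d, which is the n of the
  -- scalar absorption.
  have hcs : (∑ i, x i) ^ 2 ≤ d * ∑ i, x i ^ 2 := by
    have := sq_sum_le_card_mul_sum_sq (s := Finset.univ) (f := x)
    simpa using this
  have hle : ∀ {u : Fin d → ℝ}, (∀ i, 0 ≤ u i) → ∀ i, u i ≤ ∑ i, u i := fun hu i =>
    Finset.single_le_sum (fun i _ => hu i) (Finset.mem_univ i)
  have hsum : ∑ i, ((x i + z i) * y i + hi * (z i * x i))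
      ≤ (∑ i, x i + ∑ i, z i) * ∑ i, y i + hi * ((∑ i, z i) * ∑ i, x i) := by
    rw [Finset.sum_add_distrib, ← Finset.mul_sum]
    refine add_le_add ?_ (mul_le_mul_of_nonneg_left ?_ hhi)
    · rw [Finset.mul_sum]
      refine Finset.sum_le_sum fun i _ => mul_le_mul_of_nonneg_right ?_ (hy0 i)
      exact add_le_add (hle hx0 i) (hle hz0 i)
    · rw [Finset.mul_sum]
      exact Finset.sum_le_sum fun i _ => mul_le_mul_of_nonneg_right (hle hz0 i) (hx0 i)
  calc lo * (∑ i, x i) ^ 2 ≤ lo * (d * ∑ i, x i ^ 2) := by gcongr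
    _ = d * (lo * ∑ i, x i ^ 2) := by ring
    _ ≤ d * ((∑ i, x i + ∑ i, z i) * ∑ i, y i + hi * ((∑ i, z i) * ∑ i, x i)) := by
        gcongr
        exact he'.trans hsum
    _ ≤ _ := by gcongr

/-! ### The equation on the Fourier side -/

lemma IsSmooth.hn_natCast_lt_top (n : ℕ) : ∀ {f : Torus d → ℂ}, IsSmooth f → hn n f < ⊤ := by
  induction n with
  | zero =>
    intro f hf
    have hm := memLp_of_continuous hf.continuous 2
    rw [Nat.cast_zero, hn_zero_eq hm]
    exact hm.2
  | succ n ih =>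
    intro f hf
    rw [Nat.cast_succ]
    refine (hn_add_one_le n fun i k => mFourierCoeff_partialDeriv hf i k).trans_lt ?_
    exact ENNReal.add_lt_top.2 ⟨ih hf, ENNReal.sum_lt_top.2 fun i _ =>
      ih (hf.isSmooth_partialDeriv i)⟩

/-- Supplies the a priori finiteness of the H^s norm of ∇p, without which the commutator could not
be absorbed. -/
lemma IsSmooth.hn_lt_top (s : ℝ) {f : Torus d → ℂ} (hf : IsSmooth f) : hn s f < ⊤ := by
  obtain ⟨n, hn⟩ := exists_nat_ge s
  exact (hn_mono hn f).trans_lt (hf.hn_natCast_lt_top n)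

/-- A field which is weakly divergence free has a divergence free Fourier transform. -/
lemma sum_mul_mFourierCoeff_eq_zero {X : Fin d → Torus d → ℝ}
    (hX : ∀ i, MemLp (X i) 2 (torusMeasure d))
    (h : ∀ φ : Torus d → ℝ, IsSmooth φ →
      ∫ x, ∑ i, X i x * partialDeriv i φ x ∂(torusMeasure d) = 0) (k : Fin d → ℤ) :
    ∑ i, (k i : ℂ) * mFourierCoeff (fun x => (X i x : ℂ)) k = 0 := by
  -- Test functions are real, so the exponential is tested through its real and imaginary parts.
  set u : Torus d → ℂ := fun x => mFourier (-k) x with hu'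
  have hu : IsSmooth u := isSmooth_mFourier (-k)
  have hi : ∀ i, Integrable (fun x => (X i x : ℂ) * partialDeriv i u x) (torusMeasure d) := by
    intro i
    have hXi : Integrable (fun x => (X i x : ℂ)) (torusMeasure d) :=
      ((hX i).integrable (by norm_num)).ofReal
    obtain ⟨B, hB⟩ := isCompact_univ.exists_bound_of_continuousOn
      (hu.isSmooth_partialDeriv i).continuous.continuousOn
    exact hXi.mul_bdd (c := B) (hu.isSmooth_partialDeriv i).continuous.aestronglyMeasurable
        (Filter.Eventually.of_forall fun x => hB x (Set.mem_univ x))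
  have hint : Integrable (fun x => ∑ i, (X i x : ℂ) * partialDeriv i u x) (torusMeasure d) :=
    integrable_finsetSum _ fun i _ => hi i
  have key : ∫ x, ∑ i, (X i x : ℂ) * partialDeriv i u x ∂(torusMeasure d) = 0 := by
    have r := h _ (hu.clm_comp Complex.reCLM)
    have m := h _ (hu.clm_comp Complex.imCLM)
    simp_rw [partialDeriv_clm_comp _ hu] at r m
    have er := integral_re hint
    have em := integral_im hint
    apply Complex.ext
    · simp only [RCLike.re_eq_complex_re, Complex.re_sum, Complex.re_ofReal_mul] at er
      rw [← er, Complex.zero_re]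
      exact r
    · simp only [RCLike.im_eq_complex_im, Complex.im_sum, Complex.im_ofReal_mul] at em
      rw [← em, Complex.zero_im]
      exact m
  rw [integral_finsetSum _ fun i _ => hi i] at key
  have e : ∀ i, ∫ x, (X i x : ℂ) * partialDeriv i u x ∂(torusMeasure d)
      = -(2 * Real.pi * Complex.I) * ((k i : ℂ) * mFourierCoeff (fun x => (X i x : ℂ)) k) := by
    intro i
    rw [mFourierCoeff_def, ← mul_assoc, ← integral_const_mul]
    congr 1
    ext x
    rw [hu', partialDeriv_mFourier]
    push_cast [Pi.neg_apply]
    ring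
  simp_rw [e, ← Finset.mul_sum] at key
  refine (mul_eq_zero.1 key).resolve_left ?_
  simp [Real.pi_ne_zero]

/-! ### The pressure estimate -/

/-- The scalar interpolation is applied at each frequency with x = ⟨k⟩^θ; integer multiples of θ
keep all powers natural. -/
lemma mul_hn_le_interpolation {N ε : ℝ≥0∞} (hε : ε ≠ 0) (hε' : ε ≠ ⊤) (n : ℕ) (θ : ℝ)
    (u : Torus d → ℂ) :
    N * hn (n * θ) u ≤ ε * hn ((n + 1 : ℕ) * θ) u + (ε⁻¹) ^ n * N ^ (n + 1) * hn 0 u := by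
  unfold hn
  rw [← l2_const_mul, ← l2_const_mul, ← l2_const_mul]
  refine (l2_mono fun k => ?_).trans (l2_add_le _ _)
  rw [← wt_pow, ← wt_pow, wt_zero, one_mul, ← mul_assoc, ← mul_assoc, ← add_mul]
  gcongr
  exact mul_pow_le_interpolation hε hε' n

/-- The choice ρ = 2 − θ makes both weight sums equal to the same ℓ² norm of ⟨k⟩^{θ−2} and puts only
the L² norm of u in the second term. The first term carries H^{s−θ} = H^{nθ}, which is interpolated
between H^s with factor ε and L². -/
lemma l2_commutator_le_of_interpolation {s θ : ℝ} {n : ℕ} (hθ : 0 ≤ θ) (hθ1 : θ ≤ 1)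
    (hn : s = (n + 1 : ℕ) * θ) {ε : ℝ≥0∞} (hε : ε ≠ 0) (hε' : ε ≠ ⊤)
    {b u f : Torus d → ℂ} (hb : MemLp b 2 (torusMeasure d)) (hu : MemLp u 2 (torusMeasure d))
    (hf : MemLp f 2 (torusMeasure d))
    (hfu : ∀ k, mFourierCoeff f k = ((bracket k ^ s : ℝ) : ℂ) * mFourierCoeff u k) :
    l2 (fun k => ‖((bracket k ^ s : ℝ) : ℂ) * mFourierCoeff (fun x => b x * u x) k
        - mFourierCoeff (fun x => b x * f x) k‖ₑ)
      ≤ ε * HeleShaw.hn s u + ((ε⁻¹) ^ n * (ENNReal.ofReal ((1 + s) * 2 ^ s) *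
          (l2 (wt (d := d) (θ - 2)) * HeleShaw.hn 2 b)) ^ (n + 1)
        + ENNReal.ofReal ((1 + s) * 2 ^ s) * (HeleShaw.hn (2 + n * θ) b *
          l2 (wt (d := d) (θ - 2)))) * eLpNorm u 2 (torusMeasure d) := by
  have hθs : θ ≤ s := by
    rw [hn]
    push_cast
    have : 0 ≤ (n : ℝ) * θ := by positivity
    linarith
  have e1 : s - θ = n * θ := by rw [hn]; push_cast; ring
  have e2 : s + (2 - θ) = 2 + n * θ := by rw [hn]; push_cast; ring
  have h := l2_commutator_le hθ hθ1 hθs (ρ := 2 - θ) (by linarith) hb hu hf hfu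
  rw [e1, e2, neg_sub] at h
  refine h.trans ?_
  set A := ENNReal.ofReal ((1 + s) * 2 ^ s)
  set S := l2 (wt (d := d) (θ - 2))
  have h1 : ∑' k, wt θ k * ‖mFourierCoeff b k‖ₑ ≤ S * HeleShaw.hn 2 b :=
    tsum_wt_mul_le_hn_two θ b
  have h2 : ∑' k, wt (θ - 2) k * ‖mFourierCoeff u k‖ₑ ≤ S * eLpNorm u 2 (torusMeasure d) := by
    have := tsum_wt_mul_mFourierCoeff_le (θ - 2) 0 u
    rwa [sub_zero, hn_zero_eq hu] at this
  have h3 := mul_hn_le_interpolation (N := A * (S * HeleShaw.hn 2 b)) hε hε' n θ u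
  rw [← hn, hn_zero_eq hu] at h3
  calc _ ≤ A * ((S * HeleShaw.hn 2 b) * HeleShaw.hn (n * θ) u
        + HeleShaw.hn (2 + n * θ) b * (S * eLpNorm u 2 (torusMeasure d))) := by gcongr
    _ = A * (S * HeleShaw.hn 2 b) * HeleShaw.hn (n * θ) u
        + A * (HeleShaw.hn (2 + n * θ) b * S) * eLpNorm u 2 (torusMeasure d) := by ring
    _ ≤ _ := by
        rw [add_mul, ← add_assoc]
        gcongr

lemma MemLp.bdd_mul_real {a u : Torus d → ℝ} {p : ℝ≥0∞} (ha : MemLp a ∞ (torusMeasure d))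
    (hu : MemLp u p (torusMeasure d)) : MemLp (fun x => a x * u x) p (torusMeasure d) :=
  hu.mul (r := p) ha

/-- The equation for the pressure, on the Fourier side. -/
lemma IsSmoothPressure.sum_mul_mFourierCoeff {η : ℝ → ℝ} {C : ℝ} {c p : Torus d → ℝ}
    (h : IsSmoothPressure η C c p)
    (ha : MemLp (fun x => (η (c x))⁻¹) ∞ (torusMeasure d))
    (hW : ∀ i, MemLp (force C c i) 2 (torusMeasure d)) (k : Fin d → ℤ) :
    ∑ i, conj (mFourierCoeff (fun x => ((partialDeriv i p x : ℝ) : ℂ)) k) *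
      mFourierCoeff (fun x => (((η (c x))⁻¹ : ℝ) : ℂ)
        * ((partialDeriv i p x - force C c i x : ℝ) : ℂ)) k = 0 := by
  have hp := fun i => memLp_of_continuous (h.1.isSmooth_partialDeriv i).continuous 2
  have hX : ∀ i, MemLp (fun x => (η (c x))⁻¹ * (partialDeriv i p x - force C c i x)) 2
      (torusMeasure d) := fun i => MemLp.bdd_mul_real ha ((hp i).sub (hW i))
  have h0 := sum_mul_mFourierCoeff_eq_zero hX (fun φ hφ => ?_) k
  · have e : ∀ i, mFourierCoeff (fun x => ((partialDeriv i p x : ℝ) : ℂ)) k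
        = 2 * Real.pi * Complex.I * k i * mFourierCoeff (fun x => (p x : ℂ)) k := by
      intro i
      rw [← mFourierCoeff_partialDeriv h.1.ofReal, funext (partialDeriv_ofReal h.1 i)]
    have e2 : ∀ i, conj (mFourierCoeff (fun x => ((partialDeriv i p x : ℝ) : ℂ)) k) *
        mFourierCoeff (fun x => (((η (c x))⁻¹ : ℝ) : ℂ)
          * ((partialDeriv i p x - force C c i x : ℝ) : ℂ)) k
        -- The coefficients of ∇p are multiples of k, so pairing them with a divergence-free field
        -- gives zero.
        = conj (2 * Real.pi * Complex.I * mFourierCoeff (fun x => (p x : ℂ)) k) * ((k i : ℂ) *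
          mFourierCoeff (fun x => (((η (c x))⁻¹ * (partialDeriv i p x - force C c i x) : ℝ) : ℂ))
            k) := by
      intro i
      rw [e]
      simp only [map_mul, Complex.ofReal_mul, map_intCast]
      ring
    rw [Finset.sum_congr rfl fun i _ => e2 i, ← Finset.mul_sum, h0, mul_zero]
  · have hφ' := fun i => memLp_of_continuous (hφ.isSmooth_partialDeriv i).continuous ∞
    have hi : ∀ {u : Fin d → Torus d → ℝ}, (∀ i, MemLp (u i) 2 (torusMeasure d)) →
        Integrable (fun x => ∑ i, (η (c x))⁻¹ * u i x * partialDeriv i φ x) (torusMeasure d) := by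
      intro u hu
      refine integrable_finsetSum _ fun i _ => ?_
      have := (MemLp.bdd_mul_real (hφ' i) (MemLp.bdd_mul_real ha (hu i))).integrable (by norm_num)
      refine this.congr (Filter.Eventually.of_forall fun x => mul_comm _ _)
    have heq := h.2 φ hφ
    have e1 : ∀ x, (η (c x))⁻¹ * inner ℝ (grad p x) (grad φ x)
        = ∑ i, (η (c x))⁻¹ * partialDeriv i p x * partialDeriv i φ x := by
      intro x
      simp only [PiLp.inner_apply, grad, RCLike.inner_apply, conj_trivial, Finset.mul_sum]
      exact Finset.sum_congr rfl fun i _ => by ring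
    have e2 : ∀ x, (η (c x))⁻¹ * chemPotential C c x * inner ℝ (weakGrad c x) (grad φ x)
        = ∑ i, (η (c x))⁻¹ * force C c i x * partialDeriv i φ x := by
      intro x
      simp only [PiLp.inner_apply, grad, weakGrad, force, RCLike.inner_apply, conj_trivial,
        Finset.mul_sum]
      exact Finset.sum_congr rfl fun i _ => by ring
    simp_rw [e1, e2] at heq
    rw [← sub_eq_zero, ← integral_sub (hi hp) (hi hW)] at heq
    rw [← heq]
    congr 1
    ext x
    rw [← Finset.sum_sub_distrib]
    exact Finset.sum_congr rfl fun i _ => by ring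

/-- The energy estimate is used twice for v = ∇p − W, in L² without error and then in H^s with the
commutator as error. Working with v instead of ∇p keeps W outside the coefficient a: only v has to
be commuted with a. -/
lemma exists_pressure_le (d : ℕ) (hd : d ≤ 3) {η : ℝ → ℝ} (hη : ContDiff ℝ ∞ η) {lam Lam : ℝ}
    (hlam : 0 < lam) (hbound : ∀ r : ℝ, lam ≤ η r ∧ η r ≤ Lam) (C : ℝ) {s : ℝ} (hs : 0 ≤ s)
    (M : ℝ≥0) :
    ∃ A : ℝ≥0, ∀ c p : Torus d → ℝ, MemSobolev (s + 2) c → IsSmoothPressure η C c p →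
      eLpNorm c ∞ (torusMeasure d) ≤ M → eLpNorm (weakGrad c) ∞ (torusMeasure d) < ⊤ →
      ∑ i, hn s (fun x => ((partialDeriv i p x : ℝ) : ℂ))
        ≤ A * (1 + eLpNorm (weakGrad c) ∞ (torusMeasure d))
          * (1 + hn 2 (fun x => (c x : ℂ))) ^ (⌊2 * s⌋₊ + 1) * hn (s + 2) (fun x => (c x : ℂ)) := by
  have hη0 : ∀ r, 0 < η r := fun r => hlam.trans_le (hbound r).1
  have hLam : 0 < Lam := (hη0 0).trans_le (hbound 0).2
  set n := ⌊2 * s⌋₊ with hn'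
  -- Since n + 1 > 2s, this θ is below 1/2, and s is exactly n + 1 steps of length θ.
  set θ : ℝ := s / (n + 1 : ℕ) with hθ'
  have hn1 : (0 : ℝ) < (n + 1 : ℕ) := by positivity
  have hθ : 0 ≤ θ := by positivity
  have hθ1 : θ < 1 / 2 := by
    rw [hθ', div_lt_iff₀ hn1]
    have := Nat.lt_floor_add_one (2 * s)
    push_cast
    linarith
  have hsθ : s = (n + 1 : ℕ) * θ := by
    rw [hθ']
    field_simp
  -- The composition estimates need a function vanishing at 0, and the removed constant commutes
  -- with the Bessel potential.
  set B : ℝ → ℝ := fun r => (η r)⁻¹ - (η 0)⁻¹ with hB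
  have hinv : ContDiff ℝ ∞ fun r => (η r)⁻¹ := hη.inv fun r => (hη0 r).ne'
  have hBs : ContDiff ℝ ∞ B := hinv.sub contDiff_const
  have hB0 : B 0 = 0 := sub_self _
  obtain ⟨A₁, hA₁⟩ := exists_force_le d hd C hs M
  obtain ⟨A₂, hA₂⟩ := hn_two_comp_le d hBs hB0 M
  obtain ⟨A₃, hA₃⟩ := hn_comp_le hd hθ hθ1 n B hBs hB0 M
  set S : ℝ≥0 := (l2 (wt (d := d) (θ - 2))).toNNReal
  have hS : l2 (wt (d := d) (θ - 2)) = S :=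
    (ENNReal.coe_toNNReal (l2_wt_lt_top hd hθ1).ne).symm
  set A : ℝ≥0 := Real.toNNReal ((1 + s) * 2 ^ s)
  have hA : ENNReal.ofReal ((1 + s) * 2 ^ s) = A := rfl
  set E : ℝ≥0 := Real.toNNReal (1 + 2 / Lam⁻¹ * (Lam⁻¹ + 2 * d + d * lam⁻¹))
  have hE : ENNReal.ofReal (1 + 2 / Lam⁻¹ * (Lam⁻¹ + 2 * d + d * lam⁻¹)) = E := rfl
  -- The smallness required by `sum_eLpNorm_le_of_energy` with lower ellipticity bound 1/Λ.
  set ε : ℝ≥0 := Real.toNNReal (Lam⁻¹ / (4 * (d + 1)))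
  have hεeq : ENNReal.ofReal (Lam⁻¹ / (4 * (d + 1))) = ε := rfl
  have hε : ε ≠ 0 := by
    have : 0 < Lam⁻¹ / (4 * (d + 1)) := by positivity
    simpa [ε] using this
  refine ⟨d * A₁ + E * (d * A₁ + ((ε⁻¹) ^ n * (A * (S * A₂)) ^ (n + 1) + A * (A₃ * S))
    * (E * (d * A₁))), fun c p hc hp hM hK => ?_⟩
  set K := eLpNorm (weakGrad c) ∞ (torusMeasure d)
  set N := HeleShaw.hn 2 (fun x => (c x : ℂ)) with hN
  set T := HeleShaw.hn (s + 2) (fun x => (c x : ℂ)) with hT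
  have hNT : N ≤ T := hn_mono (by linarith) _
  have hTtop : T ≠ ⊤ := hc.hn_lt_top.ne
  have hNtop : N ≠ ⊤ := (hNT.trans_lt hc.hn_lt_top).ne
  have hc2 : MemSobolev 2 c := hc.mono (by linarith)
  have hF := hA₁ c hc hM hK
  set a : Torus d → ℝ := fun x => (η (c x))⁻¹ with ha'
  have hab : ∀ x, Lam⁻¹ ≤ a x ∧ a x ≤ lam⁻¹ := fun x =>
    ⟨inv_anti₀ (hη0 _) (hbound _).2, inv_anti₀ hlam (hbound _).1⟩
  have ham : AEStronglyMeasurable a (torusMeasure d) :=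
    hinv.continuous.comp_aestronglyMeasurable hc.1.1
  have ha : MemLp a ∞ (torusMeasure d) :=
    memLp_top_of_bound ham lam⁻¹ (Filter.Eventually.of_forall fun x => by
      rw [Real.norm_of_nonneg ((inv_pos.2 hLam).le.trans (hab x).1)]
      exact (hab x).2)
  have haC : MemLp (fun x => (a x : ℂ)) ∞ (torusMeasure d) := ha.ofReal
  have hpS := fun i => hp.1.isSmooth_partialDeriv i
  have hpm : ∀ i, MemLp (fun x => ((partialDeriv i p x : ℝ) : ℂ)) 2 (torusMeasure d) := fun i =>
    memLp_ofReal_of_continuous (hpS i).continuous 2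
  set W : Fin d → Torus d → ℂ := fun i x => (force C c i x : ℂ)
  have hWm : ∀ i, MemLp (W i) 2 (torusMeasure d) := fun i => (hF i).1.ofReal
  set v : Fin d → Torus d → ℂ := fun i x => ((partialDeriv i p x - force C c i x : ℝ) : ℂ)
  have hv' : ∀ i, v i = fun x => ((partialDeriv i p x : ℝ) : ℂ) - W i x := fun i => by
    ext x
    simp [v, W]
  have hvm : ∀ i, MemLp (v i) 2 (torusMeasure d) := fun i => by
    rw [hv']
    exact (hpm i).sub (hWm i)
  have hvc : ∀ i k, mFourierCoeff (v i) k + mFourierCoeff (W i) k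
      = mFourierCoeff (fun x => ((partialDeriv i p x : ℝ) : ℂ)) k := by
    intro i k
    rw [hv', mFourierCoeff_sub ((hpm i).integrable (by norm_num))
      ((hWm i).integrable (by norm_num)), sub_add_cancel]
  have hWn : ∀ i, HeleShaw.hn s (W i) ≤ A₁ * ((1 + K) * T) := fun i => (hF i).2.2
  have hWtop : ∀ i, HeleShaw.hn s (W i) < ⊤ := fun i => (hWn i).trans_lt
    (ENNReal.mul_lt_top ENNReal.coe_lt_top (ENNReal.mul_lt_top
      (ENNReal.add_lt_top.2 ⟨ENNReal.one_lt_top, hK⟩) hc.hn_lt_top))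
  have hvtop : ∀ i, HeleShaw.hn s (v i) < ⊤ := fun i => by
    rw [hv']
    exact (hn_sub_le s ((hpm i).integrable (by norm_num))
      ((hWm i).integrable (by norm_num))).trans_lt
      (ENNReal.add_lt_top.2 ⟨(hpS i).ofReal.hn_lt_top s, hWtop i⟩)
  have heq := hp.sum_mul_mFourierCoeff ha fun i => (hF i).1
  -- The basic energy estimate, with neither Bessel potential nor commutator.
  have hL2 : ∑ i, eLpNorm (v i) 2 (torusMeasure d) ≤ E * (d * A₁) * (K * N) := by
    have h0 := sum_eLpNorm_le_of_energy ham (inv_pos.2 hLam) (inv_pos.2 hlam).le hab hvm hWm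
      (g := fun _ _ => 0) (fun _ => MemLp.zero) (fun k => by
        refine (Finset.sum_congr rfl fun i _ => ?_).trans (heq k)
        rw [hvc]
        congr 1
        rw [mFourierCoeff_def (fun _ => 0)]
        simp only [mul_zero, integral_zero, add_zero]
        rfl) (D := 0) (by simp)
    rw [add_zero, hE] at h0
    refine h0.trans ?_
    rw [mul_assoc]
    refine mul_le_mul_right ?_ _
    calc _ ≤ ∑ _i : Fin d, A₁ * (K * N) := Finset.sum_le_sum fun i _ => by
          have := (hF i).2.1
          rwa [← eLpNorm_ofReal] at this
      _ = _ := by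
          rw [Finset.sum_const, Finset.card_univ, Fintype.card_fin, nsmul_eq_mul]
          ring
  choose f hf hfc hfn using fun i => exists_bessel s (hvtop i)
  choose r hr hrc hrn using fun i => exists_bessel s (hWtop i)
  set b : Torus d → ℂ := fun x => (B (c x) : ℂ) with hb'
  have hb : ∀ q, MemLp b q (torusMeasure d) := memLp_comp hc.1.1 hM hBs
  -- The coefficient of ‖v‖_{L²} in the commutator bound: N^{n+1} from interpolation, (1 + N)^n T
  -- from the composition estimate.
  set R : ℝ≥0∞ := (ε⁻¹ : ℝ≥0) ^ n * (A * (S * (A₂ * N))) ^ (n + 1)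
    + A * ((A₃ * (1 + N) ^ n * T) * S) with hR
  have hcomm : ∀ i, l2 (fun k => ‖((bracket k ^ s : ℝ) : ℂ) *
      mFourierCoeff (fun x => (a x : ℂ) * v i x) k
      - mFourierCoeff (fun x => (a x : ℂ) * f i x) k‖ₑ)
      ≤ ε * eLpNorm (f i) 2 (torusMeasure d) + R * eLpNorm (v i) 2 (torusMeasure d) := by
    intro i
    have h1 := l2_commutator_le_of_interpolation hθ (by linarith) hsθ
      (ENNReal.coe_ne_zero.2 hε) ENNReal.coe_ne_top (hb 2) (hvm i) (hf i) (hfc i)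
    have e : ∀ {u : Torus d → ℂ}, MemLp u 2 (torusMeasure d) → ∀ k,
        mFourierCoeff (fun x => (a x : ℂ) * u x) k
          = mFourierCoeff (fun x => b x * u x) k + ((η 0)⁻¹ : ℂ) * mFourierCoeff u k := by
      intro u hu k
      rw [← mFourierCoeff_const_mul, ← mFourierCoeff_add
        ((MemLp.bdd_mul_two (hb ∞) hu).integrable (by norm_num))
        ((hu.const_mul _).integrable (by norm_num))]
      congr 1
      ext x
      simp only [ha', hb', hB]
      push_cast
      ring
    have e2 : ∀ k, ((bracket k ^ s : ℝ) : ℂ) * mFourierCoeff (fun x => (a x : ℂ) * v i x) k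
        - mFourierCoeff (fun x => (a x : ℂ) * f i x) k
        = ((bracket k ^ s : ℝ) : ℂ) * mFourierCoeff (fun x => b x * v i x) k
        - mFourierCoeff (fun x => b x * f i x) k := by
      intro k
      rw [e (hvm i), e (hf i), hfc]
      ring
    simp_rw [e2]
    refine h1.trans ?_
    rw [hS, hA, hfn, hR, ENNReal.coe_inv hε]
    gcongr
    · exact hA₂ c hc.1 (hc2.tsum_lt_top hd) hM
    · refine (hA₃ c hc2 hM).trans ?_
      gcongr
      refine hn_mono ?_ _
      rw [hsθ]
      push_cast
      linarith
  have hRtop : R < ⊤ := by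
    have h1N : 1 + N < ⊤ := ENNReal.add_lt_top.2 ⟨ENNReal.one_lt_top, hNtop.lt_top⟩
    refine ENNReal.add_lt_top.2 ⟨?_, ?_⟩
    · refine ENNReal.mul_lt_top (ENNReal.pow_lt_top ENNReal.coe_lt_top) (ENNReal.pow_lt_top ?_)
      exact ENNReal.mul_lt_top ENNReal.coe_lt_top (ENNReal.mul_lt_top ENNReal.coe_lt_top
        (ENNReal.mul_lt_top ENNReal.coe_lt_top hNtop.lt_top))
    · refine ENNReal.mul_lt_top ENNReal.coe_lt_top (ENNReal.mul_lt_top (ENNReal.mul_lt_top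
        (ENNReal.mul_lt_top ENNReal.coe_lt_top (ENNReal.pow_lt_top h1N)) hTtop.lt_top)
        ENNReal.coe_lt_top)
  -- The commutator is realised as an L² function; its coefficients are square summable because
  -- ‖v‖_{H^s} is finite.
  choose g hg hgc using fun i => exists_mFourierCoeff_eq _ ((hcomm i).trans_lt
    (ENNReal.add_lt_top.2 ⟨ENNReal.mul_lt_top ENNReal.coe_lt_top (hf i).2,
      ENNReal.mul_lt_top hRtop (hvm i).2⟩))
  have hgn : ∀ i, eLpNorm (g i) 2 (torusMeasure d)
      ≤ ε * eLpNorm (f i) 2 (torusMeasure d) + R * eLpNorm (v i) 2 (torusMeasure d) := by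
    intro i
    rw [← l2_mFourierCoeff (hg i)]
    simp_rw [hgc]
    exact hcomm i
  have hHs : ∑ i, HeleShaw.hn s (v i)
      ≤ E * (d * A₁ * ((1 + K) * T) + R * (E * (d * A₁) * (K * N))) := by
    have h0 := sum_eLpNorm_le_of_energy ham (inv_pos.2 hLam) (inv_pos.2 hlam).le hab hf hr hg
      (fun k => by
        -- The orthogonality relation is multiplied by ⟨k⟩^{2s}, one factor ⟨k⟩^s for each side of
        -- the pairing.
        have h1 := congrArg (fun z => ((bracket k ^ s : ℝ) : ℂ) * ((bracket k ^ s : ℝ) : ℂ) * z)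
          (heq k)
        simp only [mul_zero, Finset.mul_sum] at h1
        rw [← h1]
        refine Finset.sum_congr rfl fun i _ => ?_
        rw [hfc, hrc, ← mul_add, hvc, hgc, add_sub_cancel, map_mul, Complex.conj_ofReal]
        ring) (D := R * ∑ i, eLpNorm (v i) 2 (torusMeasure d)) (by
        rw [Finset.mul_sum, Finset.mul_sum, ← Finset.sum_add_distrib]
        exact Finset.sum_le_sum fun i _ => hgn i)
    rw [hE] at h0
    simp_rw [hfn, hrn] at h0
    refine h0.trans (mul_le_mul_right (add_le_add ?_ (mul_le_mul_right hL2 _)) _)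
    refine (Finset.sum_le_sum fun i _ => hWn i).trans_eq ?_
    rw [Finset.sum_const, Finset.card_univ, Fintype.card_fin, nsmul_eq_mul, mul_assoc]
  have hpn : ∀ i, HeleShaw.hn s (fun x => ((partialDeriv i p x : ℝ) : ℂ))
      ≤ HeleShaw.hn s (W i) + HeleShaw.hn s (v i) := by
    intro i
    refine le_trans (le_of_eq ?_) (hn_add_le s ((hWm i).integrable (by norm_num))
      ((hvm i).integrable (by norm_num)))
    refine hn_congr (fun k => ?_) s
    rw [hv']
    simp
  set Q : ℝ≥0∞ := (1 + K) * (1 + N) ^ (n + 1) * T with hQ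
  have h1N : 1 ≤ 1 + N := le_self_add
  have hKTQ : (1 + K) * T ≤ Q := by
    rw [hQ, mul_assoc]
    gcongr
    exact le_mul_of_one_le_left zero_le (one_le_pow₀ h1N)
  -- The count of powers. In N^{n+1} · N the last factor is bounded by T; in (1 + N)^n T · N it
  -- joins the power. Both give (1 + N)^{n+1} T.
  have hRQ : R * (K * N) ≤ ((ε⁻¹ : ℝ≥0) ^ n * (A * (S * A₂)) ^ (n + 1) + A * (A₃ * S)) * Q := by
    have hK1 : K ≤ 1 + K := le_add_self
    have hN1 : N ≤ 1 + N := le_add_self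
    calc R * (K * N) = (ε⁻¹ : ℝ≥0) ^ n * (A * (S * A₂)) ^ (n + 1) * (K * N ^ (n + 1) * N)
          + A * (A₃ * S) * (K * ((1 + N) ^ n * N) * T) := by
          rw [hR]
          ring
      _ ≤ (ε⁻¹ : ℝ≥0) ^ n * (A * (S * A₂)) ^ (n + 1) * ((1 + K) * (1 + N) ^ (n + 1) * T)
          + A * (A₃ * S) * ((1 + K) * ((1 + N) ^ n * (1 + N)) * T) := by gcongr
      _ = _ := by
          rw [hQ]
          ring
  calc _ ≤ ∑ i, (HeleShaw.hn s (W i) + HeleShaw.hn s (v i)) := Finset.sum_le_sum fun i _ => hpn i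
    _ ≤ d * A₁ * ((1 + K) * T) + E * (d * A₁ * ((1 + K) * T) + R * (E * (d * A₁) * (K * N))) := by
        rw [Finset.sum_add_distrib]
        refine add_le_add ((Finset.sum_le_sum fun i _ => hWn i).trans_eq ?_) hHs
        rw [Finset.sum_const, Finset.card_univ, Fintype.card_fin, nsmul_eq_mul, mul_assoc]
    _ = d * A₁ * ((1 + K) * T) + E * (d * A₁ * ((1 + K) * T)
        + E * (d * A₁) * (R * (K * N))) := by ring
    _ ≤ d * A₁ * Q + E * (d * A₁ * Q + E * (d * A₁) *
        (((ε⁻¹ : ℝ≥0) ^ n * (A * (S * A₂)) ^ (n + 1) + A * (A₃ * S)) * Q)) := by gcongr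
    _ = _ := by
        rw [hQ]
        push_cast
        ring

/-! ### Vector norms, degenerate cases and monotone constants. -/

lemma l2_le_sum {ι : Type*} [Fintype ι] (a : ι → ℝ≥0∞) : l2 a ≤ ∑ i, a i := by
  rw [l2_le_iff, tsum_fintype, sq, Finset.sum_mul]
  refine Finset.sum_le_sum fun i _ => ?_
  rw [sq]
  gcongr
  exact Finset.single_le_sum (fun _ _ => zero_le) (Finset.mem_univ i)

lemma sobolevNormVec_le_sum (s : ℝ) (V : Torus d → EuclideanSpace ℝ (Fin d)) :
    sobolevNormVec s V ≤ ∑ i, sobolevNorm s (fun x => V x i) := by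
  refine le_trans (le_of_eq ?_) (l2_le_sum _)
  rw [sobolevNormVec, l2, tsum_fintype]

lemma MemSobolev.eLpNorm_top_lt_top (hd : d ≤ 3) {c : Torus d → ℝ} (hc : MemSobolev 2 c) :
    eLpNorm c ∞ (torusMeasure d) < ⊤ := by
  obtain ⟨g, hcg, hgc, -⟩ := exists_tendstoUniformly_truncate hc.1 (hc.tsum_lt_top hd)
  rw [eLpNorm_congr_ae hcg]
  exact (memLp_of_continuous hgc ∞).2

/-- Excludes the indeterminate case ∞ · 0 in the final bound: an unbounded gradient forces a nonzero
Sobolev norm of c. -/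
lemma eLpNorm_weakGrad_eq_zero {s : ℝ} (hs : 0 ≤ s) {c : Torus d → ℝ} (hc : MemSobolev (s + 1) c)
    (h : hn (s + 1) (fun x => (c x : ℂ)) = 0) : eLpNorm (weakGrad c) ∞ (torusMeasure d) = 0 := by
  have h1 : ∀ i, weakPartial i c =ᵐ[torusMeasure d] 0 := by
    intro i
    have hw := hc.exists_weakPartial hs i
    have h2 : hn s (fun x => (weakPartial i c x : ℂ)) = 0 := by
      have := hn_deriv_le s i hw.2
      rwa [h, mul_zero, nonpos_iff_eq_zero] at this
    have h3 : eLpNorm (weakPartial i c) 2 (torusMeasure d) = 0 := by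
      have := eLpNorm_le_hn hs (u := fun x => (weakPartial i c x : ℂ)) hw.1.1.ofReal
      rwa [h2, nonpos_iff_eq_zero, eLpNorm_ofReal] at this
    exact (eLpNorm_eq_zero_iff hw.1.1.1 two_ne_zero).1 h3
  have h2 : weakGrad c =ᵐ[torusMeasure d] 0 := by
    filter_upwards [ae_all_iff.2 h1] with x hx
    ext i
    exact hx i
  rw [eLpNorm_congr_ae h2, eLpNorm_zero]

/-- A family of constants is dominated by a strictly increasing function. -/
lemma exists_strictMono_ge (A : ℝ≥0 → ℝ≥0) : ∃ F : ℝ≥0 → ℝ≥0, StrictMono F ∧ (∀ x, 0 < F x) ∧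
    ∀ x, ∃ y, x ≤ y ∧ A y ≤ F x := by
  -- The constants need not be monotone in M, so those of all integers up to ⌈x⌉ are summed and y =
  -- ⌈x⌉ is used. The summand x gives strict growth, the summand 1 positivity.
  refine ⟨fun x => x + (1 + ∑ j ∈ Finset.range (⌈x⌉₊ + 1), A j), fun x y hxy => ?_, fun x => ?_,
    fun x => ⟨(⌈x⌉₊ : ℝ≥0), Nat.le_ceil x, ?_⟩⟩
  · refine add_lt_add_of_lt_of_le hxy ?_
    gcongr
  · positivity
  · have := Finset.single_le_sum (f := fun j : ℕ => A j) (fun _ _ => zero_le)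
      (Finset.self_mem_range_succ ⌈x⌉₊)
    exact this.trans (le_add_self.trans le_add_self)

end HeleShaw

end

/-! ### The pressure estimate for the full gradient. -/

theorem proposition2p1 (d : ℕ) (hd : d = 2 ∨ d = 3)
    (η : ℝ → ℝ) (hη : ContDiff ℝ ∞ η)
    (lam Lam : ℝ) (hlam : 0 < lam) (hbound : ∀ r : ℝ, lam ≤ η r ∧ η r ≤ Lam)
    (C : ℝ) (s : ℝ) (hs : 0 ≤ s) :
    ∃ F : ℝ≥0 → ℝ≥0, StrictMono F ∧
      ∀ c p : Torus d → ℝ, MemSobolev (s + 2) c → IsSmoothPressure η C c p →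
        sobolevNormVec s (grad p) ≤
          (F (eLpNorm c ∞ (torusMeasure d)).toNNReal : ℝ≥0∞)
            * (1 + eLpNorm (weakGrad c) ∞ (torusMeasure d))
            * (1 + sobolevNorm 2 c) ^ (⌊2 * s⌋₊ + 1)
            * sobolevNorm (s + 2) c := by
  have hd3 : d ≤ 3 := by omega
  choose A hA using fun M : ℝ≥0 => exists_pressure_le d hd3 hη hlam hbound C hs M
  obtain ⟨F, hF, hF0, hFA⟩ := exists_strictMono_ge A
  refine ⟨F, hF, fun c p hc hp => ?_⟩
  have hc2 : MemSobolev 2 c := hc.mono (by linarith)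
  rw [sobolevNorm_eq_hn, sobolevNorm_eq_hn]
  set M := eLpNorm c ∞ (torusMeasure d)
  -- For an unbounded gradient the right side equals ∞, provided the other factors are nonzero,
  -- since 0 · ∞ = 0 in [0, ∞].
  rcases eq_or_ne (eLpNorm (weakGrad c) ∞ (torusMeasure d)) ⊤ with hK | hK
  · have hT : hn (s + 2) (fun x => (c x : ℂ)) ≠ 0 := by
      intro h
      have e : s + 2 = s + 1 + 1 := by ring
      rw [e] at h hc
      rw [eLpNorm_weakGrad_eq_zero (by linarith) hc h] at hK
      exact ENNReal.zero_ne_top hK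
    rw [hK, add_top, ENNReal.mul_top (by exact_mod_cast (hF0 _).ne'),
      ENNReal.top_mul (pow_ne_zero _ (zero_lt_one.trans_le le_self_add).ne'), ENNReal.top_mul hT]
    exact le_top
  · obtain ⟨y, hy, hyF⟩ := hFA M.toNNReal
    -- The norm ‖c‖_∞ is finite by the embedding of H², so its `toNNReal` is faithful.
    have hMy : M ≤ y := (ENNReal.coe_toNNReal (hc2.eLpNorm_top_lt_top hd3).ne).ge.trans
      (ENNReal.coe_le_coe.2 hy)
    refine (sobolevNormVec_le_sum s _).trans ?_
    simp_rw [sobolevNorm_eq_hn]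
    refine (hA y c p hc hp hMy hK.lt_top).trans ?_
    gcongr
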